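/- Let $s>5/2$ and $S^1=\mathbb R/\mathbb Z$, $S^1_{4\pi}=\mathbb R/4\pi\mathbb Z$. All manifolds are real Banach manifolds. **The spaces $G^s$ and $K^s$.** $\mathrm{Diff}_0^s(S^1)=\{\varphi=\mathrm{id}+h : h\in H^s(S^1;\mathbb R),\ h(0)=0,\ h_x>-1\}$ is regarded as an open subset of an affine space over $H^s_0(S^1;\mathbb R)=\{h\in H^s(S^1;\mathbb R): h(0)=0\}$. $H^{s-1}(S^1;S^1_{4\pi})$ is the group of maps $S^1\to S^1_{4\pi}$ of class $H^{s-1}$, a manifold modelled on $H^{s-1}(S^1;\mathbb R)$ through the charts $\alpha+h\mapsto h$ ($|h|<2\pi$), and $H^{s-1}(S^1;S^1_{4\pi})/S^1_{4\pi}$ is its quotient by the constants, modelled on $H^{s-1}(S^1;\mathbb R)/\mathbb R$. Let $$G^s=\mathrm{Diff}_0^s(S^1)\times H^{s-1}(S^1;S^1_{4\pi}),\qquad K^s=\mathrm{Diff}_0^s(S^1)\times\bigl(H^{s-1}(S^1;S^1_{4\pi})/S^1_{4\pi}\bigr),\qquad p(\varphi,\alpha)=(\varphi,[\alpha]),$$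 with the weak Riemannian metrics $$\langle U,V\rangle_{(\varphi,\alpha)}=\tfrac14\int_{S^1}\Bigl(\tfrac{U_{1x}V_{1x}}{\varphi_x}+U_2V_2\varphi_x\Bigr)dx,\qquad \langle (U_1,[U_2]),(V_1,[V_2])\rangle_{(\varphi,[\alpha])}=\tfrac14\int_{S^1}\Bigl(\tfrac{U_{1x}V_{1x}}{\varphi_x}+\pi(U_2)\pi(V_2)\varphi_x\Bigr)dx,$$ where $\pi(U_2)=U_2-\int_{S^1}U_2\varphi_x\,dx$. **The sphere and projective space.** For $r>1/2$ let $S^{\infty,r}=\{f\in H^r(S^1;\mathbb C):\int|f|^2dx=1\}$, with the manifold structure given by the two stereographic projections from $\pm1$ and the metric $\langle X,Y\rangle_{L^2}=\mathrm{Re}\int X\bar Y\,dx$. Let $\mathbb{CP}^{\infty,r}=(H^r(S^1;\mathbb C)\setminus\{0\})/\mathbb C^*$, with the charts $[f]\mapsto f(\cdot+x_0)/f(x_0)$ on $\{[f]: f(x_0)\ne0\}$, $x_0\in S^1$, and let $q:S^{\infty,r}\to\mathbb{CP}^{\infty,r}$, $q(f)=[f]$. The Fubini–Study metric is $\langle Tq(X),Tq(Y)\rangle_{FS}=\langle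 X^h,Y^h\rangle_{L^2}$ for $X,Y\in T_fS^{\infty,r}$, where $X^h=X+if\,\mathrm{Im}\int f\bar X\,dx$ is the component of $X$ orthogonal to $if$. Let $\mathcal U^r\subset S^{\infty,r}$ be the subset of nowhere vanishing functions and $\mathcal V^r=q(\mathcal U^r)$. A smooth submersion $F:M\to N$ of weak Riemannian manifolds is a *Riemannian submersion* if, for every $x\in M$, $T_xF$ restricts to an isometry of $(\ker T_xF)^\perp$ onto $T_{F(x)}N$. **Theorem.** The formulas $$\Phi(\varphi,\alpha)=\sqrt{\varphi_x}\,e^{i\alpha/2},\qquad \Psi(\varphi,[\alpha])=\bigl[\sqrt{\varphi_x}\,e^{i\alpha/2}\bigr]$$ give well-defined maps $\Phi:G^s\to S^{\infty,s-1}$ and $\Psi:K^s\to\mathbb{CP}^{\infty,s-1}$ such that: 1. $\mathcal V^{s-1}$ is open in $\mathbb{CP}^{\infty,s-1}$, and $\Psi$ is a smooth diffeomorphism from $K^s$ onto $\mathcal V^{s-1}$ and an isometry for the Fubini–Study metric on $\mathcal V^{s-1}$. 2. $\mathcal U^{s-1}$ is open in $S^{\infty,s-1}$, and $\Phi$ is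 a smooth diffeomorphism from $G^s$ onto $\mathcal U^{s-1}$ and an isometry for the $L^2$ metric. 3. The projections $p:G^s\to K^s$, $q:S^{\infty,s}\to\mathbb{CP}^{\infty,s}$ and $q:S^{\infty,s-1}\to\mathbb{CP}^{\infty,s-1}$ are Riemannian submersions. 4. $q\circ\Phi=\Psi\circ p$. 5. The fibres of $p$ are the orbits of the action $(\varphi,\alpha)\mapsto(\varphi,\alpha+\theta)$ of $\theta\in S^1_{4\pi}$ on $G^s$, the fibres of $q:S^{\infty,s-1}\to\mathbb{CP}^{\infty,s-1}$ are the orbits of the action $f\mapsto e^{i\theta/2}f$, and $\Phi$ is equivariant: $\Phi(\varphi,\alpha+\theta)=e^{i\theta/2}\Phi(\varphi,\alpha)$. -/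

import Mathlib

open scoped Manifold ContDiff Topology LinearAlgebra.Projectivization

set_option linter.unusedSectionVars false

noncomputable section

namespace TwoHS

/-- The weight `(1 + n²)^{r/2}`. -/
def wt (r : ℝ) (n : ℤ) : ℝ := (1 + (n : ℝ) ^ 2) ^ (r / 2)

theorem wt_pos (r : ℝ) (n : ℤ) : 0 < wt r n := by unfold wt; positivity

theorem fourierCoeff_add' (f g : C(UnitAddCircle, ℂ)) (n : ℤ) :
    fourierCoeff (⇑(f + g)) n = fourierCoeff (⇑f) n + fourierCoeff (⇑g) n := by
  have hi : ∀ f : C(UnitAddCircle, ℂ), MeasureTheory.Integrable (⇑f)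
      (AddCircle.haarAddCircle (T := 1)) := fun f =>
    f.continuous.integrable_of_hasCompactSupport (HasCompactSupport.of_compactSpace _)
  rw [ContinuousMap.coe_add, fourierCoeff.add (hi f) (hi g)]; rfl

theorem fourierCoeff_smul' (c : ℂ) (f : C(UnitAddCircle, ℂ)) (n : ℤ) :
    fourierCoeff (⇑(c • f)) n = c • fourierCoeff (⇑f) n := by
  rw [ContinuousMap.coe_smul]; exact fourierCoeff.const_smul _ _ _

/-- The Sobolev space `H^r(S¹; ℂ)`, `r > 1/2`, as a space of continuous functions on
`S¹ = ℝ/ℤ`: the functions `f` with `∑ (1 + n²)^r |f̂(n)|² < ∞`. -/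
def sobolev (r : ℝ) : Submodule ℂ C(UnitAddCircle, ℂ) where
  carrier := {f | Memℓp (fun n : ℤ => (wt r n : ℂ) * fourierCoeff f n) 2}
  zero_mem' := by
    have : (fun n : ℤ => (wt r n : ℂ) * fourierCoeff (⇑(0 : C(UnitAddCircle, ℂ))) n) = 0 := by
      funext n; simp [fourierCoeff]
    simp only [Set.mem_ofPred_eq, this]; exact zero_memℓp
  add_mem' := by
    intro f g hf hg
    have := Memℓp.add hf hg
    simp only [Set.mem_ofPred_eq]
    convert this using 1
    funext n; simp only [fourierCoeff_add', Pi.add_apply]; ring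
  smul_mem' := by
    intro c f hf
    have := Memℓp.const_smul hf c
    simp only [Set.mem_ofPred_eq]
    convert this using 1
    funext n; simp only [fourierCoeff_smul', Pi.smul_apply, smul_eq_mul]; ring

/-- The Hilbert space `H^r(S¹; ℂ)`, with norm `‖f‖² = ∑ (1 + n²)^r |f̂(n)|²`. -/
def HC (r : ℝ) : Type := sobolev r

instance (r : ℝ) : AddCommGroup (HC r) := inferInstanceAs (AddCommGroup (sobolev r))
instance (r : ℝ) : Module ℂ (HC r) := inferInstanceAs (Module ℂ (sobolev r))

namespace HC

variable {r : ℝ}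

/-- The underlying continuous function. -/
def toC : HC r →ₗ[ℂ] C(UnitAddCircle, ℂ) := (sobolev r).subtype

theorem toC_injective : Function.Injective (toC : HC r → _) := Subtype.val_injective

instance : FunLike (HC r) UnitAddCircle ℂ where
  coe f := toC f
  coe_injective _ _ h := toC_injective (DFunLike.coe_injective h)

theorem mem (f : HC r) : Memℓp (fun n : ℤ => (wt r n : ℂ) * fourierCoeff (⇑f) n) 2 := f.2

/-- The function with a given continuous representative. -/
def mk (f : C(UnitAddCircle, ℂ)) (hf : f ∈ sobolev r) : HC r := ⟨f, hf⟩

@[simp] theorem mk_apply (f : C(UnitAddCircle, ℂ)) (hf : f ∈ sobolev r) (x : UnitAddCircle) :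
    mk f hf x = f x := rfl
@[simp] theorem toC_apply (f : HC r) (x : UnitAddCircle) : toC f x = f x := rfl
theorem coe_toC (f : HC r) : ⇑(toC f) = ⇑f := rfl
@[simp] theorem add_apply (f g : HC r) (x : UnitAddCircle) : (f + g) x = f x + g x := rfl
@[simp] theorem sub_apply (f g : HC r) (x : UnitAddCircle) : (f - g) x = f x - g x := by
  rw [← toC_apply, map_sub]; rfl
@[simp] theorem neg_apply (f : HC r) (x : UnitAddCircle) : (-f) x = -f x := by
  rw [← toC_apply, map_neg]; rfl
@[simp] theorem zero_apply (x : UnitAddCircle) : (0 : HC r) x = 0 := rfl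
@[simp] theorem smul_apply (c : ℂ) (f : HC r) (x : UnitAddCircle) : (c • f) x = c * f x := rfl
@[simp] theorem real_smul_apply (c : ℝ) (f : HC r) (x : UnitAddCircle) :
    (c • f) x = c * f x := rfl

@[ext] theorem ext {f g : HC r} (h : ∀ x, f x = g x) : f = g := DFunLike.ext _ _ h

/-- The weighted sequence of Fourier coefficients. -/
def coeffs : HC r →ₗ[ℂ] lp (fun _ : ℤ => ℂ) 2 where
  toFun f := ⟨fun n => (wt r n : ℂ) * fourierCoeff (⇑f) n, f.mem⟩
  map_add' f g := by
    ext n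
    change (wt r n : ℂ) * fourierCoeff (⇑(toC f + toC g)) n = _
    rw [fourierCoeff_add', mul_add]; rfl
  map_smul' c f := by
    ext n
    change (wt r n : ℂ) * fourierCoeff (⇑(c • toC f)) n = _
    rw [fourierCoeff_smul', smul_eq_mul, mul_left_comm]; rfl

theorem coeffs_apply (f : HC r) (n : ℤ) :
    (coeffs f : ∀ _ : ℤ, ℂ) n = (wt r n : ℂ) * fourierCoeff (⇑f) n := rfl

theorem eq_zero_of_fourierCoeff (f : C(UnitAddCircle, ℂ)) (h : ∀ n, fourierCoeff (⇑f) n = 0) :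
    f = 0 := by
  have h0 : fourierCoeff (⇑f) = 0 := funext h
  have h1 : Summable (fourierCoeff (⇑f)) := by rw [h0]; exact summable_zero
  have h2 := hasSum_fourier_series_of_summable h1
  have h3 : (fun n : ℤ => fourierCoeff (⇑f) n • fourier (T := 1) n)
      = fun _ => (0 : C(UnitAddCircle, ℂ)) := by
    funext n; rw [h n]; ext x; simp
  rw [h3] at h2
  exact h2.unique hasSum_zero

theorem coeffs_injective : Function.Injective (coeffs : HC r → _) := by
  rw [← LinearMap.ker_eq_bot, LinearMap.ker_eq_bot']
  intro f hf
  apply toC_injective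
  rw [map_zero]
  apply eq_zero_of_fourierCoeff
  intro n
  have h1 : (coeffs f : ∀ _ : ℤ, ℂ) n = 0 := by rw [hf]; rfl
  rw [coeffs_apply] at h1
  have := (wt_pos r n).ne'
  simpa [this, coe_toC] using h1

end HC

instance (r : ℝ) : NormedAddCommGroup (HC r) :=
  NormedAddCommGroup.induced (HC r) (lp (fun _ : ℤ => ℂ) 2) HC.coeffs HC.coeffs_injective

instance (r : ℝ) : NormedSpace ℂ (HC r) :=
  NormedSpace.induced ℂ (HC r) (lp (fun _ : ℤ => ℂ) 2) HC.coeffs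


namespace HC
variable {r : ℝ}

theorem norm_def (f : HC r) : ‖f‖ = ‖coeffs f‖ := rfl

theorem summable_wt [hr : Fact (1 / 2 < r)] : Summable fun n : ℤ => (wt r n)⁻¹ ^ 2 := by
  have h := hr.out
  have h1 : Summable fun n : ℤ => |(n : ℝ)| ^ (-(2 * r)) := by
    simpa using Real.summable_abs_int_rpow (b := 2 * r) (by linarith)
  refine Summable.of_norm_bounded_eventually h1 ?_
  have h2 : ({0}ᶜ : Set ℤ) ∈ Filter.cofinite := (Set.finite_singleton 0).compl_mem_cofinite
  filter_upwards [h2] with n hn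
  have hn' : (0 : ℝ) < |(n : ℝ)| := by simpa using hn
  rw [Real.norm_of_nonneg (by positivity)]
  unfold wt
  rw [← Real.rpow_neg (by positivity), ← Real.rpow_natCast, ← Real.rpow_mul (by positivity)]
  have e : |(n : ℝ)| ^ (-(2 * r)) = (|(n : ℝ)| ^ 2) ^ (-r) := by
    rw [← Real.rpow_natCast, ← Real.rpow_mul (by positivity)]; congr 1; push_cast; ring
  rw [e, sq_abs]
  have : -(r / 2) * ((2 : ℕ) : ℝ) = -r := by push_cast; ring
  rw [this]
  apply Real.rpow_le_rpow_of_nonpos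
  · rw [← sq_abs]; positivity
  · linarith
  · linarith


theorem norm_fourier_apply (n : ℤ) (a : UnitAddCircle) : ‖fourier n a‖ = 1 := by
  rw [fourier_apply]; exact Circle.norm_coe _

theorem summable_mul_of_sq {u : ℤ → ℝ} (hu : ∀ n, 0 ≤ u n) (hs : Summable fun n => u n ^ 2)
    (f : HC r) :
    (Summable fun n => u n * (wt r n * ‖fourierCoeff (⇑f) n‖)) ∧
      ∑' n, u n * (wt r n * ‖fourierCoeff (⇑f) n‖) ≤ Real.sqrt (∑' n, u n ^ 2) * ‖f‖ := by
  have hn : ∀ n, wt r n * ‖fourierCoeff (⇑f) n‖ = ‖(coeffs f : ∀ _ : ℤ, ℂ) n‖ := by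
    intro n
    rw [coeffs_apply, norm_mul, Complex.norm_real, Real.norm_of_nonneg (wt_pos r n).le]
  simp only [hn]
  have hc : Summable fun n => ‖(coeffs f : ∀ _ : ℤ, ℂ) n‖ ^ (2 : ℝ) := by
    simpa using (lp.memℓp (coeffs f)).summable (by norm_num)
  have key := Real.inner_le_Lp_mul_Lq_tsum_of_nonneg Real.HolderConjugate.two_two hu
    (fun n => norm_nonneg ((coeffs f : ∀ _ : ℤ, ℂ) n)) (by simpa using hs) hc
  refine ⟨Real.summable_mul_of_Lp_Lq_of_nonneg Real.HolderConjugate.two_two hu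
    (fun n => norm_nonneg ((coeffs f : ∀ _ : ℤ, ℂ) n)) (by simpa using hs) hc,
    key.trans (le_of_eq ?_)⟩
  rw [norm_def, lp.norm_eq_tsum_rpow (by norm_num), Real.sqrt_eq_rpow]
  simp

theorem summable_coeff [Fact (1 / 2 < r)] (f : HC r) :
    (Summable fun n => ‖fourierCoeff (⇑f) n‖) ∧
      ∑' n, ‖fourierCoeff (⇑f) n‖ ≤ Real.sqrt (∑' n : ℤ, (wt r n)⁻¹ ^ 2) * ‖f‖ := by
  have := summable_mul_of_sq (fun n => (inv_pos.2 (wt_pos r n)).le) summable_wt f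
  have e : ∀ n, (wt r n)⁻¹ * (wt r n * ‖fourierCoeff (⇑f) n‖) = ‖fourierCoeff (⇑f) n‖ := by
    intro n; rw [inv_mul_cancel_left₀ (wt_pos r n).ne']
  simpa only [e] using this

theorem hasSum_apply [Fact (1 / 2 < r)] (f : HC r) (x : UnitAddCircle) :
    HasSum (fun n => fourierCoeff (⇑f) n * fourier n x) (f x) :=
  has_pointwise_sum_fourier_series_of_summable (f := toC f) (summable_coeff f).1.of_norm x

/-- The constant in the embedding `H^r ⊂ C`. -/
def embC (r : ℝ) : ℝ := Real.sqrt (∑' n : ℤ, (wt r n)⁻¹ ^ 2)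

theorem norm_apply_le [Fact (1 / 2 < r)] (f : HC r) (x : UnitAddCircle) :
    ‖f x‖ ≤ embC r * ‖f‖ := by
  rw [← (hasSum_apply f x).tsum_eq]
  refine le_trans (norm_tsum_le_tsum_norm ?_) (le_trans (le_of_eq ?_) (summable_coeff f).2)
  · simpa only [norm_mul, norm_fourier_apply, mul_one] using (summable_coeff f).1
  · simp only [norm_mul, norm_fourier_apply, mul_one]

/-- The embedding of `H^r` into the continuous functions. -/
def toCL [Fact (1 / 2 < r)] : HC r →L[ℂ] C(UnitAddCircle, ℂ) :=
  toC.mkContinuous (embC r) fun f => by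
    exact (ContinuousMap.norm_le _ (mul_nonneg (Real.sqrt_nonneg _) (norm_nonneg f))).2
      fun x => norm_apply_le f x

@[simp] theorem toCL_apply [Fact (1 / 2 < r)] (f : HC r) (x : UnitAddCircle) :
    toCL f x = f x := rfl

/-- Evaluation at a point. -/
def evalL [Fact (1 / 2 < r)] (x : UnitAddCircle) : HC r →L[ℂ] ℂ :=
  (ContinuousMap.evalCLM ℂ x).comp toCL

@[simp] theorem evalL_apply [Fact (1 / 2 < r)] (x : UnitAddCircle) (f : HC r) :
    evalL x f = f x := rfl

/-- The termwise derivative of the Fourier series. -/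
def dseries (f : HC r) (x : UnitAddCircle) : ℂ :=
  ∑' n : ℤ, fourierCoeff (⇑f) n * (2 * Real.pi * Complex.I * n * fourier n x)

theorem norm_term (f : HC r) (x : UnitAddCircle) (n : ℤ) :
    ‖fourierCoeff (⇑f) n * (2 * Real.pi * Complex.I * n * fourier n x)‖
      = 2 * Real.pi * |(n : ℝ)| * ‖fourierCoeff (⇑f) n‖ := by
  rw [norm_mul, norm_mul, norm_fourier_apply]
  simp [abs_of_pos Real.pi_pos]; ring

theorem summable_dcoeff [hr : Fact (1 / 2 < r - 1)] (f : HC r) :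
    (Summable fun n : ℤ => 2 * Real.pi * |(n : ℝ)| * ‖fourierCoeff (⇑f) n‖) ∧
      ∑' n : ℤ, 2 * Real.pi * |(n : ℝ)| * ‖fourierCoeff (⇑f) n‖
        ≤ 2 * Real.pi * embC (r - 1) * ‖f‖ := by
  have hle : ∀ n : ℤ, |(n : ℝ)| * ‖fourierCoeff (⇑f) n‖ ≤
      (wt (r - 1) n)⁻¹ * (wt r n * ‖fourierCoeff (⇑f) n‖) := by
    intro n
    rw [← mul_assoc]
    refine mul_le_mul_of_nonneg_right ?_ (norm_nonneg _)
    unfold wt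
    rw [← Real.rpow_neg (by positivity), ← Real.rpow_add (by positivity)]
    have : -((r - 1) / 2) + r / 2 = 1 / 2 := by ring
    rw [this, ← Real.sqrt_eq_rpow]
    apply Real.abs_le_sqrt; linarith
  obtain ⟨h1, h2⟩ :=
    summable_mul_of_sq (fun n => (inv_pos.2 (wt_pos (r - 1) n)).le) (summable_wt (r := r - 1)) f
  have h3 : Summable fun n : ℤ => |(n : ℝ)| * ‖fourierCoeff (⇑f) n‖ :=
    Summable.of_nonneg_of_le (fun n => by positivity) hle h1
  simp only [mul_assoc]
  refine ⟨(h3.mul_left _).mul_left _, ?_⟩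
  rw [tsum_mul_left, tsum_mul_left]
  have := (h3.tsum_le_tsum hle h1).trans h2
  unfold embC
  gcongr

theorem hasDerivAt_apply [Fact (1 / 2 < r)] [Fact (1 / 2 < r - 1)] (f : HC r)
    (x : UnitAddCircle) (t : ℝ) :
    HasDerivAt (fun t : ℝ => f (x + (t : UnitAddCircle))) (dseries f (x + (t : UnitAddCircle))) t := by
  induction x using QuotientAddGroup.induction_on with
  | H a =>
  have e : (fun t : ℝ => f (((a : ℝ) : UnitAddCircle) + (t : UnitAddCircle))) = fun t : ℝ =>
      ∑' n : ℤ, fourierCoeff (⇑f) n * fourier n ((a + t : ℝ) : UnitAddCircle) := by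
    funext t
    rw [(hasSum_apply f _).tsum_eq]; rfl
  change HasDerivAt (fun t : ℝ => f (((a : ℝ) : UnitAddCircle) + (t : UnitAddCircle))) _ _
  rw [e]
  refine hasDerivAt_tsum (summable_dcoeff f).1 (g := fun n t => fourierCoeff (⇑f) n *
      fourier n ((a + t : ℝ) : UnitAddCircle)) (g' := fun n t => fourierCoeff (⇑f) n *
      (2 * Real.pi * Complex.I * n * fourier n ((a + t : ℝ) : UnitAddCircle))) ?_ ?_ (y₀ := 0) ?_ t
  · intro n y
    have := (hasDerivAt_fourier 1 n (a + y)).comp_const_add a y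
    simpa using! this.const_mul (fourierCoeff (⇑f) n)
  · intro n y
    exact (norm_term f _ n).le
  · simpa using! (hasSum_apply f ((a + 0 : ℝ) : UnitAddCircle)).summable

theorem norm_dseries_le [Fact (1 / 2 < r - 1)] (f : HC r) (x : UnitAddCircle) :
    ‖dseries f x‖ ≤ 2 * Real.pi * embC (r - 1) * ‖f‖ := by
  refine le_trans (norm_tsum_le_tsum_norm ?_) ?_
  · simpa only [norm_term] using (summable_dcoeff f).1
  · simpa only [norm_term] using (summable_dcoeff f).2

theorem continuous_dseries [Fact (1 / 2 < r - 1)] (f : HC r) : Continuous (dseries f) :=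
  continuous_tsum (fun n => by fun_prop) (summable_dcoeff f).1 fun n x => (norm_term f x n).le

theorem fourierCoeff_translate (f : C(UnitAddCircle, ℂ)) (a : UnitAddCircle) (n : ℤ) :
    fourierCoeff (fun x => f (x + a)) n = fourier n a * fourierCoeff (⇑f) n := by
  unfold fourierCoeff
  rw [← MeasureTheory.integral_add_right_eq_self
    (fun t : UnitAddCircle => fourier (-n) t • f t) a, ← MeasureTheory.integral_const_mul]
  congr 1; funext t
  have h : fourier n a * fourier (-n) (t + a) = fourier (-n) t := by
    simp only [fourier_apply, smul_add, AddCircle.toCircle_add, Circle.coe_mul]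
    rw [mul_left_comm, ← Circle.coe_mul, ← AddCircle.toCircle_add]; simp
  simp only [smul_eq_mul]
  rw [← mul_assoc, h]

theorem translate_mem (f : HC r) (a : UnitAddCircle) :
    (toC f).comp ⟨fun x : UnitAddCircle => x + a, by fun_prop⟩ ∈ sobolev r := by
  have := f.mem
  change Memℓp _ 2
  rw [memℓp_gen_iff (by norm_num)] at this ⊢
  refine this.congr fun n => ?_
  have := fourierCoeff_translate (toC f) a n
  simp only [ContinuousMap.coe_comp, Function.comp_def, ContinuousMap.coe_mk, norm_mul]
  rw [this, norm_mul, norm_fourier_apply, one_mul]; rfl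

/-- The translation `f ↦ f(· + a)`. -/
def translate (a : UnitAddCircle) : HC r →L[ℂ] HC r :=
  LinearMap.mkContinuous
    { toFun := fun f => mk _ (translate_mem f a)
      map_add' := fun f g => by ext x; rfl
      map_smul' := fun c f => by ext x; rfl } 1 fun f => by
    rw [one_mul, norm_def, norm_def, lp.norm_eq_tsum_rpow (by norm_num),
      lp.norm_eq_tsum_rpow (by norm_num)]
    apply le_of_eq
    congr 2; funext n
    have h := fourierCoeff_translate (toC f) a n
    congr 1
    rw [coeffs_apply, coeffs_apply, norm_mul, norm_mul]
    congr 1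
    have h2 : fourierCoeff (⇑(mk _ (translate_mem f a))) n = fourier n a * fourierCoeff (⇑f) n := h
    change ‖fourierCoeff (⇑(mk _ (translate_mem f a))) n‖ = _
    rw [h2, norm_mul, norm_fourier_apply, one_mul]

@[simp] theorem translate_apply (a : UnitAddCircle) (f : HC r) (x : UnitAddCircle) :
    translate a f x = f (x + a) := rfl

theorem const_mem (c : ℂ) : ContinuousMap.const UnitAddCircle c ∈ sobolev r := by
  change Memℓp _ 2
  have h : ∀ n : ℤ, n ≠ 0 → fourierCoeff (⇑(ContinuousMap.const UnitAddCircle c)) n = 0 := by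
    intro n hn
    have h1 := fourierCoeff_fourier (T := 1) 0
    have e : ⇑(ContinuousMap.const UnitAddCircle c) = c • ⇑(fourier (T := 1) 0) := by
      funext x; simp
    rw [e, fourierCoeff.const_smul, h1]; simp [hn]
  rw [memℓp_gen_iff (by norm_num)]
  refine summable_of_ne_finset_zero (s := {0}) fun n hn => ?_
  rw [h n (by simpa using hn)]; simp

/-- The constant function. -/
def const (c : ℂ) : HC r := mk _ (const_mem c)

@[simp] theorem const_apply (c : ℂ) (x : UnitAddCircle) : (const c : HC r) x = c := rfl

end HC
end TwoHS

namespace TwoHS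

instance instFactHalf (s : ℝ) [h : Fact (5 / 2 < s)] : Fact (1 / 2 < s) := ⟨by linarith [h.out]⟩
instance instFactHalfSub (s : ℝ) [h : Fact (5 / 2 < s)] : Fact (1 / 2 < s - 1) :=
  ⟨by linarith [h.out]⟩

/-! ### Real-valued Sobolev functions -/

/-- Real continuous functions, seen as complex ones. -/
def complexify : C(UnitAddCircle, ℝ) →ₗ[ℝ] C(UnitAddCircle, ℂ) where
  toFun f := ⟨fun x => (f x : ℂ), by fun_prop⟩
  map_add' f g := by ext x; simp
  map_smul' c f := by ext x; simp

theorem complexify_injective : Function.Injective complexify := by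
  intro f g h
  ext x
  have := congrArg (fun k : C(UnitAddCircle, ℂ) => k x) h
  exact Complex.ofReal_injective this

/-- The real-valued functions of class `H^r` on `S¹`. -/
def sobolevR (r : ℝ) : Submodule ℝ C(UnitAddCircle, ℝ) :=
  ((sobolev r).restrictScalars ℝ).comap complexify

/-- The Hilbert space `H^r(S¹; ℝ)`, with the norm of `H^r(S¹; ℂ)`. -/
def HR (r : ℝ) : Type := sobolevR r

instance (r : ℝ) : AddCommGroup (HR r) := inferInstanceAs (AddCommGroup (sobolevR r))
instance (r : ℝ) : Module ℝ (HR r) := inferInstanceAs (Module ℝ (sobolevR r))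

namespace HR
variable {r : ℝ}

/-- The underlying continuous function. -/
def toC : HR r →ₗ[ℝ] C(UnitAddCircle, ℝ) := (sobolevR r).subtype

theorem toC_injective : Function.Injective (toC : HR r → _) := Subtype.val_injective

instance : FunLike (HR r) UnitAddCircle ℝ where
  coe f := toC f
  coe_injective _ _ h := toC_injective (DFunLike.coe_injective h)

/-- The function with a given continuous representative. -/
def mk (f : C(UnitAddCircle, ℝ)) (hf : f ∈ sobolevR r) : HR r := ⟨f, hf⟩

/-- The inclusion `H^r(S¹; ℝ) ⊂ H^r(S¹; ℂ)`. -/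
def toHC : HR r →ₗ[ℝ] HC r where
  toFun f := HC.mk (complexify (toC f)) f.2
  map_add' f g := by ext x; simp [complexify]
  map_smul' c f := by ext x; simp [complexify]

theorem toHC_injective : Function.Injective (toHC : HR r → _) := by
  intro f g h
  exact toC_injective (complexify_injective (congrArg HC.toC h))

@[simp] theorem mk_apply (f : C(UnitAddCircle, ℝ)) (hf : f ∈ sobolevR r) (x : UnitAddCircle) :
    mk f hf x = f x := rfl
@[simp] theorem toC_apply (f : HR r) (x : UnitAddCircle) : toC f x = f x := rfl
@[simp] theorem toHC_apply (f : HR r) (x : UnitAddCircle) : toHC f x = (f x : ℂ) := rfl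
@[simp] theorem add_apply (f g : HR r) (x : UnitAddCircle) : (f + g) x = f x + g x := rfl
@[simp] theorem sub_apply (f g : HR r) (x : UnitAddCircle) : (f - g) x = f x - g x := by
  rw [← toC_apply, map_sub]; rfl
@[simp] theorem neg_apply (f : HR r) (x : UnitAddCircle) : (-f) x = -f x := by
  rw [← toC_apply, map_neg]; rfl
@[simp] theorem zero_apply (x : UnitAddCircle) : (0 : HR r) x = 0 := rfl
@[simp] theorem smul_apply (c : ℝ) (f : HR r) (x : UnitAddCircle) : (c • f) x = c * f x := rfl

@[ext] theorem ext {f g : HR r} (h : ∀ x, f x = g x) : f = g := DFunLike.ext _ _ h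

theorem continuous_coe (f : HR r) : Continuous (⇑f) := (toC f).continuous

end HR

instance (r : ℝ) : NormedAddCommGroup (HR r) :=
  NormedAddCommGroup.induced (HR r) (HC r) HR.toHC HR.toHC_injective

instance (r : ℝ) : NormedSpace ℝ (HR r) :=
  NormedSpace.induced ℝ (HR r) (HC r) HR.toHC

/-- The derivative of a function on `S¹ = ℝ/ℤ`. -/
def dx (f : UnitAddCircle → ℝ) (x : UnitAddCircle) : ℝ :=
  deriv (fun t : ℝ => f (x + (t : UnitAddCircle))) 0

namespace HR
variable {r : ℝ}

theorem norm_toHC (f : HR r) : ‖toHC f‖ = ‖f‖ := rfl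

theorem abs_apply_le [Fact (1 / 2 < r)] (f : HR r) (x : UnitAddCircle) :
    |f x| ≤ HC.embC r * ‖f‖ := by
  simpa [norm_toHC] using HC.norm_apply_le (toHC f) x

/-- Evaluation at a point. -/
def evalL [Fact (1 / 2 < r)] (x : UnitAddCircle) : HR r →L[ℝ] ℝ :=
  LinearMap.mkContinuous
    { toFun := fun f => f x
      map_add' := fun _ _ => rfl
      map_smul' := fun _ _ => rfl } (HC.embC r) fun f => abs_apply_le f x

@[simp] theorem evalL_apply [Fact (1 / 2 < r)] (x : UnitAddCircle) (f : HR r) :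
    evalL x f = f x := rfl

theorem hasDerivAt_apply [Fact (1 / 2 < r)] [Fact (1 / 2 < r - 1)] (f : HR r)
    (x : UnitAddCircle) :
    HasDerivAt (fun t : ℝ => f (x + (t : UnitAddCircle))) (HC.dseries (toHC f) x).re 0 := by
  have h := HC.hasDerivAt_apply (toHC f) x 0
  have h2 := (Complex.reCLM.hasFDerivAt.comp_hasDerivAt (0 : ℝ) h)
  simpa [Function.comp_def] using! h2

theorem dx_eq [Fact (1 / 2 < r)] [Fact (1 / 2 < r - 1)] (f : HR r) (x : UnitAddCircle) :
    dx f x = (HC.dseries (toHC f) x).re := (hasDerivAt_apply f x).deriv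

theorem dx_sub [Fact (1 / 2 < r)] [Fact (1 / 2 < r - 1)] (f g : HR r) (x : UnitAddCircle) :
    dx ⇑(f - g) x = dx f x - dx g x := by
  have h := ((hasDerivAt_apply f x).sub (hasDerivAt_apply g x)).deriv
  rw [dx_eq f, dx_eq g, ← h]
  unfold dx
  congr 1

theorem abs_dx_le [Fact (1 / 2 < r)] [Fact (1 / 2 < r - 1)] (f : HR r) (x : UnitAddCircle) :
    |dx f x| ≤ 2 * Real.pi * HC.embC (r - 1) * ‖f‖ := by
  rw [dx_eq]
  exact (Complex.abs_re_le_norm _).trans (HC.norm_dseries_le _ _)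

theorem continuous_dx [Fact (1 / 2 < r)] [Fact (1 / 2 < r - 1)] (f : HR r) :
    Continuous (dx f) := by
  have : dx f = fun x => (HC.dseries (toHC f) x).re := funext (dx_eq f)
  rw [this]
  exact Complex.continuous_re.comp (HC.continuous_dseries _)

theorem const_mem (c : ℝ) : ContinuousMap.const UnitAddCircle c ∈ sobolevR r :=
  HC.const_mem (c : ℂ)

/-- The constant function. -/
def const (c : ℝ) : HR r := mk _ (const_mem c)

@[simp] theorem const_apply (c : ℝ) (x : UnitAddCircle) : (const c : HR r) x = c := rfl

end HR

/-- The closed subspace `H^s_0(S¹; ℝ)` of the functions vanishing at `0`. -/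
def H0R (s : ℝ) : Submodule ℝ (HR s) where
  carrier := {u | u 0 = 0}
  zero_mem' := rfl
  add_mem' := by
    intro u v (hu : u 0 = 0) (hv : v 0 = 0)
    change (u + v) 0 = 0
    simp [hu, hv]
  smul_mem' := by
    intro c u (hu : u 0 = 0)
    change (c • u) 0 = 0
    simp [hu]

/-! ### The diffeomorphism group -/

/-- `Diff₀^s(S¹)`: the diffeomorphism `φ = id + h`, with `h ∈ H^s_0(S¹; ℝ)` and `h_x > -1`, is
represented by `h`; in this global chart `Diff₀^s(S¹)` is an open subset of `H^s_0(S¹; ℝ)`. -/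
def Diff0 (s : ℝ) [Fact (5 / 2 < s)] : TopologicalSpace.Opens (H0R s) where
  carrier := {h | ∀ x, -1 < dx (h : HR s) x}
  is_open' := by
    rw [Metric.isOpen_iff]
    intro h hh
    obtain ⟨x₀, -, hx₀⟩ := isCompact_univ.exists_isMinOn Set.univ_nonempty
      (HR.continuous_dx (h : HR s)).continuousOn
    have hδ : 0 < 1 + dx (h : HR s) x₀ := by linarith [hh x₀]
    set C := 2 * Real.pi * HC.embC (s - 1) with hC
    have hC0 : 0 ≤ C := by
      have : 0 ≤ HC.embC (s - 1) := Real.sqrt_nonneg _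
      have := Real.pi_pos
      positivity
    refine ⟨(1 + dx (h : HR s) x₀) / (C + 1), by positivity, fun k hk x => ?_⟩
    rw [Metric.mem_ball, dist_eq_norm] at hk
    have h1 := HR.abs_dx_le ((k - h : H0R s) : HR s) x
    rw [Submodule.coe_sub, HR.dx_sub, ← hC, abs_le] at h1
    have h2 : dx (h : HR s) x₀ ≤ dx (h : HR s) x := hx₀ (Set.mem_univ x)
    have h3 : ‖(k : HR s) - h‖ < (1 + dx (h : HR s) x₀) / (C + 1) := hk
    rw [lt_div_iff₀ (by positivity)] at h3
    have h4 := norm_nonneg ((k : HR s) - h)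
    nlinarith [h1.1]

/-- The derivative `φ_x = 1 + h_x` of `φ = id + h`. -/
def phiX {s : ℝ} [Fact (5 / 2 < s)] (φ : Diff0 s) (x : UnitAddCircle) : ℝ :=
  1 + dx (φ.1 : HR s) x

/-! ### Manifolds modelled by translation charts

Let `A` be an abelian group, `π : E → A` a homomorphism from a normed space and `U` an open
neighbourhood of `0` in `E` on which `π` is injective. The charts `a + π h ↦ h`, `h ∈ U`, at the
points `a` of `A` turn `A` into a manifold modelled on `E`. -/

section Translation

variable {E A : Type} [NormedAddCommGroup E] [AddCommGroup A]
  (π : E →+ A) (U : Set E)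

/-- The chart `a + π h ↦ h`, for `h ∈ U`. -/
def transChart (hinj : Set.InjOn π U) (a : A) : PartialEquiv A E where
  toFun x := Function.invFunOn π U (x - a)
  invFun h := a + π h
  source := {x | ∃ h ∈ U, a + π h = x}
  target := U
  map_source' := by
    rintro _ ⟨h, hh, rfl⟩
    exact Function.invFunOn_mem ⟨h, hh, by abel⟩
  map_target' := fun h hh => ⟨h, hh, rfl⟩
  left_inv' := by
    rintro _ ⟨h, hh, rfl⟩
    rw [Function.invFunOn_eq (f := π) (s := U) ⟨h, hh, by abel⟩]; abel
  right_inv' := by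
    intro h hh
    have e : a + π h - a = π h := by abel
    rw [e]
    exact hinj.leftInvOn_invFunOn hh

theorem transChart_locally (hU : IsOpen U) (hinj : Set.InjOn π U) (a b : A) {h : E}
    (hh : h ∈ ((transChart π U hinj a).symm.trans (transChart π U hinj b)).source) :
    ∃ c : E, ∀ᶠ k in 𝓝 h,
      k ∈ ((transChart π U hinj a).symm.trans (transChart π U hinj b)).source ∧
      ((transChart π U hinj a).symm.trans (transChart π U hinj b)) k = k + c := by
  obtain ⟨h1, h', hh', e⟩ := hh
  change b + π h' = a + π h at e
  refine ⟨h' - h, ?_⟩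
  have hc : Filter.Tendsto (fun k => k + (h' - h)) (𝓝 h) (𝓝 h') := by
    have : Continuous fun k : E => k + (h' - h) := by fun_prop
    simpa using this.tendsto h
  filter_upwards [hU.mem_nhds h1, hc (hU.mem_nhds hh')] with k hk hk'
  have e2 : b + π (k + (h' - h)) = a + π k := by
    rw [map_add, map_sub]
    have : π h' = a + π h - b := by rw [← e]; abel
    rw [this]; abel
  refine ⟨⟨hk, k + (h' - h), hk', e2⟩, ?_⟩
  have := (transChart π U hinj b).right_inv' hk'
  change (transChart π U hinj b) (b + π (k + (h' - h))) = _ at this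
  rw [e2] at this
  exact this

/-- The atlas of all the charts `a + π h ↦ h`. -/
def transCore (hU : IsOpen U) (h0 : (0 : E) ∈ U) (hinj : Set.InjOn π U) :
    ChartedSpaceCore E A where
  atlas := Set.range (transChart π U hinj)
  chartAt := transChart π U hinj
  mem_chart_source a := ⟨0, h0, by simp⟩
  chart_mem_atlas a := ⟨a, rfl⟩
  open_source := by
    rintro _ _ ⟨a, rfl⟩ ⟨b, rfl⟩
    rw [isOpen_iff_mem_nhds]
    intro h hh
    obtain ⟨c, hc⟩ := transChart_locally π U hU hinj a b hh
    exact hc.mono fun k hk => hk.1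
  continuousOn_toFun := by
    rintro _ _ ⟨a, rfl⟩ ⟨b, rfl⟩
    intro h hh
    obtain ⟨c, hc⟩ := transChart_locally π U hU hinj a b hh
    apply ContinuousAt.continuousWithinAt
    refine ContinuousAt.congr (f := fun k => k + c) (by fun_prop) ?_
    exact hc.mono fun k hk => hk.2.symm

theorem transCore_isManifold [NormedSpace ℝ E] (hU : IsOpen U) (h0 : (0 : E) ∈ U) (hinj : Set.InjOn π U) :
    letI := (transCore π U hU h0 hinj).toTopologicalSpace
    letI := (transCore π U hU h0 hinj).toChartedSpace
    IsManifold 𝓘(ℝ, E) ∞ A := by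
  let _ := (transCore π U hU h0 hinj).toTopologicalSpace
  let _ := (transCore π U hU h0 hinj).toChartedSpace
  apply isManifold_of_contDiffOn
  intro e e' he he'
  change e ∈ ⋃ (e : PartialEquiv A E) (he : _), {_} at he
  change e' ∈ ⋃ (e : PartialEquiv A E) (he : _), {_} at he'
  simp only [Set.mem_iUnion, Set.mem_singleton_iff] at he he'
  obtain ⟨_, ⟨a, rfl⟩, rfl⟩ := he
  obtain ⟨_, ⟨b, rfl⟩, rfl⟩ := he'
  rintro h ⟨hh, -⟩
  obtain ⟨c, hc⟩ := transChart_locally π U hU hinj a b hh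
  apply ContDiffAt.contDiffWithinAt
  refine ContDiffAt.congr_of_eventuallyEq (f := fun k => k + c) (by fun_prop) ?_
  exact hc.mono fun k hk => hk.2

end Translation

/-! ### Circle-valued Sobolev maps -/

/-- The circle `S¹_{4π} = ℝ/4πℤ` of length `4π`. -/
abbrev Circ : Type := AddCircle (4 * Real.pi)

/-- The phase `e^{iθ/2}` of a point `θ` of `S¹_{4π}`. -/
def phase (θ : Circ) : ℂ := (AddCircle.toCircle θ : ℂ)

theorem phase_coe (t : ℝ) : phase (t : Circ) = Complex.exp (Complex.I * t / 2) := by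
  unfold phase
  rw [AddCircle.toCircle_apply_mk, Circle.coe_exp]
  congr 1
  have : (Real.pi : ℂ) ≠ 0 := by exact_mod_cast Real.pi_ne_zero
  push_cast
  field_simp
  ring

/-- The maps `S¹ → S¹_{4π}` of class `H^r`: those with a lift to `ℝ` of the form
`t ↦ 4πnt + h(t)`, where `n` is the winding number and `h` is a periodic function of
class `H^r`. -/
def circMaps (r : ℝ) : AddSubgroup C(UnitAddCircle, Circ) where
  carrier := {α | ∃ (n : ℤ) (h : HR r), ∀ t : ℝ,
    α (t : UnitAddCircle) = ((4 * Real.pi * n * t + h (t : UnitAddCircle) : ℝ) : Circ)}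
  zero_mem' := ⟨0, 0, fun t => by simp⟩
  add_mem' := by
    rintro α β ⟨n, h, hα⟩ ⟨m, k, hβ⟩
    refine ⟨n + m, h + k, fun t => ?_⟩
    rw [ContinuousMap.add_apply, hα, hβ, ← AddCircle.coe_add]
    congr 1
    push_cast
    rw [HR.add_apply]
    ring
  neg_mem' := by
    rintro α ⟨n, h, hα⟩
    refine ⟨-n, -h, fun t => ?_⟩
    rw [ContinuousMap.neg_apply, hα, ← AddCircle.coe_neg]
    congr 1
    push_cast
    rw [HR.neg_apply]
    ring

/-- The group `H^r(S¹; S¹_{4π})`. -/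
def HCirc (r : ℝ) : Type := circMaps r

instance (r : ℝ) : AddCommGroup (HCirc r) := inferInstanceAs (AddCommGroup (circMaps r))

namespace HCirc
variable {r : ℝ}

/-- The underlying continuous map. -/
def toC : HCirc r →+ C(UnitAddCircle, Circ) := (circMaps r).subtype

theorem toC_injective : Function.Injective (toC : HCirc r → _) := Subtype.val_injective

instance : FunLike (HCirc r) UnitAddCircle Circ where
  coe f := toC f
  coe_injective _ _ h := toC_injective (DFunLike.coe_injective h)

@[ext] theorem ext {f g : HCirc r} (h : ∀ x, f x = g x) : f = g := DFunLike.ext _ _ h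

/-- Reduction modulo `4π` of a real-valued function. -/
def proj : HR r →+ HCirc r where
  toFun h := ⟨⟨fun x => ((h x : ℝ) : Circ), (AddCircle.continuous_mk' _).comp h.continuous_coe⟩,
    0, h, fun t => by simp; rfl⟩
  map_zero' := by ext x; rfl
  map_add' h k := by ext x; rfl

@[simp] theorem proj_apply (h : HR r) (x : UnitAddCircle) : proj h x = ((h x : ℝ) : Circ) := rfl
@[simp] theorem add_apply (α β : HCirc r) (x : UnitAddCircle) : (α + β) x = α x + β x := rfl
@[simp] theorem zero_apply (x : UnitAddCircle) : (0 : HCirc r) x = 0 := rfl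

/-- The domain `|h| < 2π` of the translation charts. -/
def chartDomain (r : ℝ) : Set (HR r) := {h | ∃ c < 2 * Real.pi, ∀ x, |h x| ≤ c}

theorem chartDomain_open [Fact (1 / 2 < r)] : IsOpen (chartDomain r) := by
  rw [Metric.isOpen_iff]
  rintro h ⟨c, hc, hh⟩
  have hC0 : 0 ≤ HC.embC r := Real.sqrt_nonneg _
  have hd : 0 < 2 * Real.pi - c := by linarith
  refine ⟨(2 * Real.pi - c) / 2 / (HC.embC r + 1), by positivity,
    fun k hk => ⟨c + (2 * Real.pi - c) / 2, by linarith, fun x => ?_⟩⟩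
  rw [Metric.mem_ball, dist_eq_norm, lt_div_iff₀ (by positivity)] at hk
  have h1 := HR.abs_apply_le (k - h) x
  rw [HR.sub_apply] at h1
  have h2 : |k x| ≤ |h x| + |k x - h x| := by
    have := abs_add_le (h x) (k x - h x)
    simpa using this
  have h3 := hh x
  have h4 := norm_nonneg (k - h)
  nlinarith

theorem proj_injOn : Set.InjOn (proj : HR r →+ HCirc r) (chartDomain r) := by
  rintro h ⟨c, hc, hh⟩ k ⟨d, hd, hk⟩ e
  ext x
  have e1 : ((h x : ℝ) : Circ) = ((k x : ℝ) : Circ) := congrArg (fun α : HCirc r => α x) e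
  rw [← sub_eq_zero, ← AddCircle.coe_sub, AddCircle.coe_eq_zero_iff] at e1
  obtain ⟨n, hn⟩ := e1
  have hx := abs_le.1 (hh x)
  have hy := abs_le.1 (hk x)
  have hπ := Real.pi_pos
  simp only [zsmul_eq_mul] at hn
  have hn1 : (n : ℝ) < 1 := by nlinarith
  have hn2 : (-1 : ℝ) < n := by nlinarith
  have hn0 : n = 0 := by
    have h1 : n < 1 := by exact_mod_cast hn1
    have h2 : -1 < n := by exact_mod_cast hn2
    omega
  rw [hn0] at hn
  simp at hn
  linarith

/-- The manifold structure of `H^r(S¹; S¹_{4π})`, with the charts `α + h ↦ h`, `|h| < 2π`. -/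
def core (r : ℝ) [Fact (1 / 2 < r)] : ChartedSpaceCore (HR r) (HCirc r) :=
  transCore proj (chartDomain r) chartDomain_open
    ⟨0, by have := Real.pi_pos; positivity, fun x => by simp⟩ proj_injOn

instance [Fact (1 / 2 < r)] : TopologicalSpace (HCirc r) := (core r).toTopologicalSpace
instance [Fact (1 / 2 < r)] : ChartedSpace (HR r) (HCirc r) := (core r).toChartedSpace
instance [Fact (1 / 2 < r)] : IsManifold 𝓘(ℝ, HR r) ∞ (HCirc r) :=
  transCore_isManifold proj (chartDomain r) _ _ _

/-- The constant maps, as a homomorphism. -/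
def const : Circ →+ HCirc r where
  toFun θ := ⟨ContinuousMap.const _ θ, by
    obtain ⟨c, rfl⟩ := QuotientAddGroup.mk_surjective θ
    exact ⟨0, HR.const c, fun t => by simp⟩⟩
  map_zero' := rfl
  map_add' _ _ := rfl

@[simp] theorem const_apply (θ : Circ) (x : UnitAddCircle) : (const θ : HCirc r) x = θ := rfl

end HCirc

/-- The constant functions in `H^r(S¹; ℝ)`. -/
def constR (r : ℝ) : Submodule ℝ (HR r) := Submodule.span ℝ {HR.const 1}

theorem mem_constR {r : ℝ} {h : HR r} : h ∈ constR r ↔ ∃ c : ℝ, ∀ x, h x = c := by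
  unfold constR
  rw [Submodule.mem_span_singleton]
  constructor
  · rintro ⟨c, rfl⟩; exact ⟨c, fun x => by simp⟩
  · rintro ⟨c, hc⟩; exact ⟨c, by ext x; simp [hc]⟩

instance (r : ℝ) : IsClosed (constR r : Set (HR r)) := by
  unfold constR; exact Submodule.closed_of_finiteDimensional _

/-- The Banach space `H^r(S¹; ℝ)/ℝ`. -/
abbrev HRmod (r : ℝ) : Type := HR r ⧸ constR r

/-- The quotient `H^r(S¹; S¹_{4π})/S¹_{4π}` by the constant phases. -/
def HCircMod (r : ℝ) : Type := HCirc r ⧸ (HCirc.const (r := r)).range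

instance (r : ℝ) : AddCommGroup (HCircMod r) :=
  inferInstanceAs (AddCommGroup (HCirc r ⧸ (HCirc.const (r := r)).range))

namespace HCircMod
variable {r : ℝ}

/-- The class `[α]`. -/
def mk : HCirc r →+ HCircMod r := QuotientAddGroup.mk' (HCirc.const (r := r)).range

theorem mk_eq_mk {α β : HCirc r} : mk α = mk β ↔ ∃ θ : Circ, β = α + HCirc.const θ := by
  change (QuotientAddGroup.mk α : HCirc r ⧸ (HCirc.const (r := r)).range)
    = QuotientAddGroup.mk β ↔ _
  rw [QuotientAddGroup.eq]
  constructor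
  · rintro ⟨θ, hθ⟩; exact ⟨θ, by rw [hθ]; abel⟩
  · rintro ⟨θ, hθ⟩; exact ⟨θ, by rw [hθ]; abel⟩

/-- Reduction modulo `4π` of a real-valued function modulo constants. -/
def proj : HRmod r →+ HCircMod r :=
  QuotientAddGroup.lift (constR r).toAddSubgroup (mk.comp HCirc.proj) (by
    intro h hh
    obtain ⟨c, hc⟩ := mem_constR.1 hh
    rw [AddMonoidHom.mem_ker, AddMonoidHom.comp_apply, ← map_zero mk]
    refine (mk_eq_mk.2 ⟨(c : Circ), ?_⟩).symm
    ext x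
    simp [hc])

theorem proj_mk (h : HR r) : proj (Submodule.Quotient.mk h) = mk (HCirc.proj h) := rfl

theorem proj_injOn : Set.InjOn (proj : HRmod r →+ HCircMod r) Set.univ := by
  rw [Set.injOn_univ, injective_iff_map_eq_zero]
  intro h hh
  obtain ⟨h, rfl⟩ := Submodule.Quotient.mk_surjective _ h
  rw [proj_mk, ← map_zero mk] at hh
  obtain ⟨θ, hθ⟩ := mk_eq_mk.1 hh.symm
  rw [zero_add] at hθ
  rw [Submodule.Quotient.mk_eq_zero, mem_constR]
  refine ⟨h 0, fun x => ?_⟩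
  have hd : ∀ x : UnitAddCircle, h x - h 0 ∈ Set.range fun n : ℤ => n • (4 * Real.pi) := by
    intro x
    have e1 : ((h x : ℝ) : Circ) = ((h 0 : ℝ) : Circ) :=
      (congrArg (fun α : HCirc r => α x) hθ).trans (congrArg (fun α : HCirc r => α 0) hθ).symm
    rw [← sub_eq_zero, ← AddCircle.coe_sub, AddCircle.coe_eq_zero_iff] at e1
    exact e1
  have hcont : Continuous fun t : ℝ => (h (t : UnitAddCircle) - h 0) / (4 * Real.pi) :=
    ((h.continuous_coe.comp (AddCircle.continuous_mk' _)).sub continuous_const).div_const _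
  have hπ := Real.pi_pos
  have hint : ∀ t : ℝ, ∃ n : ℤ, (h (t : UnitAddCircle) - h 0) / (4 * Real.pi) = n := by
    intro t
    obtain ⟨n, hn⟩ := hd (t : UnitAddCircle)
    refine ⟨n, ?_⟩
    rw [← hn]
    simp only [zsmul_eq_mul]
    field_simp
  obtain ⟨t, rfl⟩ := QuotientAddGroup.mk_surjective x
  choose n hn using hint
  have hlc : Continuous n := by
    have h1 : (fun t : ℝ => (n t : ℝ)) =
      fun t : ℝ => (h (t : UnitAddCircle) - h 0) / (4 * Real.pi) := funext fun t => (hn t).symm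
    rw [Int.isClosedEmbedding_coe_real.isInducing.continuous_iff]
    change Continuous fun t : ℝ => (n t : ℝ)
    rw [h1]; exact hcont
  have hconst : n t = n 0 := PreconnectedSpace.constant inferInstance hlc
  have h2 : (h (t : UnitAddCircle) - h 0) / (4 * Real.pi) =
      (h ((0 : ℝ) : UnitAddCircle) - h 0) / (4 * Real.pi) := by rw [hn, hn, hconst]
  have h3 : ((0 : ℝ) : UnitAddCircle) = 0 := rfl
  rw [h3, sub_self, zero_div, div_eq_zero_iff] at h2
  rcases h2 with h2 | h2
  · exact sub_eq_zero.1 h2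
  · exfalso; nlinarith

/-- The manifold structure of `H^r(S¹; S¹_{4π})/S¹_{4π}`, with the charts
`[α] + [h] ↦ [h]`. -/
def core (r : ℝ) : ChartedSpaceCore (HRmod r) (HCircMod r) :=
  transCore proj Set.univ isOpen_univ (Set.mem_univ _) proj_injOn

instance : TopologicalSpace (HCircMod r) := (core r).toTopologicalSpace
instance : ChartedSpace (HRmod r) (HCircMod r) := (core r).toChartedSpace
instance : IsManifold 𝓘(ℝ, HRmod r) ∞ (HCircMod r) :=
  transCore_isManifold proj Set.univ _ _ _

end HCircMod

end TwoHS

namespace TwoHS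

/-! ### The `L²` inner product and the sphere -/

/-- The real `L²` inner product `⟨f, g⟩ = Re ∫ f ḡ`. -/
def l2 (f g : UnitAddCircle → ℂ) : ℝ := (∫ x, f x * starRingEnd ℂ (g x)).re

theorem volume_univ : (MeasureTheory.volume : MeasureTheory.Measure UnitAddCircle).real Set.univ
    = 1 := by
  rw [MeasureTheory.measureReal_def, UnitAddCircle.measure_univ]; simp

namespace HC
variable {r : ℝ}

theorem continuous_coe (f : HC r) : Continuous (⇑f) := (toC f).continuous

theorem integrable_mul_conj (f g : HC r) :
    MeasureTheory.Integrable fun x : UnitAddCircle => f x * starRingEnd ℂ (g x) :=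
  ((f.continuous_coe).mul (Complex.continuous_conj.comp
    g.continuous_coe)).integrable_of_hasCompactSupport (HasCompactSupport.of_compactSpace _)

theorem l2_add_left (f g h : HC r) : l2 ⇑(f + g) h = l2 f h + l2 g h := by
  unfold l2
  rw [← Complex.add_re, ← MeasureTheory.integral_add (integrable_mul_conj f h)
    (integrable_mul_conj g h)]
  simp only [add_apply, add_mul]

theorem l2_smul_left (c : ℝ) (f h : HC r) : l2 ⇑(c • f) h = c * l2 f h := by
  unfold l2
  simp only [real_smul_apply, mul_assoc, MeasureTheory.integral_const_mul]
  exact Complex.re_ofReal_mul _ _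

theorem l2_comm (f g : UnitAddCircle → ℂ) : l2 f g = l2 g f := by
  unfold l2
  rw [← Complex.conj_re, ← integral_conj]
  congr 2; funext x
  simp [mul_comm]

theorem l2_add_right (f g h : HC r) : l2 f ⇑(g + h) = l2 f g + l2 f h := by
  rw [l2_comm, l2_add_left, l2_comm g, l2_comm h]

theorem l2_smul_right (c : ℝ) (f h : HC r) : l2 f ⇑(c • h) = c * l2 f h := by
  rw [l2_comm, l2_smul_left, l2_comm]

theorem abs_l2_le [Fact (1 / 2 < r)] (f g : HC r) :
    |l2 f g| ≤ embC r * embC r * ‖f‖ * ‖g‖ := by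
  unfold l2
  refine (Complex.abs_re_le_norm _).trans ?_
  have h : ∀ x : UnitAddCircle, ‖f x * starRingEnd ℂ (g x)‖ ≤ embC r * embC r * ‖f‖ * ‖g‖ := by
    intro x
    rw [norm_mul, RCLike.norm_conj]
    calc ‖f x‖ * ‖g x‖ ≤ (embC r * ‖f‖) * (embC r * ‖g‖) := by
          have := norm_apply_le f x
          have h0 : 0 ≤ embC r := Real.sqrt_nonneg _
          have := norm_apply_le g x
          gcongr
      _ = _ := by ring
  refine (MeasureTheory.norm_integral_le_of_norm_le_const (Filter.Eventually.of_forall h)).trans ?_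
  rw [volume_univ, mul_one]

/-- The `L²` inner product as a continuous bilinear map. -/
def l2L [Fact (1 / 2 < r)] : HC r →L[ℝ] HC r →L[ℝ] ℝ :=
  LinearMap.mkContinuous₂ (LinearMap.mk₂ ℝ (fun f g : HC r => l2 f g) l2_add_left
    l2_smul_left l2_add_right l2_smul_right) (embC r * embC r) abs_l2_le

theorem l2L_apply [Fact (1 / 2 < r)] (f g : HC r) : l2L f g = l2 f g := rfl

theorem l2_self (f : UnitAddCircle → ℂ) : l2 f f = ∫ x, ‖f x‖ ^ 2 := by
  unfold l2
  have : (fun x => f x * starRingEnd ℂ (f x)) = fun x => ((‖f x‖ ^ 2 : ℝ) : ℂ) := by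
    funext x; rw [Complex.mul_conj, Complex.normSq_eq_norm_sq]
  rw [this, integral_complex_ofReal, Complex.ofReal_re]

theorem l2_self_nonneg (f : UnitAddCircle → ℂ) : 0 ≤ l2 f f := by
  rw [l2_self]; positivity

theorem eq_zero_of_l2_self {f : HC r} (h : l2 f f = 0) : f = 0 := by
  rw [l2_self] at h
  have hc : Continuous fun x => ‖f x‖ ^ 2 := (f.continuous_coe.norm).pow 2
  have hi : MeasureTheory.Integrable fun x : UnitAddCircle => ‖f x‖ ^ 2 :=
    hc.integrable_of_hasCompactSupport (HasCompactSupport.of_compactSpace _)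
  rw [MeasureTheory.integral_eq_zero_iff_of_nonneg (fun x => by positivity) hi] at h
  have := (hc.ae_eq_iff_eq (MeasureTheory.volume) continuous_const).1 h
  ext x
  have h2 : ‖f x‖ ^ 2 = 0 := congrFun this x
  simpa using h2

theorem l2_one_one : l2 ⇑(const 1 : HC r) ⇑(const 1 : HC r) = 1 := by
  rw [l2_self]; simp [volume_univ]

end HC

/-- The subspace `1^⊥` of the functions orthogonal to the constant function `1`. -/
def onePerp (r : ℝ) : Submodule ℝ (HC r) where
  carrier := {h | l2 h (HC.const 1 : HC r) = 0}
  zero_mem' := by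
    change l2 _ _ = 0
    simp [l2]
  add_mem' := by
    intro f g (hf : l2 _ _ = 0) (hg : l2 _ _ = 0)
    change l2 _ _ = 0
    rw [HC.l2_add_left, hf, hg, add_zero]
  smul_mem' := by
    intro c f (hf : l2 _ _ = 0)
    change l2 _ _ = 0
    rw [HC.l2_smul_left, hf, mul_zero]

/-- The unit sphere `S^{∞,r}`: the functions `f` of class `H^r` with `∫ |f|² = 1`. -/
def Sph (r : ℝ) : Type := {f : HC r // ∫ x : UnitAddCircle, ‖f x‖ ^ 2 = 1}

namespace Sph
variable {r : ℝ}

/-- The inclusion `S^{∞,r} ⊂ H^r(S¹; ℂ)`. -/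
def incl : Sph r → HC r := Subtype.val

theorem incl_injective : Function.Injective (incl : Sph r → _) := Subtype.val_injective

instance : TopologicalSpace (Sph r) := instTopologicalSpaceSubtype

theorem continuous_incl : Continuous (incl : Sph r → _) := continuous_subtype_val

theorem l2_incl (f : Sph r) : l2 (incl f) (incl f) = 1 := by rw [HC.l2_self]; exact f.2

theorem ne_zero (f : Sph r) : incl f ≠ 0 := by
  intro h
  have := l2_incl f
  rw [h] at this
  simp [l2] at this

/-- The constant function `ε`, `ε = ±1`. -/
def pole (ε : ℝ) (hε : ε ^ 2 = 1) : Sph r := ⟨HC.const ε, by simp [hε, volume_univ]⟩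

section charts
variable [Fact (1 / 2 < r)]

/-- The component `⟨f, 1⟩` along the constant function `1`. -/
def ht : HC r →L[ℝ] ℝ := HC.l2L.flip (HC.const 1)

theorem ht_apply (f : HC r) : ht f = l2 f (HC.const 1 : HC r) := rfl

theorem ht_one : ht (HC.const 1 : HC r) = 1 := HC.l2_one_one

/-- The orthogonal projection `f ↦ f - ⟨f, 1⟩` onto `1^⊥`. -/
def perp : HC r →L[ℝ] onePerp r :=
  (ContinuousLinearMap.id ℝ (HC r) - ht.smulRight (HC.const 1)).codRestrict (onePerp r) (by
    intro f
    change ht _ = 0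
    simp [ht_one])

theorem perp_coe (f : HC r) : (perp f : HC r) = f - ht f • HC.const 1 := rfl

/-- The stereographic projection `f ↦ (f - ⟨f, 1⟩) / (1 + ε ⟨f, 1⟩)` from the point `-ε`, where
`ε = 1` for the south pole `-1` and `ε = -1` for the north pole `1`. -/
def stereo (ε : ℝ) (f : HC r) : onePerp r := (1 + ε * ht f)⁻¹ • perp f

/-- The inverse `h ↦ (2h + ε (1 - ‖h‖²)) / (‖h‖² + 1)` of the stereographic projection. -/
def stereoInv (ε : ℝ) (h : onePerp r) : HC r :=
  (l2 (h : HC r) (h : HC r) + 1)⁻¹ •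
    ((2 : ℝ) • (h : HC r) + (ε * (1 - l2 (h : HC r) (h : HC r))) • HC.const 1)

theorem ht_perp (h : onePerp r) : ht (h : HC r) = 0 := h.2

theorem l2_add_const (c d : ℝ) (h : HC r) :
    l2 ⇑(c • h + d • (HC.const 1 : HC r)) ⇑(c • h + d • (HC.const 1 : HC r))
      = c ^ 2 * l2 h h + 2 * c * d * ht h + d ^ 2 := by
  rw [HC.l2_add_left, HC.l2_add_right, HC.l2_add_right]
  simp only [HC.l2_smul_left, HC.l2_smul_right, HC.l2_one_one]
  rw [HC.l2_comm ⇑(HC.const 1 : HC r) h, ← ht_apply]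
  ring

theorem ht_stereoInv (ε : ℝ) (h : onePerp r) :
    ht (stereoInv ε h) = (l2 (h : HC r) (h : HC r) + 1)⁻¹ *
      (ε * (1 - l2 (h : HC r) (h : HC r))) := by
  unfold stereoInv
  simp [ht_one, ht_perp]

theorem stereoInv_norm {ε : ℝ} (hε : ε ^ 2 = 1) (h : onePerp r) :
    ∫ x : UnitAddCircle, ‖stereoInv ε h x‖ ^ 2 = 1 := by
  rw [← HC.l2_self]
  have h0 := HC.l2_self_nonneg (h : HC r)
  unfold stereoInv
  rw [HC.l2_smul_left, HC.l2_smul_right, l2_add_const, ht_perp, mul_pow, hε]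
  field_simp
  ring

theorem eq_pole {ε : ℝ} (hε : ε ^ 2 = 1) (f : Sph r) (h : 1 + ε * ht (incl f) = 0) :
    f = pole (-ε) (by rw [neg_sq]; exact hε) := by
  apply incl_injective
  have h1 := l2_add_const 1 ε (incl f)
  rw [l2_incl, hε] at h1
  have h2 : l2 ⇑((1 : ℝ) • incl f + ε • (HC.const 1 : HC r))
      ⇑((1 : ℝ) • incl f + ε • (HC.const 1 : HC r)) = 0 := by rw [h1]; linarith
  have h3 := HC.eq_zero_of_l2_self h2
  ext x
  have h4 := congrArg (fun k : HC r => k x) h3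
  simp only [one_smul, HC.add_apply, HC.real_smul_apply, HC.const_apply, mul_one,
    HC.zero_apply] at h4
  change incl f x = ((-ε : ℝ) : ℂ)
  rw [eq_neg_of_add_eq_zero_left h4]; simp

theorem ht_pole (ε : ℝ) (hε : ε ^ 2 = 1) : ht (incl (pole ε hε : Sph r)) = ε := by
  have : incl (pole ε hε : Sph r) = ε • HC.const 1 := by
    ext x; simp [pole, incl]
  rw [this, map_smul, ht_one]; simp

theorem denom_ne {ε : ℝ} (hε : ε ^ 2 = 1) (f : Sph r)
    (hf : f ≠ pole (-ε) (by rw [neg_sq]; exact hε)) : 1 + ε * ht (incl f) ≠ 0 :=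
  fun h => hf (eq_pole hε f h)

theorem continuous_l2_self : Continuous fun f : HC r => l2 f f := by
  have : Continuous fun f : HC r => HC.l2L f f := by fun_prop
  exact this

theorem contDiff_l2_self : ContDiff ℝ ∞ fun f : HC r => l2 f f := by
  have : ContDiff ℝ ∞ fun f : HC r => HC.l2L f f := by fun_prop
  exact this

theorem contDiff_stereoInv (ε : ℝ) : ContDiff ℝ ∞ (stereoInv ε : onePerp r → HC r) := by
  have h1 : ContDiff ℝ ∞ fun h : onePerp r => (h : HC r) := (onePerp r).subtypeL.contDiff
  have h2 : ContDiff ℝ ∞ fun h : onePerp r => l2 (h : HC r) (h : HC r) :=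
    contDiff_l2_self.comp h1
  have h3 : ContDiff ℝ ∞ fun h : onePerp r => (l2 (h : HC r) (h : HC r) + 1)⁻¹ := by
    refine (h2.add contDiff_const).inv fun h => ?_
    have h0 := HC.l2_self_nonneg (h : HC r)
    positivity
  have h4 : ContDiff ℝ ∞ fun h : onePerp r => ε * (1 - l2 (h : HC r) (h : HC r)) :=
    contDiff_const.mul (contDiff_const.sub h2)
  have h5 : ContDiff ℝ ∞ fun h : onePerp r =>
      (2 : ℝ) • (h : HC r) + (ε * (1 - l2 (h : HC r) (h : HC r))) • (HC.const 1 : HC r) :=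
    (h1.const_smul (2 : ℝ)).add (h4.smul contDiff_const)
  exact h3.smul h5

theorem contDiffAt_stereo (ε : ℝ) (f : HC r) (hf : 1 + ε * ht f ≠ 0) :
    ContDiffAt ℝ ∞ (stereo ε) f := by
  unfold stereo
  have h1 : ContDiff ℝ ∞ fun f : HC r => 1 + ε * ht f :=
    contDiff_const.add (contDiff_const.mul ht.contDiff)
  exact ContDiffAt.smul (h1.contDiffAt.inv hf) perp.contDiff.contDiffAt

theorem denom_stereoInv {ε : ℝ} (hε : ε ^ 2 = 1) (h : onePerp r) :
    1 + ε * ht (stereoInv ε h) = 2 * (l2 (h : HC r) (h : HC r) + 1)⁻¹ := by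
  have h0 := HC.l2_self_nonneg (h : HC r)
  rw [ht_stereoInv]
  have : ε * ((l2 (h : HC r) (h : HC r) + 1)⁻¹ * (ε * (1 - l2 (h : HC r) (h : HC r)))) =
      ε ^ 2 * ((l2 (h : HC r) (h : HC r) + 1)⁻¹ * (1 - l2 (h : HC r) (h : HC r))) := by ring
  rw [this, hε]
  field_simp
  ring

theorem stereo_stereoInv {ε : ℝ} (hε : ε ^ 2 = 1) (h : onePerp r) :
    stereo ε (stereoInv ε h) = h := by
  have h0 := HC.l2_self_nonneg (h : HC r)
  apply Subtype.ext
  unfold stereo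
  rw [denom_stereoInv hε, Submodule.coe_smul, perp_coe, ht_stereoInv]
  unfold stereoInv
  have h1 : l2 (h : HC r) (h : HC r) + 1 ≠ 0 := by positivity
  ext x
  simp only [HC.real_smul_apply, HC.sub_apply, HC.add_apply, HC.const_apply]
  have h2 : ((l2 (h : HC r) (h : HC r) : ℝ) : ℂ) + 1 ≠ 0 := by exact_mod_cast h1
  push_cast
  field_simp
  ring

theorem stereoInv_stereo {ε : ℝ} (hε : ε ^ 2 = 1) (f : Sph r)
    (hf : 1 + ε * ht (incl f) ≠ 0) : stereoInv ε (stereo ε (incl f)) = incl f := by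
  set a := ht (incl f) with ha
  have hN : l2 ⇑((stereo ε (incl f) : onePerp r) : HC r) ⇑((stereo ε (incl f) : onePerp r) : HC r)
      = ((1 + ε * a)⁻¹) ^ 2 * (1 - a ^ 2) := by
    unfold stereo
    have e : (perp (incl f) : HC r) = (1 : ℝ) • incl f + (-a) • HC.const 1 := by
      rw [perp_coe, ← ha, one_smul, neg_smul, sub_eq_add_neg]
    rw [Submodule.coe_smul, HC.l2_smul_left, HC.l2_smul_right, e, l2_add_const, l2_incl, ← ha]
    ring
  have hN1 : ((1 + ε * a)⁻¹) ^ 2 * (1 - a ^ 2) + 1 = 2 * (1 + ε * a)⁻¹ := by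
    field_simp
    linear_combination (a ^ 2) * hε
  have hN2 : 1 - ((1 + ε * a)⁻¹) ^ 2 * (1 - a ^ 2) = 2 * (ε * a) * (1 + ε * a)⁻¹ := by
    field_simp
    linear_combination (- a ^ 2) * hε
  unfold stereoInv
  rw [hN, hN1, hN2]
  unfold stereo
  rw [Submodule.coe_smul, perp_coe, ← ha]
  ext x
  simp only [HC.real_smul_apply, HC.sub_apply, HC.add_apply, HC.const_apply]
  have h2 : (1 : ℂ) + ε * a ≠ 0 := by exact_mod_cast hf
  have h3 : (ε : ℂ) ^ 2 = 1 := by exact_mod_cast hε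
  push_cast
  field_simp
  linear_combination (a : ℂ) * h3

/-- The chart of the sphere given by the stereographic projection from `-ε`. -/
def chart (ε : ℝ) (hε : ε ^ 2 = 1) : OpenPartialHomeomorph (Sph r) (onePerp r) where
  toFun f := stereo ε (incl f)
  invFun h := ⟨stereoInv ε h, stereoInv_norm hε h⟩
  source := {f | 1 + ε * ht (incl f) ≠ 0}
  target := Set.univ
  map_source' _ _ := Set.mem_univ _
  map_target' h _ := by
    change 1 + ε * ht (stereoInv ε h) ≠ 0
    have h0 := HC.l2_self_nonneg (h : HC r)
    rw [denom_stereoInv hε]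
    positivity
  left_inv' f hf := incl_injective (stereoInv_stereo hε f hf)
  right_inv' h _ := stereo_stereoInv hε h
  open_source := by
    refine isOpen_ne_fun ?_ continuous_const
    have := continuous_incl (r := r)
    fun_prop
  open_target := isOpen_univ
  continuousOn_toFun := fun f hf =>
    ((contDiffAt_stereo ε _ hf).continuousAt.comp
      continuous_incl.continuousAt).continuousWithinAt
  continuousOn_invFun :=
    ((contDiff_stereoInv ε).continuous.subtype_mk _).continuousOn

/-- The manifold structure of the sphere, given by the two stereographic projections. -/
instance : ChartedSpace (onePerp r) (Sph r) where
  atlas := {chart 1 (by norm_num), chart (-1) (by norm_num)}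
  chartAt f := by
    classical
    exact if f = pole (-1) (by norm_num) then chart (-1) (by norm_num) else chart 1 (by norm_num)
  mem_chart_source f := by
    classical
    by_cases hf : f = pole (-1) (by norm_num)
    · simp only [if_pos hf]
      change 1 + (-1) * ht (incl f) ≠ 0
      rw [hf, ht_pole]; norm_num
    · simp only [if_neg hf]
      exact denom_ne (by norm_num) f hf
  chart_mem_atlas f := by
    classical
    by_cases hf : f = pole (-1) (by norm_num)
    · simp only [if_pos hf]; right; rfl
    · simp only [if_neg hf]; left; rfl

theorem contDiffOn_transition (ε δ : ℝ) (hε : ε ^ 2 = 1) (hδ : δ ^ 2 = 1) :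
    ContDiffOn ℝ ∞ ((chart δ hδ : Sph r → onePerp r) ∘ (chart ε hε).symm)
      ((chart ε hε).symm ≫ₕ chart δ hδ).source := by
  rintro h ⟨-, hh⟩
  apply ContDiffAt.contDiffWithinAt
  change ContDiffAt ℝ ∞ (fun h : onePerp r => stereo δ (stereoInv ε h)) h
  exact (contDiffAt_stereo δ _ hh).comp h (contDiff_stereoInv ε).contDiffAt

instance : IsManifold 𝓘(ℝ, onePerp r) ∞ (Sph r) := by
  apply isManifold_of_contDiffOn
  have hmem : ∀ e ∈ atlas (onePerp r) (Sph r), ∃ ε : ℝ, ∃ hε : ε ^ 2 = 1, e = chart ε hε := by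
    rintro e (rfl | rfl)
    · exact ⟨1, by norm_num, rfl⟩
    · exact ⟨-1, by norm_num, rfl⟩
  intro e e' he he'
  obtain ⟨ε, hε, rfl⟩ := hmem e he
  obtain ⟨δ, hδ, rfl⟩ := hmem e' he'
  exact (contDiffOn_transition ε δ hε hδ).mono Set.inter_subset_left

end charts
end Sph

/-! ### Complex projective space -/

/-- The projective space `ℂP^{∞,r}` of `H^r(S¹; ℂ)`. -/
def CP (r : ℝ) : Type := ℙ ℂ (HC r)

/-- The subspace of the functions vanishing at `0`. -/
def H0C (r : ℝ) : Submodule ℝ (HC r) where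
  carrier := {f | f 0 = 0}
  zero_mem' := rfl
  add_mem' := by
    intro f g (hf : f 0 = 0) (hg : g 0 = 0)
    change (f + g) 0 = 0
    simp [hf, hg]
  smul_mem' := by
    intro c f (hf : f 0 = 0)
    change (c • f) 0 = 0
    simp [hf]

namespace CP
variable {r : ℝ}

/-- The class `[f]` of a nonzero function. -/
def mk (f : HC r) (hf : f ≠ 0) : CP r := Projectivization.mk ℂ f hf

/-- A nonzero representative of a class. -/
def rep (P : CP r) : HC r := Projectivization.rep P

theorem rep_ne (P : CP r) : rep P ≠ 0 := Projectivization.rep_nonzero P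

theorem mk_rep (P : CP r) : mk (rep P) (rep_ne P) = P := Projectivization.mk_rep P

theorem mk_eq_mk {f g : HC r} (hf : f ≠ 0) (hg : g ≠ 0) :
    mk f hf = mk g hg ↔ ∃ c : ℂ, c • g = f := Projectivization.mk_eq_mk_iff' ℂ f g hf hg

section charts
variable [Fact (1 / 2 < r)]

/-- The projection `f ↦ f - f(0)` onto the functions vanishing at `0`. -/
def sub0 : HC r →L[ℝ] H0C r :=
  (ContinuousLinearMap.id ℝ (HC r) -
    { toFun := fun f => HC.const (f 0)
      map_add' := fun f g => by ext x; simp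
      map_smul' := fun c f => by ext x; simp
      cont := by
        have h : (fun f : HC r => (HC.const (f 0) : HC r)) = fun f => HC.evalL 0 f • HC.const 1 := by
          funext f; ext x; simp
        rw [h]
        exact (HC.evalL (r := r) 0).continuous.smul continuous_const }).codRestrict (H0C r) (by
    intro f
    change (f - HC.const (f 0) : HC r) 0 = 0
    simp)

theorem sub0_coe (f : HC r) : (sub0 f : HC r) = f - HC.const (f 0) := rfl

/-- `f ↦ f(· + a)/f(a) - 1`. -/
def dehom (a : UnitAddCircle) (f : HC r) : H0C r := sub0 ((f a)⁻¹ • HC.translate a f)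

/-- The inverse `g ↦ (1 + g)(· - a)` of a chart, before taking the class. -/
def hom (a : UnitAddCircle) (g : H0C r) : HC r :=
  HC.translate (-a) (HC.const 1 + (g : HC r))

theorem dehom_apply (a : UnitAddCircle) (f : HC r) (ha : f a ≠ 0) (x : UnitAddCircle) :
    (dehom a f : HC r) x = f (x + a) / f a - 1 := by
  unfold dehom
  rw [sub0_coe]
  simp [ha, div_eq_inv_mul]

theorem hom_apply (a : UnitAddCircle) (g : H0C r) (x : UnitAddCircle) :
    hom a g x = 1 + (g : HC r) (x - a) := by
  simp [hom, sub_eq_add_neg]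

theorem coe_zero (g : H0C r) : (g : HC r) 0 = 0 := g.2

theorem hom_ne (a : UnitAddCircle) (g : H0C r) : hom a g ≠ 0 := by
  intro h
  have h1 := hom_apply a g a
  rw [h, sub_self, coe_zero] at h1
  simp at h1

theorem dehom_smul (a : UnitAddCircle) (f : HC r) (c : ℂ) (hc : c ≠ 0) :
    dehom a (c • f) = dehom a f := by
  unfold dehom
  congr 1
  ext x
  simp only [HC.smul_apply, HC.translate_apply]
  rw [mul_inv]
  field_simp

theorem rep_mk (f : HC r) (hf : f ≠ 0) : ∃ c : ℂ, c ≠ 0 ∧ rep (mk f hf) = c • f := by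
  have h := mk_rep (mk f hf)
  rw [mk_eq_mk] at h
  obtain ⟨c, hc⟩ := h
  refine ⟨c, ?_, hc.symm⟩
  rintro rfl
  rw [zero_smul] at hc
  exact rep_ne _ hc.symm

/-- The chart `[f] ↦ f(· + a)/f(a)` on the set `W_a` of the classes `[f]` with `f(a) ≠ 0`. The
model space `{g | g(0) = 1}` is identified with `{g | g(0) = 0}` by subtracting `1`. -/
def chart (a : UnitAddCircle) : PartialEquiv (CP r) (H0C r) where
  toFun P := dehom a (rep P)
  invFun g := mk (hom a g) (hom_ne a g)
  source := {P | rep P a ≠ 0}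
  target := Set.univ
  map_source' _ _ := Set.mem_univ _
  map_target' g _ := by
    obtain ⟨c, hc, e⟩ := rep_mk (hom a g) (hom_ne a g)
    change rep (mk _ _) a ≠ 0
    rw [e, HC.smul_apply, hom_apply, sub_self, coe_zero]
    simpa using hc
  left_inv' P hP := by
    conv_rhs => rw [← mk_rep P]
    rw [mk_eq_mk]
    refine ⟨(rep P a)⁻¹, ?_⟩
    ext x
    rw [hom_apply, dehom_apply a _ hP, sub_add_cancel, HC.smul_apply]
    ring
  right_inv' g _ := by
    obtain ⟨c, hc, e⟩ := rep_mk (hom a g) (hom_ne a g)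
    rw [e, dehom_smul _ _ _ hc]
    have h1 : hom a g a = 1 := by rw [hom_apply, sub_self, coe_zero, add_zero]
    apply Subtype.ext
    ext x
    rw [dehom_apply _ _ (by rw [h1]; exact one_ne_zero), h1, hom_apply]
    simp

theorem chart_mk (a : UnitAddCircle) (f : HC r) (hf : f ≠ 0) :
    chart a (mk f hf) = dehom a f := by
  obtain ⟨c, hc, e⟩ := rep_mk f hf
  change dehom a (rep _) = _
  rw [e, dehom_smul _ _ _ hc]

theorem mk_mem_source (a : UnitAddCircle) (f : HC r) (hf : f ≠ 0) :
    mk f hf ∈ (chart a).source ↔ f a ≠ 0 := by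
  obtain ⟨c, hc, e⟩ := rep_mk f hf
  change rep _ a ≠ 0 ↔ _
  rw [e]; simp [hc]

theorem exists_rep_ne (P : CP r) : ∃ a, rep P a ≠ 0 := by
  by_contra h
  push Not at h
  exact rep_ne P (by ext x; rw [h x]; rfl)

theorem trans_source (a b : UnitAddCircle) :
    ((chart a).symm.trans (chart b) : PartialEquiv (H0C r) (H0C r)).source
      = {g | hom a g b ≠ 0} := by
  ext g
  rw [PartialEquiv.trans_source]
  simp only [Set.mem_inter_iff, Set.mem_preimage]
  change True ∧ mk (hom a g) (hom_ne a g) ∈ (chart b).source ↔ _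
  rw [mk_mem_source, true_and]; rfl

theorem trans_apply (a b : UnitAddCircle) (g : H0C r) :
    ((chart a).symm.trans (chart b) : PartialEquiv (H0C r) (H0C r)) g = dehom b (hom a g) :=
  chart_mk b _ _

theorem contDiff_hom (a : UnitAddCircle) : ContDiff ℝ ∞ (hom a : H0C r → HC r) := by
  have h1 : ContDiff ℝ ∞ fun g : H0C r => (g : HC r) := (H0C r).subtypeL.contDiff
  have h2 : ContDiff ℝ ∞ (HC.translate (-a) : HC r → HC r) :=
    ((HC.translate (r := r) (-a)).restrictScalars ℝ).contDiff
  exact h2.comp (contDiff_const.add h1)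

theorem contDiffAt_dehom (a : UnitAddCircle) (f : HC r) (hf : f a ≠ 0) :
    ContDiffAt ℝ ∞ (dehom a : HC r → H0C r) f := by
  have h1 : ContDiff ℝ ∞ fun f : HC r => f a :=
    ((HC.evalL (r := r) a).restrictScalars ℝ).contDiff
  have h2 : ContDiff ℝ ∞ (HC.translate a : HC r → HC r) :=
    ((HC.translate (r := r) a).restrictScalars ℝ).contDiff
  have h3 : ContDiff ℝ ∞ (sub0 : HC r → H0C r) := sub0.contDiff
  exact h3.contDiffAt.comp f (ContDiffAt.smul (h1.contDiffAt.inv hf) h2.contDiffAt)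

theorem contDiffAt_trans (a b : UnitAddCircle) (g : H0C r) (hg : hom a g b ≠ 0) :
    ContDiffAt ℝ ∞ ((chart a).symm.trans (chart b) : PartialEquiv (H0C r) (H0C r)) g := by
  have : ⇑((chart a).symm.trans (chart b) : PartialEquiv (H0C r) (H0C r))
      = fun g => dehom b (hom a g) := funext (trans_apply a b)
  rw [this]
  exact (contDiffAt_dehom b _ hg).comp g (contDiff_hom a).contDiffAt

/-- The atlas of `ℂP^{∞,r}`. -/
def core (r : ℝ) [Fact (1 / 2 < r)] : ChartedSpaceCore (H0C r) (CP r) where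
  atlas := Set.range chart
  chartAt P := chart (exists_rep_ne P).choose
  mem_chart_source P := (exists_rep_ne P).choose_spec
  chart_mem_atlas P := ⟨_, rfl⟩
  open_source := by
    rintro _ _ ⟨a, rfl⟩ ⟨b, rfl⟩
    rw [trans_source]
    exact isOpen_ne_fun ((HC.evalL (r := r) b).continuous.comp (contDiff_hom a).continuous)
      continuous_const
  continuousOn_toFun := by
    rintro _ _ ⟨a, rfl⟩ ⟨b, rfl⟩
    rw [trans_source]
    exact fun g hg => (contDiffAt_trans a b g hg).continuousAt.continuousWithinAt

instance : TopologicalSpace (CP r) := (core r).toTopologicalSpace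
instance : ChartedSpace (H0C r) (CP r) := (core r).toChartedSpace

instance : IsManifold 𝓘(ℝ, H0C r) ∞ (CP r) := by
  apply isManifold_of_contDiffOn
  intro e e' he he'
  change e ∈ ⋃ (e : PartialEquiv (CP r) (H0C r)) (he : _), {_} at he
  change e' ∈ ⋃ (e : PartialEquiv (CP r) (H0C r)) (he : _), {_} at he'
  simp only [Set.mem_iUnion, Set.mem_singleton_iff] at he he'
  obtain ⟨_, ⟨a, rfl⟩, rfl⟩ := he
  obtain ⟨_, ⟨b, rfl⟩, rfl⟩ := he'
  rintro g ⟨hg, -⟩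
  change g ∈ ((chart a).symm.trans (chart b)).source at hg
  rw [trans_source] at hg
  exact (contDiffAt_trans a b g hg).contDiffWithinAt

end charts

/-- The projection `q : S^{∞,r} → ℂP^{∞,r}`, `f ↦ [f]`. -/
def q (r : ℝ) (f : Sph r) : CP r := mk (Sph.incl f) f.ne_zero

theorem q_surjective (r : ℝ) : Function.Surjective (q r) := by
  intro P
  have hN : 0 < l2 (rep P) (rep P) :=
    lt_of_le_of_ne (HC.l2_self_nonneg _) fun h => rep_ne P (HC.eq_zero_of_l2_self h.symm)
  set c := (Real.sqrt (l2 (rep P) (rep P)))⁻¹ with hc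
  have hc0 : c ≠ 0 := by positivity
  refine ⟨⟨c • rep P, ?_⟩, ?_⟩
  · rw [← HC.l2_self, HC.l2_smul_left, HC.l2_smul_right, ← mul_assoc, hc, ← mul_inv,
      Real.mul_self_sqrt hN.le, inv_mul_cancel₀ hN.ne']
  · conv_rhs => rw [← mk_rep P]
    unfold q
    rw [mk_eq_mk]
    exact ⟨(c : ℂ), rfl⟩

end CP

end TwoHS

/-! ### Weak Riemannian manifolds -/

namespace TwoHS

section Riemannian

variable {E E' H H' M N : Type} [NormedAddCommGroup E] [NormedSpace ℝ E]
  [NormedAddCommGroup E'] [NormedSpace ℝ E'] [TopologicalSpace H] [TopologicalSpace H']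
  (I : ModelWithCorners ℝ E H) (J : ModelWithCorners ℝ E' H')
  [TopologicalSpace M] [ChartedSpace H M] [TopologicalSpace N] [ChartedSpace H' N]

/-- `f` is a smooth diffeomorphism from `M` onto the open submanifold `V` of `N`. -/
def IsDiffeoOnto (f : M → N) (V : Set N) : Prop :=
  IsOpen V ∧ Set.BijOn f Set.univ V ∧ ContMDiff I J ∞ f ∧
    ∃ g : N → M, Function.LeftInverse g f ∧ ContMDiffOn J I ∞ g V

/-- `f` preserves the metrics `gM` and `gN`. -/
def PreservesMetric (gM : ∀ x : M, TangentSpace I x → TangentSpace I x → ℝ)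
    (gN : ∀ y : N, TangentSpace J y → TangentSpace J y → ℝ) (f : M → N) : Prop :=
  ∀ (x : M) (v w : TangentSpace I x),
    gN (f x) (mfderiv I J f x v) (mfderiv I J f x w) = gM x v w

/-- The horizontal subspace `(ker T_x f)^⊥`. -/
def horizontal (gM : ∀ x : M, TangentSpace I x → TangentSpace I x → ℝ) (f : M → N) (x : M) :
    Set (TangentSpace I x) :=
  {v | ∀ w : TangentSpace I x, mfderiv I J f x w = 0 → gM x v w = 0}

/-- `f` is a smooth submersion whose differential restricts, at each point `x`, to an isometry
of the horizontal subspace onto the tangent space at `f x`. -/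
structure IsRiemannianSubmersion (gM : ∀ x : M, TangentSpace I x → TangentSpace I x → ℝ)
    (gN : ∀ y : N, TangentSpace J y → TangentSpace J y → ℝ) (f : M → N) : Prop where
  submersion : Manifold.IsSubmersion I J ∞ f
  bijOn : ∀ x, Set.BijOn (mfderiv I J f x) (horizontal I J gM f x) Set.univ
  isometry : ∀ x, ∀ v ∈ horizontal I J gM f x, ∀ w ∈ horizontal I J gM f x,
    gN (f x) (mfderiv I J f x v) (mfderiv I J f x w) = gM x v w

end Riemannian

/-! ### The manifolds `G^s` and `K^s` -/

section GK

variable (s : ℝ) [Fact (5 / 2 < s)]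

/-- The manifold `G^s = Diff₀^s(S¹) × H^{s-1}(S¹; S¹_{4π})`. -/
abbrev G : Type := Diff0 s × HCirc (s - 1)

/-- The manifold `K^s = Diff₀^s(S¹) × H^{s-1}(S¹; S¹_{4π})/S¹_{4π}`. -/
abbrev K : Type := Diff0 s × HCircMod (s - 1)

/-- The model of `G^s`. -/
abbrev IG : ModelWithCorners ℝ (H0R s × HR (s - 1)) (ModelProd (H0R s) (HR (s - 1))) :=
  𝓘(ℝ, H0R s).prod 𝓘(ℝ, HR (s - 1))

/-- The model of `K^s`. -/
abbrev IK : ModelWithCorners ℝ (H0R s × HRmod (s - 1)) (ModelProd (H0R s) (HRmod (s - 1))) :=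
  𝓘(ℝ, H0R s).prod 𝓘(ℝ, HRmod (s - 1))

/-- The projection `p(φ, α) = (φ, [α])`. -/
def p (g : G s) : K s := (g.1, HCircMod.mk g.2)

variable {s}

/-- The metric `⟨U, V⟩ = ¼ ∫ (U₁ₓ V₁ₓ / φₓ + U₂ V₂ φₓ) dx` at the point `(φ, α)` of `G^s`. -/
def metricG (g : G s) (U V : TangentSpace (IG s) g) : ℝ :=
  let U' : H0R s × HR (s - 1) := U
  let V' : H0R s × HR (s - 1) := V
  1 / 4 * ∫ x : UnitAddCircle,
    (dx (U'.1 : HR s) x * dx (V'.1 : HR s) x / phiX g.1 x + U'.2 x * V'.2 x * phiX g.1 x)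

theorem continuous_phiX (φ : Diff0 s) : Continuous (phiX φ) :=
  continuous_const.add (HR.continuous_dx (φ.1 : HR s))

theorem integrable_of_continuous {f : UnitAddCircle → ℝ} (hf : Continuous f) :
    MeasureTheory.Integrable f :=
  hf.integrable_of_hasCompactSupport (HasCompactSupport.of_compactSpace _)

theorem integral_dx (h : HR s) : ∫ x : UnitAddCircle, dx h x = 0 := by
  rw [← UnitAddCircle.intervalIntegral_preimage 0]
  have hd : ∀ t : ℝ, HasDerivAt (fun t : ℝ => h (t : UnitAddCircle)) (dx h (t : UnitAddCircle)) t := by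
    intro t
    have h1 := HR.hasDerivAt_apply h (t : UnitAddCircle)
    rw [← HR.dx_eq] at h1
    have h3 : HasDerivAt (fun u : ℝ => h ((t : UnitAddCircle) + (u : UnitAddCircle)))
        (dx h (t : UnitAddCircle)) (t - t) := by rw [sub_self]; exact h1
    have h2 := h3.comp_sub_const t t
    refine h2.congr_of_eventuallyEq (Filter.Eventually.of_forall fun u => ?_)
    change h _ = h _
    rw [← AddCircle.coe_add]; congr 2; ring
  rw [intervalIntegral.integral_eq_sub_of_hasDerivAt (fun t _ => hd t)
    (((HR.continuous_dx h).comp (AddCircle.continuous_mk' _)).intervalIntegrable _ _)]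
  have : ((0 + 1 : ℝ) : UnitAddCircle) = ((0 : ℝ) : UnitAddCircle) := by
    rw [AddCircle.coe_add]; simp
  rw [this, sub_self]

theorem integral_phiX (φ : Diff0 s) : ∫ x, phiX φ x = 1 := by
  unfold phiX
  rw [MeasureTheory.integral_add (integrable_of_continuous continuous_const)
    (integrable_of_continuous (HR.continuous_dx _)), integral_dx]
  simp [volume_univ]

/-- The projection `π(U) = U - ∫ U φ_x dx` on classes modulo constants. -/
def piAt (φ : Diff0 s) : HRmod (s - 1) → UnitAddCircle → ℝ :=
  Quotient.lift (fun (U : HR (s - 1)) (x : UnitAddCircle) => U x - ∫ y, U y * phiX φ y) (by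
    intro U V h
    have h1 : U - V ∈ constR (s - 1) :=
      (Submodule.Quotient.eq _).1 (Quotient.sound h : (Submodule.Quotient.mk U : HRmod (s - 1)) = _)
    obtain ⟨c, hc⟩ := mem_constR.1 h1
    have hU : ∀ x, U x = V x + c := fun x => by have := hc x; rw [HR.sub_apply] at this; linarith
    funext x
    have e : ∫ y, U y * phiX φ y = (∫ y, V y * phiX φ y) + c := by
      have e1 : (fun y => U y * phiX φ y) = fun y => V y * phiX φ y + c * phiX φ y := by
        funext y; rw [hU y, add_mul]
      have i1 : MeasureTheory.Integrable fun y => V y * phiX φ y :=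
        integrable_of_continuous (V.continuous_coe.mul (continuous_phiX φ))
      have i2 : MeasureTheory.Integrable fun y => c * phiX φ y :=
        integrable_of_continuous (continuous_const.mul (continuous_phiX φ))
      rw [e1, MeasureTheory.integral_add i1 i2, MeasureTheory.integral_const_mul, integral_phiX,
        mul_one]
    change U x - ∫ y, U y * phiX φ y = V x - ∫ y, V y * phiX φ y
    rw [e, hU x]
    ring)

theorem piAt_mk (φ : Diff0 s) (U : HR (s - 1)) (x : UnitAddCircle) :
    piAt φ (Submodule.Quotient.mk U) x = U x - ∫ y, U y * phiX φ y := rfl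

/-- The metric `⟨(U₁, [U₂]), (V₁, [V₂])⟩ = ¼ ∫ (U₁ₓ V₁ₓ / φₓ + π(U₂) π(V₂) φₓ) dx` at the
point `(φ, [α])` of `K^s`. -/
def metricK (k : K s) (U V : TangentSpace (IK s) k) : ℝ :=
  let U' : H0R s × HRmod (s - 1) := U
  let V' : H0R s × HRmod (s - 1) := V
  1 / 4 * ∫ x : UnitAddCircle,
    (dx (U'.1 : HR s) x * dx (V'.1 : HR s) x / phiX k.1 x
      + piAt k.1 U'.2 x * piAt k.1 V'.2 x * phiX k.1 x)

end GK

/-! ### The metrics on the sphere and on projective space -/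

section FS

variable {r : ℝ} [Fact (1 / 2 < r)]

/-- A tangent vector of the sphere as an element of `H^r(S¹; ℂ)`. -/
def Sph.vec (f : Sph r) (X : TangentSpace 𝓘(ℝ, onePerp r) f) : HC r :=
  mfderiv 𝓘(ℝ, onePerp r) 𝓘(ℝ, HC r) (Sph.incl : Sph r → HC r) f X

/-- The `L²` metric of the sphere. -/
def metricSph (f : Sph r) (X Y : TangentSpace 𝓘(ℝ, onePerp r) f) : ℝ :=
  l2 (Sph.vec f X) (Sph.vec f Y)

/-- The horizontal component `X^h = X + i f Im ∫ f X̄`. -/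
def horPart (f : Sph r) (X : HC r) : HC r :=
  X + (Complex.I * ((∫ x, Sph.incl f x * starRingEnd ℂ (X x)).im : ℂ)) • Sph.incl f

/-- The Fubini–Study metric `⟨Tq X, Tq Y⟩ = ⟨X^h, Y^h⟩_{L²}`: at a point `P`, choose `f` in the
sphere with `q f = P`, and for tangent vectors `ξ`, `η` at `P` choose `X`, `Y` with `T_f q X = ξ`,
`T_f q Y = η`. -/
def fubiniStudy (P : CP r) (ξ η : TangentSpace 𝓘(ℝ, H0C r) P) : ℝ :=
  let f : Sph r := Function.surjInv (CP.q_surjective r) P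
  let T : onePerp r → H0C r := mfderiv 𝓘(ℝ, onePerp r) 𝓘(ℝ, H0C r) (CP.q r) f
  l2 (horPart f (Sph.vec f (Function.invFun T ξ))) (horPart f (Sph.vec f (Function.invFun T η)))

variable (r)

/-- The set `𝒰^r` of the nowhere vanishing functions in the sphere. -/
def setU : Set (Sph r) := {f | ∀ x, Sph.incl f x ≠ 0}

/-- The image `𝒱^r` of `𝒰^r` in projective space. -/
def setV : Set (CP r) := CP.q r '' setU r

end FS

end TwoHS

end

open TwoHS

/-!
The map `Φ` is the Madelung transform. It is an isometry because its differential is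
`TΦ(U₁, U₂) = ½ Φ (U₁ₓ / φ_x + i U₂)` and `|Φ|² = φ_x`, so that the `L²` inner product of two such
vectors is the metric of `G^s` (`madelungD_apply`, `l2_madelungD`). It is invertible because
`φ_x = |f|²` and `φ(0) = 0` determine `φ`, and the phase of `f = Φ(φ, α)` is `e^{iα/2}`: since
`∫ |f|² = 1`, the primitive of `|f|²` vanishing at `0` is a diffeomorphism of the circle, and a
continuous choice of argument of a nowhere vanishing `f` of class `H^{s-1}` is again of class
`H^{s-1}` (`exists_phase_lift`, `exists_local_inverse_madelung`).

The analysis behind this is that of the Banach algebra `H^r`, `r > 1/2`. A character `χ` of this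
algebra satisfies `|χ(e^{2πix})|ⁿ ≤ ‖χ‖ (1 + n²)^{r/2}`, and likewise for `e^{-2πix}`, whence
`|χ(e^{2πix})| = 1`, and `χ` is the evaluation at a point (`HC.character_eq_eval`). The spectrum of
`f` is therefore its range. This gives inverses of nowhere vanishing functions (`HC.exists_inv`),
logarithms of functions close to `1` by the power series (`HC.exists_log_one_add`), and, after
division by the exponential of a trigonometric polynomial, of all functions with a continuous
logarithm (`HC.exists_of_exp`). The exponential is smooth, being a power series in the algebra, and
so is, near `1`, the logarithm, by the inverse function theorem (`HC.contDiff_expH`,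
`HC.exists_smooth_log`). Differentiation and integration are Fourier multipliers between `H^s` and
`H^{s-1}` (`derivR`, `primR`).

The statements on `K^s` and the projective space are deduced from those on `G^s` and the sphere.
`Φ` is equivariant, hence descends to an injective `Ψ`, and smooth local sections of `p` and of
`g ↦ [g]` (`exists_section_p`, `CP.exists_section`) carry over the smoothness of `Φ` and of its
local inverses. The Fubini-Study product of `Tq(Y)` and `Tq(Z)` may be computed from any unit
representative and any lifts, by removing the components along the complex line of the
representative (`fubiniStudy_proj`). For the vector `TΦ(U₁, U₂)` this amounts to
replacing `U₂` by `π(U₂)` (`horC_madelungD`), since `∫ U₁ₓ = 0`, which makes `Ψ` an isometry.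

In suitable charts `p` and `q` are linear projections with one-dimensional kernel. For `p` these
are the given charts, with the splitting `h ↦ ([h], h(0))` of the model space; for `q` the sphere
needs charts adapted to the fibres, in which a function is described by its class and the argument
of its value at a point (`CP.adaptedChart`).
-/

set_option linter.unusedSectionVars false

noncomputable section

namespace TwoHS

/-! ### Fourier coefficients and the space `H^r` -/

/-- The `n`-th Fourier coefficient as a continuous functional on continuous functions. -/
def coeffCL (n : ℤ) : C(UnitAddCircle, ℂ) →L[ℂ] ℂ :=
  LinearMap.mkContinuous
    { toFun := fun f => fourierCoeff (⇑f) n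
      map_add' := fun f g => fourierCoeff_add' f g n
      map_smul' := fun c f => fourierCoeff_smul' c f n } 1 fun f => by
    change ‖fourierCoeff (⇑f) n‖ ≤ 1 * ‖f‖
    unfold fourierCoeff
    refine (MeasureTheory.norm_integral_le_of_norm_le_const (C := ‖f‖)
      (Filter.Eventually.of_forall fun t => ?_)).trans ?_
    · rw [norm_smul, HC.norm_fourier_apply, one_mul]; exact f.norm_coe_le_norm t
    · simp

theorem coeffCL_apply (n : ℤ) (f : C(UnitAddCircle, ℂ)) : coeffCL n f = fourierCoeff (⇑f) n := rfl

theorem fourierCoeff_fourier_apply (m n : ℤ) :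
    fourierCoeff (⇑(fourier (T := 1) m)) n = if n = m then 1 else 0 := by
  rw [fourierCoeff_fourier]; simp [Pi.single_apply]

theorem fourierCoeff_fourier_mul (f : C(UnitAddCircle, ℂ)) (m n : ℤ) :
    fourierCoeff (⇑(fourier (T := 1) m * f)) n = fourierCoeff (⇑f) (n - m) := by
  unfold fourierCoeff
  congr 1; funext t
  rw [ContinuousMap.mul_apply, smul_eq_mul, smul_eq_mul, ← mul_assoc, ← fourier_add]
  congr 3; ring

theorem norm_fourier_continuousMap (m : ℤ) : ‖fourier (T := 1) m‖ = 1 := fourier_norm m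

theorem summable_smul_fourier {c : ℤ → ℂ} (hc : Summable fun n => ‖c n‖) :
    Summable fun m => c m • fourier (T := 1) m := by
  refine Summable.of_norm ?_
  simpa only [norm_smul, norm_fourier_continuousMap, mul_one] using hc

theorem fourierCoeff_tsum {c : ℤ → ℂ} (hc : Summable fun n => ‖c n‖) (n : ℤ) :
    fourierCoeff (⇑(∑' m, c m • fourier (T := 1) m)) n = c n := by
  rw [← coeffCL_apply, (coeffCL n).map_tsum (summable_smul_fourier hc)]
  rw [tsum_eq_single n]
  · rw [map_smul, coeffCL_apply, fourierCoeff_fourier_apply]; simp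
  · intro m hm
    rw [map_smul, coeffCL_apply, fourierCoeff_fourier_apply, if_neg hm.symm, smul_zero]

theorem hasSum_fourierCoeff_mul (f g : C(UnitAddCircle, ℂ))
    (hf : Summable fun n => ‖fourierCoeff (⇑f) n‖) (n : ℤ) :
    HasSum (fun m => fourierCoeff (⇑f) m * fourierCoeff (⇑g) (n - m))
      (fourierCoeff (⇑(f * g)) n) := by
  have h1 := hasSum_fourier_series_of_summable hf.of_norm
  have h2 := (h1.mul_right g).mapL (coeffCL n)
  simpa only [smul_mul_assoc, map_smul, coeffCL_apply, fourierCoeff_fourier_mul,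
    smul_eq_mul] using h2

theorem wt_zero (r : ℝ) : wt r 0 = 1 := by simp [wt]

/-- The weights are quasi-subadditive. -/
theorem wt_le {r : ℝ} (hr : 0 ≤ r) (m k : ℤ) :
    wt r (m + k) ≤ 4 ^ (r / 2) * (wt r m + wt r k) := by
  have key : ∀ a b : ℝ, |a| ≤ |b| →
      (1 + (a + b) ^ 2) ^ (r / 2) ≤ 4 ^ (r / 2) * (1 + b ^ 2) ^ (r / 2) := by
    intro a b hab
    rw [← Real.mul_rpow (by norm_num) (by positivity)]
    refine Real.rpow_le_rpow (by positivity) ?_ (by linarith)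
    have := sq_le_sq.2 hab
    nlinarith [sq_nonneg (a - b)]
  have hm := (wt_pos r m).le
  have hk := (wt_pos r k).le
  unfold wt at *
  push_cast
  have h4 : (0 : ℝ) ≤ 4 ^ (r / 2) := by positivity
  rcases le_total |(m : ℝ)| |(k : ℝ)| with h | h
  · refine (key _ _ h).trans ?_
    gcongr
    linarith
  · rw [add_comm (m : ℝ)]
    refine (key _ _ h).trans ?_
    gcongr
    linarith

namespace HC
variable {r : ℝ}

theorem summable_sq (f : HC r) : Summable fun n => (wt r n * ‖fourierCoeff (⇑f) n‖) ^ 2 := by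
  have hc : Summable fun n => ‖(coeffs f : ∀ _ : ℤ, ℂ) n‖ ^ (2 : ℝ) := by
    simpa using (lp.memℓp (coeffs f)).summable (by norm_num)
  refine hc.congr fun n => ?_
  rw [coeffs_apply, norm_mul, Complex.norm_real, Real.norm_of_nonneg (wt_pos r n).le]
  norm_cast

theorem norm_sq_eq (f : HC r) : ‖f‖ ^ 2 = ∑' n, (wt r n * ‖fourierCoeff (⇑f) n‖) ^ 2 := by
  have h := lp.norm_rpow_eq_tsum (p := 2) (by norm_num) (coeffs f)
  rw [norm_def]
  have e : ∀ n, ‖(coeffs f : ∀ _ : ℤ, ℂ) n‖ ^ (2 : ENNReal).toReal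
      = (wt r n * ‖fourierCoeff (⇑f) n‖) ^ 2 := by
    intro n
    rw [coeffs_apply, norm_mul, Complex.norm_real, Real.norm_of_nonneg (wt_pos r n).le]
    norm_cast
  simp only [e] at h
  rw [← h]; norm_cast

theorem mem_sobolev_iff (f : C(UnitAddCircle, ℂ)) :
    f ∈ sobolev r ↔ Summable fun n => (wt r n * ‖fourierCoeff (⇑f) n‖) ^ 2 := by
  change Memℓp _ 2 ↔ _
  rw [memℓp_gen_iff (by norm_num)]
  refine summable_congr fun n => ?_
  rw [norm_mul, Complex.norm_real, Real.norm_of_nonneg (wt_pos r n).le]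
  norm_cast

theorem ext_coeff {f g : HC r} (h : ∀ n, fourierCoeff (⇑f) n = fourierCoeff (⇑g) n) : f = g := by
  apply coeffs_injective
  ext n
  rw [coeffs_apply, coeffs_apply, h n]

section
variable [hr : Fact (1 / 2 < r)]

theorem summable_of_sq {c : ℤ → ℂ} (hc : Summable fun n => (wt r n * ‖c n‖) ^ 2) :
    Summable fun n => ‖c n‖ := by
  have h := Real.summable_mul_of_Lp_Lq_of_nonneg Real.HolderConjugate.two_two
    (f := fun n => (wt r n)⁻¹) (g := fun n => wt r n * ‖c n‖)
    (fun n => (inv_pos.2 (wt_pos r n)).le) (fun n => mul_nonneg (wt_pos r n).le (norm_nonneg _))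
    (by simpa using summable_wt (r := r)) (by simpa using hc)
  refine h.congr fun n => ?_
  rw [inv_mul_cancel_left₀ (wt_pos r n).ne']

/-- The function with given Fourier coefficients. -/
def ofCoeff (c : ℤ → ℂ) (hc : Summable fun n => (wt r n * ‖c n‖) ^ 2) : HC r :=
  mk (∑' m, c m • fourier (T := 1) m) (by
    rw [mem_sobolev_iff]
    simpa only [fourierCoeff_tsum (summable_of_sq hc)] using hc)

theorem fourierCoeff_ofCoeff {c : ℤ → ℂ} (hc : Summable fun n => (wt r n * ‖c n‖) ^ 2) (n : ℤ) :
    fourierCoeff (⇑(ofCoeff c hc)) n = c n := fourierCoeff_tsum (summable_of_sq hc) n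

theorem coeffs_surjective : Function.Surjective (coeffs : HC r → _) := by
  intro a
  have h1 : Summable fun n => ‖a n‖ ^ 2 := by
    simpa using (lp.memℓp a).summable (by norm_num)
  have h2 : ∀ n, (wt r n * ‖((wt r n : ℂ))⁻¹ * a n‖) ^ 2 = ‖a n‖ ^ 2 := by
    intro n
    rw [norm_mul, norm_inv, Complex.norm_real, Real.norm_of_nonneg (wt_pos r n).le,
      mul_inv_cancel_left₀ (wt_pos r n).ne']
  refine ⟨ofCoeff (fun n => ((wt r n : ℂ))⁻¹ * a n) (by simpa only [h2] using h1), ?_⟩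
  ext n
  rw [coeffs_apply, fourierCoeff_ofCoeff,
    mul_inv_cancel_left₀ (by exact_mod_cast (wt_pos r n).ne')]

/-- `H^r` is isometric to `ℓ²` through the weighted Fourier coefficients. -/
def coeffsIso : HC r ≃ₗᵢ[ℂ] lp (fun _ : ℤ => ℂ) 2 where
  toLinearEquiv := LinearEquiv.ofBijective coeffs ⟨coeffs_injective, coeffs_surjective⟩
  norm_map' _ := rfl

instance : CompleteSpace (HC r) :=
  (completeSpace_congr (e := (coeffsIso (r := r)).toEquiv)
    (coeffsIso (r := r)).isometry.isUniformEmbedding).2 inferInstance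

end

/-- The Fourier multiplier with a given symbol, from `H^r` to `H^t`. -/
theorem exists_multiplier {t : ℝ} [Fact (1 / 2 < t)] (m : ℤ → ℂ) (C : ℝ)
    (hm : ∀ n, wt t n * ‖m n‖ ≤ C * wt r n) :
    ∃ M : HC r →L[ℂ] HC t, ∀ f n, fourierCoeff (⇑(M f)) n = m n * fourierCoeff (⇑f) n := by
  have hC : 0 ≤ C := by
    have h := hm 0
    rw [wt_zero, wt_zero] at h
    linarith [norm_nonneg (m 0)]
  have hle : ∀ (f : HC r) (n : ℤ), (wt t n * ‖m n * fourierCoeff (⇑f) n‖) ^ 2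
      ≤ C ^ 2 * (wt r n * ‖fourierCoeff (⇑f) n‖) ^ 2 := by
    intro f n
    rw [← mul_pow, norm_mul, ← mul_assoc, ← mul_assoc]
    have := (wt_pos t n).le
    exact pow_le_pow_left₀ (by positivity)
      (mul_le_mul_of_nonneg_right (hm n) (norm_nonneg _)) 2
  have hs : ∀ f : HC r, Summable fun n => (wt t n * ‖m n * fourierCoeff (⇑f) n‖) ^ 2 := fun f =>
    Summable.of_nonneg_of_le (fun n => by positivity) (hle f) ((summable_sq f).mul_left _)
  refine ⟨LinearMap.mkContinuous
    { toFun := fun f => ofCoeff _ (hs f)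
      map_add' := fun f g => ext_coeff fun n => ?_
      map_smul' := fun c f => ext_coeff fun n => ?_ } C fun f => ?_, fun f n =>
        fourierCoeff_ofCoeff (hs f) n⟩
  · have e : ∀ f g : HC t, fourierCoeff (⇑(f + g)) n = fourierCoeff (⇑f) n + fourierCoeff (⇑g) n :=
      fun f g => fourierCoeff_add' (toC f) (toC g) n
    have e' : ∀ f g : HC r, fourierCoeff (⇑(f + g)) n = fourierCoeff (⇑f) n + fourierCoeff (⇑g) n :=
      fun f g => fourierCoeff_add' (toC f) (toC g) n
    rw [e, fourierCoeff_ofCoeff, fourierCoeff_ofCoeff, fourierCoeff_ofCoeff, e', mul_add]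
  · have e : ∀ f : HC t, fourierCoeff (⇑(c • f)) n = c • fourierCoeff (⇑f) n :=
      fun f => fourierCoeff_smul' c (toC f) n
    have e' : ∀ f : HC r, fourierCoeff (⇑(c • f)) n = c • fourierCoeff (⇑f) n :=
      fun f => fourierCoeff_smul' c (toC f) n
    rw [RingHom.id_apply, e, fourierCoeff_ofCoeff, fourierCoeff_ofCoeff, e']
    simp only [smul_eq_mul]; ring
  · change ‖ofCoeff _ (hs f)‖ ≤ _
    refine abs_le_of_sq_le_sq' ?_ (by positivity) |>.2
    rw [norm_sq_eq, mul_pow, norm_sq_eq f, ← tsum_mul_left]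
    simp only [fourierCoeff_ofCoeff]
    exact (hs f).tsum_le_tsum (hle f) ((summable_sq f).mul_left _)

section
variable [hr : Fact (1 / 2 < r)]

/-- The constant in the estimate `‖f g‖ ≤ C ‖f‖ ‖g‖`. -/
def mulC (r : ℝ) : ℝ := (4 ^ (r / 2)) ^ 2 * (4 * ∑' n : ℤ, (wt r n)⁻¹ ^ 2)

theorem mulC_nonneg : 0 ≤ mulC r := by
  unfold mulC
  have : 0 ≤ ∑' n : ℤ, (wt r n)⁻¹ ^ 2 := tsum_nonneg fun n => by positivity
  positivity

/-- The Cauchy-Schwarz estimate of the Fourier coefficients of a product: by `wt_le` the weight of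
`n` is controlled by those of `m` and `n - m`, and the sum over `m` is estimated against the
square summable sequence `m ↦ 1 / wt r m + 1 / wt r (n - m)`. -/
theorem coeff_mul_le (f g : HC r) (n : ℤ) :
    (wt r n * ‖fourierCoeff (⇑(toC f * toC g)) n‖) ^ 2 ≤ mulC r *
      ∑' m, (wt r m * ‖fourierCoeff (⇑f) m‖) ^ 2 *
        (wt r (n - m) * ‖fourierCoeff (⇑g) (n - m)‖) ^ 2 := by
  set A : ℤ → ℝ := fun m => wt r m * ‖fourierCoeff (⇑f) m‖ with hA
  set B : ℤ → ℝ := fun m => wt r m * ‖fourierCoeff (⇑g) m‖ with hB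
  have hA0 : ∀ m, 0 ≤ A m := fun m => mul_nonneg (wt_pos r m).le (norm_nonneg _)
  have hB0 : ∀ m, 0 ≤ B m := fun m => mul_nonneg (wt_pos r m).le (norm_nonneg _)
  have hr0 : 0 ≤ r := by have := hr.out; linarith
  have hAB : Summable fun p : ℤ × ℤ => A p.1 ^ 2 * B p.2 ^ 2 :=
    (summable_sq f).mul_of_nonneg (summable_sq g) (fun _ => sq_nonneg _) (fun _ => sq_nonneg _)
  have hABn : Summable fun m => (A m * B (n - m)) ^ 2 := by
    have hi : Function.Injective fun m : ℤ => (m, n - m) := fun a b h => (Prod.ext_iff.1 h).1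
    refine (hAB.comp_injective hi).congr fun m => ?_
    simp [mul_pow]
  set W : ℤ → ℝ := fun m => (wt r m)⁻¹ + (wt r (n - m))⁻¹ with hW
  have hw0 : ∀ m, 0 < (wt r m)⁻¹ := fun m => inv_pos.2 (wt_pos r m)
  have hw2 : Summable fun m => (wt r (n - m))⁻¹ ^ 2 :=
    summable_wt.comp_injective (sub_right_injective (b := n))
  have hWle : ∀ m, W m ^ 2 ≤ 2 * (wt r m)⁻¹ ^ 2 + 2 * (wt r (n - m))⁻¹ ^ 2 := by
    intro m
    simp only [hW]
    nlinarith [sq_nonneg ((wt r m)⁻¹ - (wt r (n - m))⁻¹)]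
  have hsum := (summable_wt (r := r).mul_left 2).add (hw2.mul_left 2)
  have hWs : Summable fun m => W m ^ 2 :=
    Summable.of_nonneg_of_le (fun _ => sq_nonneg _) hWle hsum
  have hWt : ∑' m, W m ^ 2 ≤ 4 * ∑' n : ℤ, (wt r n)⁻¹ ^ 2 := by
    refine (hWs.tsum_le_tsum hWle hsum).trans (le_of_eq ?_)
    have e : ∑' m, (wt r (n - m))⁻¹ ^ 2 = ∑' m, (wt r m)⁻¹ ^ 2 :=
      (Equiv.subLeft n).tsum_eq (fun m => (wt r m)⁻¹ ^ 2)
    rw [(summable_wt (r := r).mul_left 2).tsum_add (hw2.mul_left 2), tsum_mul_left, tsum_mul_left,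
      e]
    ring
  have hterm : ∀ m, wt r n * (‖fourierCoeff (⇑f) m‖ * ‖fourierCoeff (⇑g) (n - m)‖) ≤
      4 ^ (r / 2) * (W m * (A m * B (n - m))) := by
    intro m
    have h1 := wt_le hr0 m (n - m)
    rw [add_sub_cancel] at h1
    have h2 : W m * (A m * B (n - m)) = (wt r m + wt r (n - m)) *
        (‖fourierCoeff (⇑f) m‖ * ‖fourierCoeff (⇑g) (n - m)‖) := by
      simp only [hW, hA, hB]
      have := (wt_pos r m).ne'
      have := (wt_pos r (n - m)).ne'
      field_simp
      ring
    rw [h2, ← mul_assoc (4 ^ (r / 2))]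
    exact mul_le_mul_of_nonneg_right h1 (mul_nonneg (norm_nonneg _) (norm_nonneg _))
  have hCS := Real.inner_le_Lp_mul_Lq_tsum_of_nonneg Real.HolderConjugate.two_two
    (f := W) (g := fun m => A m * B (n - m))
    (fun m => (add_pos (hw0 _) (hw0 _)).le) (fun m => mul_nonneg (hA0 _) (hB0 _))
    (by simpa using hWs) (by simpa using hABn)
  have hWABs := Real.summable_mul_of_Lp_Lq_of_nonneg Real.HolderConjugate.two_two
    (f := W) (g := fun m => A m * B (n - m))
    (fun m => (add_pos (hw0 _) (hw0 _)).le) (fun m => mul_nonneg (hA0 _) (hB0 _))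
    (by simpa using hWs) (by simpa using hABn)
  have hprod := hasSum_fourierCoeff_mul (toC f) (toC g) (summable_coeff f).1 n
  have hps : Summable fun m => ‖fourierCoeff (⇑f) m‖ * ‖fourierCoeff (⇑g) (n - m)‖ := by
    refine Summable.of_nonneg_of_le (fun m => by positivity) (fun m => ?_)
      ((hWABs.mul_left (4 ^ (r / 2))).mul_left (wt r n)⁻¹)
    rw [le_inv_mul_iff₀ (wt_pos r n)]
    exact hterm m
  have h1 : wt r n * ‖fourierCoeff (⇑(toC f * toC g)) n‖ ≤
      4 ^ (r / 2) * ∑' m, W m * (A m * B (n - m)) := by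
    rw [← hprod.tsum_eq, ← tsum_mul_left]
    refine le_trans ?_ ((hps.mul_left (wt r n)).tsum_le_tsum hterm (hWABs.mul_left _))
    rw [tsum_mul_left]
    refine mul_le_mul_of_nonneg_left ?_ (wt_pos r n).le
    refine (norm_tsum_le_tsum_norm ?_).trans (le_of_eq ?_)
    · simp only [norm_mul]; exact hps
    · simp only [norm_mul]; rfl
  have h0 : 0 ≤ wt r n * ‖fourierCoeff (⇑(toC f * toC g)) n‖ :=
    mul_nonneg (wt_pos r n).le (norm_nonneg _)
  have hCS2 : (∑' m, W m * (A m * B (n - m))) ^ 2 ≤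
      (∑' m, W m ^ 2) * ∑' m, (A m * B (n - m)) ^ 2 := by
    have hn : 0 ≤ ∑' m, W m * (A m * B (n - m)) :=
      tsum_nonneg fun m => mul_nonneg (add_pos (hw0 _) (hw0 _)).le (mul_nonneg (hA0 _) (hB0 _))
    have := pow_le_pow_left₀ hn hCS 2
    refine this.trans (le_of_eq ?_)
    rw [mul_pow, ← Real.sqrt_eq_rpow, ← Real.sqrt_eq_rpow, Real.sq_sqrt, Real.sq_sqrt]
    · norm_cast
    · exact tsum_nonneg fun m => Real.rpow_nonneg (mul_nonneg (hA0 _) (hB0 _)) _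
    · exact tsum_nonneg fun m => Real.rpow_nonneg (add_pos (hw0 _) (hw0 _)).le _
  calc (wt r n * ‖fourierCoeff (⇑(toC f * toC g)) n‖) ^ 2
      ≤ (4 ^ (r / 2) * ∑' m, W m * (A m * B (n - m))) ^ 2 := pow_le_pow_left₀ h0 h1 2
    _ = (4 ^ (r / 2)) ^ 2 * (∑' m, W m * (A m * B (n - m))) ^ 2 := mul_pow _ _ _
    _ ≤ (4 ^ (r / 2)) ^ 2 * ((∑' m, W m ^ 2) * ∑' m, (A m * B (n - m)) ^ 2) := by gcongr
    _ ≤ (4 ^ (r / 2)) ^ 2 * ((4 * ∑' n : ℤ, (wt r n)⁻¹ ^ 2) * ∑' m, (A m * B (n - m)) ^ 2) := by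
        have : 0 ≤ ∑' m, (A m * B (n - m)) ^ 2 := tsum_nonneg fun m => sq_nonneg _
        gcongr
    _ = _ := by
        unfold mulC
        simp only [hA, hB, mul_pow]; ring

/-- The convolution of two summable sequences is summable, with sum the product of the sums. -/
theorem summable_conv (f g : HC r) :
    Summable (fun n => ∑' m, (wt r m * ‖fourierCoeff (⇑f) m‖) ^ 2 *
        (wt r (n - m) * ‖fourierCoeff (⇑g) (n - m)‖) ^ 2) ∧
    ∑' n, ∑' m, (wt r m * ‖fourierCoeff (⇑f) m‖) ^ 2 *
        (wt r (n - m) * ‖fourierCoeff (⇑g) (n - m)‖) ^ 2 = ‖f‖ ^ 2 * ‖g‖ ^ 2 := by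
  set A : ℤ → ℝ := fun m => (wt r m * ‖fourierCoeff (⇑f) m‖) ^ 2 with hA
  set B : ℤ → ℝ := fun m => (wt r m * ‖fourierCoeff (⇑g) m‖) ^ 2 with hB
  have hAB : Summable fun p : ℤ × ℤ => A p.1 * B p.2 :=
    (summable_sq f).mul_of_nonneg (summable_sq g) (fun _ => sq_nonneg _) (fun _ => sq_nonneg _)
  let e : ℤ × ℤ ≃ ℤ × ℤ :=
    { toFun := fun p => (p.2, p.1 - p.2)
      invFun := fun p => (p.1 + p.2, p.1)
      left_inv := fun p => by simp
      right_inv := fun p => by simp }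
  have h2 : Summable fun p : ℤ × ℤ => A p.2 * B (p.1 - p.2) := e.summable_iff.2 hAB
  refine ⟨h2.prod, ?_⟩
  have h3 : ∑' p : ℤ × ℤ, A p.2 * B (p.1 - p.2) = ∑' p : ℤ × ℤ, A p.1 * B p.2 :=
    e.tsum_eq (fun p : ℤ × ℤ => A p.1 * B p.2)
  rw [← h2.tsum_prod, h3, hAB.tsum_prod]
  simp only [tsum_mul_left, tsum_mul_right]
  rw [norm_sq_eq, norm_sq_eq]

theorem mul_mem (f g : HC r) : toC f * toC g ∈ sobolev r := by
  rw [mem_sobolev_iff]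
  exact Summable.of_nonneg_of_le (fun n => sq_nonneg _) (coeff_mul_le f g)
    ((summable_conv f g).1.mul_left _)

theorem norm_mul_le' (f g : HC r) :
    ‖mk _ (mul_mem f g)‖ ≤ Real.sqrt (mulC r) * ‖f‖ * ‖g‖ := by
  refine abs_le_of_sq_le_sq' ?_ (by positivity) |>.2
  rw [norm_sq_eq, mul_pow, mul_pow, Real.sq_sqrt mulC_nonneg, mul_assoc, ← (summable_conv f g).2,
    ← tsum_mul_left]
  exact (summable_sq (mk _ (mul_mem f g))).tsum_le_tsum (coeff_mul_le f g)
    ((summable_conv f g).1.mul_left _)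

/-- For `r > 1/2` the space `H^r` is a ring under pointwise multiplication. The instance is scoped, so
that elsewhere `0` and `•` on `H^r` are found through its normed space structure. -/
scoped instance commRing : CommRing (HC r) :=
  { (inferInstance : AddCommGroup (HC r)) with
    mul := fun f g => mk _ (mul_mem f g)
    one := const 1
    mul_assoc := fun f g h => ext fun x => mul_assoc (f x) (g x) (h x)
    one_mul := fun f => ext fun x => one_mul (f x)
    mul_one := fun f => ext fun x => mul_one (f x)
    mul_comm := fun f g => ext fun x => mul_comm (f x) (g x)
    left_distrib := fun f g h => ext fun x => mul_add (f x) (g x) (h x)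
    right_distrib := fun f g h => ext fun x => add_mul (f x) (g x) (h x)
    zero_mul := fun f => ext fun x => zero_mul (f x)
    mul_zero := fun f => ext fun x => mul_zero (f x) }

@[simp] theorem mul_apply (f g : HC r) (x : UnitAddCircle) : (f * g) x = f x * g x := rfl
@[simp] theorem one_apply (x : UnitAddCircle) : (1 : HC r) x = 1 := rfl

scoped instance algebra : Algebra ℂ (HC r) :=
  Algebra.ofModule (fun c f g => ext fun x => mul_assoc c (f x) (g x))
    (fun c f g => ext fun x => mul_left_comm (f x) c (g x))

/-- The multiplication of `H^r` as a bounded bilinear map. -/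
def mulL : HC r →L[ℂ] HC r →L[ℂ] HC r :=
  LinearMap.mkContinuous₂ (LinearMap.mul ℂ (HC r)) (Real.sqrt (mulC r)) norm_mul_le'

@[simp] theorem mulL_apply (f g : HC r) : mulL f g = f * g := rfl

/-- The exponential `x ↦ e^{2πinx}` in `H^r`. -/
def expMode (n : ℤ) : HC r :=
  ofCoeff (fun m => if m = n then 1 else 0) (by
    refine summable_of_ne_finset_zero (s := {n}) fun m hm => ?_
    rw [if_neg (by simpa using hm)]; simp)

theorem fourierCoeff_expMode (n m : ℤ) :
    fourierCoeff (⇑(expMode n : HC r)) m = if m = n then 1 else 0 := fourierCoeff_ofCoeff _ m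

theorem toC_expMode (n : ℤ) : toC (expMode n : HC r) = fourier (T := 1) n := by
  rw [← sub_eq_zero]
  refine eq_zero_of_fourierCoeff _ fun m => ?_
  rw [← coeffCL_apply, map_sub, coeffCL_apply, coeffCL_apply, fourierCoeff_fourier_apply,
    sub_eq_zero]
  exact fourierCoeff_expMode n m

theorem expMode_apply (n : ℤ) (x : UnitAddCircle) :
    (expMode n : HC r) x = fourier (T := 1) n x := by
  rw [← toC_apply, toC_expMode]

theorem norm_expMode (n : ℤ) : ‖(expMode n : HC r)‖ = wt r n := by
  have h : ‖(expMode n : HC r)‖ ^ 2 = wt r n ^ 2 := by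
    rw [norm_sq_eq, tsum_eq_single n]
    · simp [fourierCoeff_expMode]
    · intro m hm
      simp [fourierCoeff_expMode, hm]
  exact (sq_eq_sq₀ (norm_nonneg _) (wt_pos r n).le).1 h

theorem expMode_mul (m n : ℤ) : (expMode m * expMode n : HC r) = expMode (m + n) := by
  ext x
  rw [mul_apply, expMode_apply, expMode_apply, expMode_apply, fourier_add]

theorem expMode_zero : (expMode 0 : HC r) = 1 := by
  ext x; rw [expMode_apply, one_apply, fourier_zero]

/-- The Fourier series of `f` converges in `H^r`. -/
theorem hasSum_expMode (f : HC r) :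
    HasSum (fun n => fourierCoeff (⇑f) n • (expMode n : HC r)) f := by
  have h := lp.hasSum_single (p := 2) (by norm_num) (coeffs f)
  have h2 := h.mapL (coeffsIso (r := r)).symm.toContinuousLinearEquiv.toContinuousLinearMap
  have e1 :
      (coeffsIso (r := r)).symm.toContinuousLinearEquiv.toContinuousLinearMap (coeffs f) = f :=
    (coeffsIso (r := r)).symm_apply_apply f
  rw [e1] at h2
  refine h2.congr_fun fun n => ?_
  refine ((coeffsIso (r := r)).symm_apply_eq.2 ?_).symm
  change _ = coeffs _
  rw [map_smul]
  ext m
  have e2 : (coeffs (expMode n : HC r) : ∀ _ : ℤ, ℂ) m = (wt r m : ℂ) * if m = n then 1 else 0 := by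
    rw [coeffs_apply, fourierCoeff_expMode]
  have e3 : ((fourierCoeff (⇑f) n • coeffs (expMode n : HC r) : lp (fun _ : ℤ => ℂ) 2) :
      ∀ _ : ℤ, ℂ) m = fourierCoeff (⇑f) n * ((wt r m : ℂ) * if m = n then 1 else 0) := by
    rw [← e2]; rfl
  rw [e3, lp.single_apply]
  by_cases hm : m = n
  · subst hm; simp [coeffs_apply, mul_comm]
  · simp [hm]

end
end HC

open scoped HC

/-! ### The Banach algebra `H^r`: inverses, exponentials and logarithms -/

namespace HC
variable {r : ℝ} [hr : Fact (1 / 2 < r)]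

/-- Left multiplication as a homomorphism into the bounded operators. -/
def lmulHom : HC r →ₐ[ℂ] (HC r →L[ℂ] HC r) where
  toFun f := mulL f
  map_one' := by ext f x; simp
  map_mul' f g := by ext h x; simp [mul_assoc]
  map_zero' := map_zero _
  map_add' f g := map_add _ f g
  commutes' c := by
    ext f x
    rw [Algebra.algebraMap_eq_smul_one]
    change (c * 1) * f x = c * f x
    rw [mul_one]

theorem lmulHom_injective : Function.Injective (lmulHom : HC r →ₐ[ℂ] (HC r →L[ℂ] HC r)) := by
  intro f g h
  have := congrArg (fun T : HC r →L[ℂ] HC r => T 1) h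
  simpa [lmulHom] using this

end HC

/-- The space `H^r` with the submultiplicative norm `‖f‖ = sup {‖f g‖_r : ‖g‖_r ≤ 1}`. -/
def BA (r : ℝ) : Type := HC r

section
variable {r : ℝ} [hr : Fact (1 / 2 < r)]

instance : CommRing (BA r) := inferInstanceAs (CommRing (HC r))
instance : Algebra ℂ (BA r) := inferInstanceAs (Algebra ℂ (HC r))
instance : NormedCommRing (BA r) :=
  NormedCommRing.induced (BA r) (HC r →L[ℂ] HC r) (HC.lmulHom (r := r)) HC.lmulHom_injective
instance : NormedAlgebra ℂ (BA r) :=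
  NormedAlgebra.induced ℂ (BA r) (HC r →L[ℂ] HC r) (HC.lmulHom (r := r))

namespace HC

/-- The identity, as an isomorphism between the two norms. -/
def toBA : HC r ≃L[ℂ] BA r :=
  ContinuousLinearEquiv.mk
    { toFun := fun f => f
      invFun := fun f => f
      map_add' := fun _ _ => rfl
      map_smul' := fun _ _ => rfl
      left_inv := fun _ => rfl
      right_inv := fun _ => rfl }
    (AddMonoidHomClass.continuous_of_bound (LinearMap.mk ⟨fun f : HC r => (f : BA r),
        fun _ _ => rfl⟩ fun _ _ => rfl : HC r →ₗ[ℂ] BA r) ‖(mulL : HC r →L[ℂ] _)‖ fun f =>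
      (mulL : HC r →L[ℂ] HC r →L[ℂ] HC r).le_opNorm f)
    (AddMonoidHomClass.continuous_of_bound (LinearMap.mk ⟨fun f : BA r => (f : HC r),
        fun _ _ => rfl⟩ fun _ _ => rfl : BA r →ₗ[ℂ] HC r) ‖(1 : HC r)‖ fun f => by
      have h := (mulL (show HC r from f)).le_opNorm (1 : HC r)
      rw [mulL_apply, mul_one, mul_comm] at h
      exact h)

theorem toBA_mul (f g : HC r) : toBA (f * g) = toBA f * toBA g := rfl
theorem toBA_one : toBA (1 : HC r) = 1 := rfl

end HC

instance : CompleteSpace (BA r) :=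
  (completeSpace_congr (e := (HC.toBA (r := r)).toEquiv)
    (HC.toBA (r := r)).isUniformEmbedding).1 inferInstance

instance : Nontrivial (BA r) :=
  ⟨⟨0, 1, fun h => zero_ne_one (α := ℂ) (congrArg (fun f : HC r => f 0) h)⟩⟩

namespace HC

/-- Evaluation at a point as an algebra homomorphism. -/
def evalBA (x : UnitAddCircle) : BA r →ₐ[ℂ] ℂ where
  toFun f := toBA.symm f x
  map_one' := rfl
  map_mul' _ _ := rfl
  map_zero' := rfl
  map_add' _ _ := rfl
  commutes' c := by
    rw [Algebra.algebraMap_eq_smul_one]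
    exact mul_one c

theorem continuous_evalBA (x : UnitAddCircle) : Continuous (evalBA x : BA r →ₐ[ℂ] ℂ) :=
  (evalL (r := r) x).continuous.comp toBA.symm.continuous

/-- A number whose powers grow at most like `(1 + n²)^{r/2}` has modulus at most `1`. -/
theorem norm_le_one_of_pow_le {z : ℂ} {C : ℝ} (h : ∀ n : ℕ, ‖z‖ ^ n ≤ C * wt r n) : ‖z‖ ≤ 1 := by
  by_contra hz
  push Not at hz
  have hr0 : 0 < r := by have := hr.out; linarith
  set a := ‖z‖ with ha
  have hwt : ∀ n : ℕ, 1 ≤ n → wt r n ≤ 2 ^ (r / 2) * (n : ℝ) ^ r := by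
    intro n hn
    unfold wt
    have hn' : (1 : ℝ) ≤ n := by exact_mod_cast hn
    have e : (n : ℝ) ^ r = ((n : ℝ) ^ 2) ^ (r / 2) := by
      rw [← Real.rpow_natCast, ← Real.rpow_mul (by positivity)]; congr 1; push_cast; ring
    rw [e, ← Real.mul_rpow (by norm_num) (by positivity)]
    refine Real.rpow_le_rpow (by positivity) ?_ (by positivity)
    push_cast
    nlinarith
  have hlim : Filter.Tendsto (fun n : ℕ => (n : ℝ) ^ r * Real.exp (-Real.log a * n))
      Filter.atTop (𝓝 0) :=
    (tendsto_rpow_mul_exp_neg_mul_atTop_nhds_zero r (Real.log a) (Real.log_pos hz)).comp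
      tendsto_natCast_atTop_atTop
  have hlim2 := hlim.const_mul (|C| * 2 ^ (r / 2))
  rw [mul_zero] at hlim2
  obtain ⟨N, hN⟩ := (hlim2.eventually (gt_mem_nhds one_pos)).exists_forall_of_atTop
  have h1 := hN (max N 1) (le_max_left _ _)
  set n := max N 1 with hn
  have h2 := h n
  have h3 : Real.exp (-Real.log a * n) = (a ^ n)⁻¹ := by
    rw [neg_mul, Real.exp_neg, mul_comm, Real.exp_nat_mul, Real.exp_log (by linarith)]
  have hp : 0 < a ^ n := by positivity
  rw [h3] at h1
  have h4 : |C| * 2 ^ (r / 2) * (n : ℝ) ^ r < a ^ n := by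
    have : |C| * 2 ^ (r / 2) * ((n : ℝ) ^ r * (a ^ n)⁻¹)
      = |C| * 2 ^ (r / 2) * (n : ℝ) ^ r / a ^ n := by ring
    rw [this, div_lt_one hp] at h1
    exact h1
  have h5 : C * wt r n ≤ |C| * (2 ^ (r / 2) * (n : ℝ) ^ r) :=
    mul_le_mul (le_abs_self C) (hwt n (le_max_right _ _)) (wt_pos r _).le (abs_nonneg C)
  linarith

/-- The characters of the Banach algebra `H^r` are the evaluations at the points of the circle. -/
theorem character_eq_eval (χ : WeakDual.characterSpace ℂ (BA r)) :
    ∃ x : UnitAddCircle, ∀ f : HC r, χ (toBA f) = f x := by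
  have hcont : Continuous fun f : HC r => χ (toBA f) :=
    (map_continuous χ).comp toBA.continuous
  let χL : HC r →L[ℂ] ℂ :=
    { toFun := fun f => χ (toBA f)
      map_add' := fun f g => by rw [map_add, map_add]
      map_smul' := fun c f => by rw [map_smul, map_smul]; rfl
      cont := hcont }
  have hone : χ (toBA (1 : HC r)) = 1 := by rw [toBA_one, map_one]
  have hmul : ∀ f g : HC r, χ (toBA (f * g)) = χ (toBA f) * χ (toBA g) := fun f g => by
    rw [toBA_mul, map_mul]
  set e : ℤ → ℂ := fun n => χ (toBA (expMode n : HC r)) with he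
  have hadd : ∀ m n, e (m + n) = e m * e n := fun m n => by
    simp only [he]
    rw [← expMode_mul, hmul]
  have he0 : e 0 = 1 := by simp only [he]; rw [expMode_zero, hone]
  have hpow : ∀ (m : ℤ) (n : ℕ), e (n * m) = e m ^ n := by
    intro m n
    induction n with
    | zero => simp [he0]
    | succ n ih => rw [pow_succ, ← ih, ← hadd]; congr 1; push_cast; ring
  have hbound : ∀ n : ℤ, ‖e n‖ ≤ ‖χL‖ * wt r n := by
    intro n
    have := χL.le_opNorm (expMode n)
    rwa [norm_expMode] at this
  have hz1 : ‖e 1‖ ≤ 1 := by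
    refine norm_le_one_of_pow_le (r := r) (C := ‖χL‖) fun n => ?_
    have := hbound n
    rwa [← mul_one (n : ℤ), hpow, norm_pow, mul_one] at this
  have hz2 : ‖e (-1)‖ ≤ 1 := by
    refine norm_le_one_of_pow_le (r := r) (C := ‖χL‖) fun n => ?_
    have := hbound (n * (-1))
    rw [hpow, norm_pow] at this
    refine this.trans (le_of_eq ?_)
    congr 1
    unfold wt; push_cast; ring_nf
  have hinv : e 1 * e (-1) = 1 := by rw [← hadd, add_neg_cancel, he0]
  have hnorm : ‖e 1‖ = 1 := by
    have h1 : ‖e 1‖ * ‖e (-1)‖ = 1 := by rw [← norm_mul, hinv, norm_one]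
    nlinarith [norm_nonneg (e 1), norm_nonneg (e (-1))]
  obtain ⟨x, hx⟩ : ∃ x : UnitAddCircle, (AddCircle.toCircle x : ℂ) = e 1 := by
    obtain ⟨x, hx⟩ := (AddCircle.homeomorphCircle (T := 1) one_ne_zero).surjective
      ⟨e 1, mem_sphere_zero_iff_norm.2 hnorm⟩
    refine ⟨x, ?_⟩
    have : AddCircle.toCircle x = (⟨e 1, mem_sphere_zero_iff_norm.2 hnorm⟩ : Circle) := by
      rw [← hx, AddCircle.homeomorphCircle_apply]
    rw [this]
  have hex : ∀ n : ℤ, e n = fourier (T := 1) n x := by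
    have hf : ∀ n : ℕ, e n = fourier (T := 1) (n : ℤ) x := by
      intro n
      rw [← mul_one (n : ℤ), hpow, ← hx, mul_one, fourier_apply, natCast_zsmul,
        AddCircle.toCircle_nsmul, Circle.coe_pow]
    intro n
    rcases n.eq_nat_or_neg with ⟨m, rfl | rfl⟩
    · exact hf m
    · have h1 : e m * e (-m) = 1 := by rw [← hadd, add_neg_cancel, he0]
      have h2 : fourier (T := 1) (m : ℤ) x * fourier (T := 1) (-(m : ℤ)) x = 1 := by
        rw [← fourier_add, add_neg_cancel, fourier_zero]
      rw [hf] at h1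
      exact mul_left_cancel₀ (left_ne_zero_of_mul_eq_one h1) (h1.trans h2.symm)
  refine ⟨x, fun f => ?_⟩
  have h1 := (hasSum_expMode f).mapL χL
  have h2 := hasSum_apply f x
  refine h1.unique ?_
  refine h2.congr_fun fun n => ?_
  rw [map_smul, smul_eq_mul, ← hex]
  rfl

/-- The spectrum of a function is contained in its range. -/
theorem mem_spectrum {f : HC r} {z : ℂ} (h : z ∈ spectrum ℂ (toBA f)) : ∃ x, f x = z := by
  obtain ⟨χ, hχ⟩ := WeakDual.CharacterSpace.mem_spectrum_iff_exists.1 h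
  obtain ⟨x, hx⟩ := character_eq_eval χ
  exact ⟨x, by rw [← hx, hχ]⟩

/-- Wiener's lemma in `H^r`: a nowhere vanishing function has an inverse in `H^r`. -/
theorem exists_inv (f : HC r) (hf : ∀ x, f x ≠ 0) : ∃ g : HC r, f * g = 1 := by
  have h : (0 : ℂ) ∉ spectrum ℂ (toBA f) := fun h0 => by
    obtain ⟨x, hx⟩ := mem_spectrum h0
    exact hf x hx
  rw [spectrum.zero_notMem_iff] at h
  obtain ⟨g, hg⟩ := h.exists_right_inv
  exact ⟨toBA.symm g, hg⟩

/-- The powers of a function of modulus less than `1` decay geometrically. -/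
theorem summable_norm_pow (f : HC r) (hf : ∀ x, ‖f x‖ < 1) : Summable fun n => ‖toBA f ^ n‖ := by
  have h1 : spectralRadius ℂ (toBA f) < (1 : NNReal) := by
    refine spectrum.spectralRadius_lt_of_forall_lt _ fun z hz => ?_
    obtain ⟨x, rfl⟩ := mem_spectrum hz
    exact hf x
  obtain ⟨q, hq1, hq2⟩ := ENNReal.lt_iff_exists_nnreal_btwn.1 h1
  have hq2' : (q : ℝ) < 1 := by exact_mod_cast hq2
  have h2 := (spectrum.pow_nnnorm_pow_one_div_tendsto_nhds_spectralRadius (toBA f)).eventually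
    (gt_mem_nhds hq1)
  refine Summable.of_norm_bounded_eventually_nat
    (summable_geometric_of_lt_one q.coe_nonneg hq2') ?_
  filter_upwards [h2, Filter.eventually_ge_atTop 1] with n hn hn1
  rw [norm_norm]
  have hn0 : (n : ℝ) ≠ 0 := by positivity
  have h3 := ENNReal.rpow_le_rpow hn.le (z := n) (by positivity)
  rw [← ENNReal.rpow_mul, one_div_mul_cancel hn0, ENNReal.rpow_one, ENNReal.rpow_natCast] at h3
  have h4 : ‖toBA f ^ n‖₊ ≤ q ^ n := by exact_mod_cast h3
  exact_mod_cast h4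

/-- The logarithm of a function close to `1` is of class `H^r`. -/
theorem exists_log_one_add (v : HC r) (hv : ∀ x, ‖v x‖ < 1) :
    ∃ g : HC r, ∀ x, g x = Complex.log (1 + v x) := by
  have hs : Summable fun n : ℕ => ((-1 : ℂ) ^ (n + 1) / n) • toBA v ^ n := by
    refine Summable.of_norm_bounded (summable_norm_pow v hv) fun n => ?_
    rw [norm_smul]
    refine mul_le_of_le_one_left (norm_nonneg _) ?_
    rw [norm_div, norm_pow, norm_neg, norm_one, one_pow]
    rcases n.eq_zero_or_pos with rfl | hn
    · simp
    · rw [Complex.norm_natCast, div_le_one (by exact_mod_cast hn)]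
      exact_mod_cast hn
  refine ⟨toBA.symm (∑' n : ℕ, ((-1 : ℂ) ^ (n + 1) / n) • toBA v ^ n), fun x => ?_⟩
  have h1 := hs.hasSum.map (evalBA x) (continuous_evalBA x)
  have h2 := Complex.hasSum_taylorSeries_log (hv x)
  refine h1.unique (h2.congr_fun fun n => ?_)
  change evalBA x _ = _
  rw [map_smul, map_pow, smul_eq_mul]
  change _ * v x ^ n = _
  ring

/-- The pointwise exponential on `H^r`, defined through the exponential of the Banach algebra. -/
def expH (f : HC r) : HC r := toBA.symm (NormedSpace.exp (toBA f))

@[simp] theorem expH_apply (f : HC r) (x : UnitAddCircle) : expH f x = Complex.exp (f x) := by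
  let _ : NormedAlgebra ℚ (BA r) := NormedAlgebra.restrictScalars ℚ ℂ (BA r)
  have h := NormedSpace.map_exp (evalBA x) (continuous_evalBA x) (toBA f)
  rw [Complex.exp_eq_exp_ℂ]
  exact h

theorem contDiff_expH : ContDiff ℝ ∞ (expH : HC r → HC r) := by
  have h1 : ContDiff ℂ ∞ (NormedSpace.exp : BA r → BA r) := by
    rw [contDiff_iff_contDiffAt]
    exact fun x => (NormedSpace.exp_analytic x).contDiffAt
  exact (((toBA (r := r)).symm.contDiff.comp h1).comp (toBA (r := r)).contDiff).restrict_scalars ℝ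

/-- A continuous logarithm of a function of class `H^r` is of class `H^r`. -/
theorem exists_of_exp (f : HC r) (g : C(UnitAddCircle, ℂ)) (h : ∀ x, Complex.exp (g x) = f x) :
    ∃ G : HC r, ∀ x, G x = g x := by
  -- approximate the logarithm uniformly by a trigonometric polynomial
  obtain ⟨g₀, hg₀, hd⟩ : ∃ g₀ ∈ Submodule.span ℂ (Set.range (fourier (T := 1))),
      dist g g₀ < 1 / 4 := by
    have hmem : g ∈ closure (Submodule.span ℂ (Set.range (fourier (T := 1))) :
        Set C(UnitAddCircle, ℂ)) := by
      have := span_fourier_closure_eq_top (T := 1)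
      rw [← Submodule.topologicalClosure_coe, this]; trivial
    exact Metric.mem_closure_iff.1 hmem _ (by norm_num)
  have hle : Submodule.span ℂ (Set.range (fourier (T := 1))) ≤ sobolev r := by
    rw [Submodule.span_le]
    rintro _ ⟨n, rfl⟩
    rw [← toC_expMode (r := r)]
    exact (expMode n : HC r).2
  set G₀ : HC r := mk g₀ (hle hg₀) with hG₀
  have hw : ∀ x, ‖g x - G₀ x‖ < 1 / 4 := fun x => by
    rw [← dist_eq_norm]
    exact (ContinuousMap.dist_apply_le_dist x).trans_lt hd
  have hu : ∀ x, (f * expH (-G₀)) x = Complex.exp (g x - G₀ x) := fun x => by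
    rw [mul_apply, expH_apply, neg_apply, ← h, ← Complex.exp_add, sub_eq_add_neg]
  obtain ⟨G₁, hG₁⟩ := exists_log_one_add (f * expH (-G₀) - 1) fun x => by
    rw [sub_apply, hu, one_apply]
    have := Complex.norm_exp_sub_one_le (x := g x - G₀ x) (by linarith [hw x])
    linarith [hw x]
  refine ⟨G₁ + G₀, fun x => ?_⟩
  rw [add_apply, hG₁, sub_apply, one_apply, add_sub_cancel, hu, Complex.log_exp, sub_add_cancel]
  · have := (abs_le.1 (Complex.abs_im_le_norm (g x - G₀ x))).1
    linarith [hw x, Real.pi_gt_three]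
  · have := (abs_le.1 (Complex.abs_im_le_norm (g x - G₀ x))).2
    linarith [hw x, Real.pi_gt_three]

/-- Convergence in `H^r` implies uniform convergence. -/
theorem eventually_norm_sub_lt (f₀ : HC r) {ε : ℝ} (hε : 0 < ε) :
    ∀ᶠ f in 𝓝 f₀, ∀ x, ‖f x - f₀ x‖ < ε := by
  have h1 : ∀ᶠ f in 𝓝 f₀, ‖toCL f - toCL f₀‖ < ε := by
    have : Continuous fun f : HC r => ‖toCL f - toCL f₀‖ := by fun_prop
    exact this.continuousAt.eventually (gt_mem_nhds (by simpa using hε))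
  filter_upwards [h1] with f hf x
  exact ((toCL f - toCL f₀).norm_coe_le_norm x).trans_lt hf

/-- The pointwise logarithm is smooth near the constant function `1` of `H^r`. -/
theorem exists_smooth_log : ∃ L : HC r → HC r, ContDiffAt ℝ ∞ L 1 ∧
    ∀ᶠ u in 𝓝 (1 : HC r), ∀ x, L u x = Complex.log (u x) := by
  have hd : HasStrictFDerivAt (NormedSpace.exp : BA r → BA r)
      ((ContinuousLinearEquiv.refl ℂ (BA r) : BA r ≃L[ℂ] BA r) : BA r →L[ℂ] BA r) 0 :=
    hasStrictFDerivAt_exp_zero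
  have hc : ContDiffAt ℂ ∞ (NormedSpace.exp : BA r → BA r) 0 :=
    (NormedSpace.exp_analytic 0).contDiffAt
  have hn : (∞ : WithTop ℕ∞) ≠ 0 := by simp
  set l := hc.localInverse hd.hasFDerivAt hn with hl
  have hl1 : ContDiffAt ℂ ∞ l 1 := by
    have := hc.to_localInverse hd.hasFDerivAt hn
    rwa [NormedSpace.exp_zero] at this
  have hl0 : l 1 = 0 := by
    have := hc.localInverse_apply_image hd.hasFDerivAt hn
    rwa [NormedSpace.exp_zero] at this
  have hr1 : ∀ᶠ y in 𝓝 (1 : BA r), NormedSpace.exp (l y) = y := by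
    have := (hc.hasStrictFDerivAt' hd.hasFDerivAt hn).eventually_right_inverse
    rw [NormedSpace.exp_zero] at this
    exact this
  have hL : ContDiffAt ℂ ∞ (fun u : HC r => toBA.symm (l (toBA u))) 1 := by
    refine (toBA (r := r)).symm.contDiff.contDiffAt.comp (1 : HC r) ?_
    refine ContDiffAt.comp (1 : HC r) ?_ (toBA (r := r)).contDiff.contDiffAt
    exact hl1
  refine ⟨fun u => toBA.symm (l (toBA u)), hL.restrict_scalars ℝ, ?_⟩
  have h1 : ∀ᶠ u in 𝓝 (1 : HC r), NormedSpace.exp (l (toBA u)) = toBA u :=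
    (toBA (r := r)).continuous.continuousAt.eventually hr1
  have h2 : ∀ᶠ u in 𝓝 (1 : HC r), ∀ x, ‖toBA.symm (l (toBA u)) x‖ < 1 := by
    have h3 := eventually_norm_sub_lt (r := r) (toBA.symm (l (toBA 1))) one_pos
    have h4 := hL.continuousAt.eventually h3
    filter_upwards [h4] with u hu x
    have := hu x
    rwa [toBA_one, hl0, map_zero, zero_apply, sub_zero] at this
  filter_upwards [h1, h2] with u hu1 hu2 x
  have h5 : expH (toBA.symm (l (toBA u))) = u := by
    unfold expH
    rw [ContinuousLinearEquiv.apply_symm_apply, hu1, ContinuousLinearEquiv.symm_apply_apply]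
  have h6 := congrArg (fun k : HC r => k x) h5
  simp only [expH_apply] at h6
  rw [← h6, Complex.log_exp]
  · have := (abs_le.1 (Complex.abs_im_le_norm (toBA.symm (l (toBA u)) x))).1
    linarith [hu2 x, Real.pi_gt_three]
  · have := (abs_le.1 (Complex.abs_im_le_norm (toBA.symm (l (toBA u)) x))).2
    linarith [hu2 x, Real.pi_gt_three]

end HC
end

/-! ### Conjugation, real parts, differentiation and integration -/

theorem fourierCoeff_conj (f : UnitAddCircle → ℂ) (n : ℤ) :
    fourierCoeff (fun x => starRingEnd ℂ (f x)) n = starRingEnd ℂ (fourierCoeff f (-n)) := by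
  unfold fourierCoeff
  rw [← integral_conj]
  congr 1; funext t
  rw [smul_eq_mul, smul_eq_mul, map_mul, ← fourier_neg, neg_neg]

namespace HC
variable {r : ℝ}

theorem conj_mem (f : HC r) :
    (⟨fun x => starRingEnd ℂ (f x), Complex.continuous_conj.comp f.continuous_coe⟩ :
      C(UnitAddCircle, ℂ)) ∈ sobolev r := by
  rw [mem_sobolev_iff]
  refine ((summable_sq f).comp_injective neg_injective).congr fun n => ?_
  change (wt r (-n) * ‖fourierCoeff (⇑f) (-n)‖) ^ 2 =
    (wt r n * ‖fourierCoeff (fun x => starRingEnd ℂ (f x)) n‖) ^ 2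
  rw [fourierCoeff_conj, RCLike.norm_conj]
  simp [wt]

theorem norm_conj (f : HC r) : ‖mk _ (conj_mem f)‖ = ‖f‖ := by
  refine (sq_eq_sq₀ (norm_nonneg _) (norm_nonneg _)).1 ?_
  rw [norm_sq_eq, norm_sq_eq,
    ← (Equiv.neg ℤ).tsum_eq (fun n => (wt r n * ‖fourierCoeff (⇑f) n‖) ^ 2)]
  refine tsum_congr fun n => ?_
  change (wt r n * ‖fourierCoeff (fun x => starRingEnd ℂ (f x)) n‖) ^ 2 =
    (wt r (-n) * ‖fourierCoeff (⇑f) (-n)‖) ^ 2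
  rw [fourierCoeff_conj, RCLike.norm_conj]
  simp [wt]

/-- Complex conjugation on `H^r`. -/
def conjH : HC r →L[ℝ] HC r :=
  LinearMap.mkContinuous
    { toFun := fun f => mk _ (conj_mem f)
      map_add' := fun f g => by ext x; simp
      map_smul' := fun c f => by ext x; simp } 1 fun f => by
    rw [one_mul]; exact (norm_conj f).le

@[simp] theorem conjH_apply (f : HC r) (x : UnitAddCircle) :
    conjH f x = starRingEnd ℂ (f x) := rfl

theorem half_add_conj_apply (f : HC r) (x : UnitAddCircle) :
    ((2⁻¹ : ℝ) • (f + conjH f)) x = ((f x).re : ℂ) := by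
  rw [real_smul_apply, add_apply, conjH_apply, Complex.add_conj]
  push_cast; ring

theorem re_mem (f : HC r) :
    (⟨fun x => (f x).re, Complex.continuous_re.comp f.continuous_coe⟩ :
      C(UnitAddCircle, ℝ)) ∈ sobolevR r := by
  change complexify _ ∈ sobolev r
  have e : complexify ⟨fun x => (f x).re, Complex.continuous_re.comp f.continuous_coe⟩ =
      toC ((2⁻¹ : ℝ) • (f + conjH f)) := by
    ext x
    rw [toC_apply, half_add_conj_apply]; rfl
  rw [e]
  exact ((2⁻¹ : ℝ) • (f + conjH f)).2

/-- The real part, as a map `H^r(S¹; ℂ) → H^r(S¹; ℝ)`. -/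
def reH : HC r →L[ℝ] HR r :=
  LinearMap.mkContinuous
    { toFun := fun f => HR.mk _ (re_mem f)
      map_add' := fun f g => by ext x; simp
      map_smul' := fun c f => by ext x; simp } 1 fun f => by
    rw [one_mul, ← HR.norm_toHC]
    have e : HR.toHC (HR.mk _ (re_mem f)) = (2⁻¹ : ℝ) • (f + conjH f) := by
      ext x; rw [half_add_conj_apply]; rfl
    change ‖HR.toHC (HR.mk _ (re_mem f))‖ ≤ _
    rw [e, norm_smul]
    have h1 := norm_add_le f (conjH f)
    have h2 : ‖conjH f‖ = ‖f‖ := norm_conj f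
    rw [Real.norm_of_nonneg (by norm_num)]
    linarith

@[simp] theorem reH_apply (f : HC r) (x : UnitAddCircle) : reH f x = (f x).re := rfl

/-- The imaginary part, as a map `H^r(S¹; ℂ) → H^r(S¹; ℝ)`. -/
def imH : HC r →L[ℝ] HR r :=
  reH.comp (((-Complex.I) • ContinuousLinearMap.id ℂ (HC r)).restrictScalars ℝ)

@[simp] theorem imH_apply (f : HC r) (x : UnitAddCircle) : imH f x = (f x).im := by
  change ((-Complex.I) * f x).re = _
  simp

end HC

namespace HR
variable {r : ℝ}

/-- The inclusion `H^r(S¹; ℝ) ⊂ H^r(S¹; ℂ)` as a bounded operator. -/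
def toHCL : HR r →L[ℝ] HC r := toHC.mkContinuous 1 fun f => by rw [one_mul, norm_toHC]

@[simp] theorem toHCL_apply (f : HR r) (x : UnitAddCircle) : toHCL f x = (f x : ℂ) := rfl

end HR

section derivative
variable (s : ℝ) [hs : Fact (5 / 2 < s)]

theorem wt_eq (n : ℤ) : wt s n = wt (s - 1) n * Real.sqrt (1 + (n : ℝ) ^ 2) := by
  unfold wt
  rw [Real.sqrt_eq_rpow, ← Real.rpow_add (by positivity)]
  congr 1; ring

/-- Differentiation is the Fourier multiplier with symbol `2πin`. -/
theorem exists_deriv : ∃ D : HC s →L[ℂ] HC (s - 1), ∀ f n,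
    fourierCoeff (⇑(D f)) n = (2 * Real.pi * Complex.I * n) * fourierCoeff (⇑f) n := by
  refine HC.exists_multiplier (fun n : ℤ => 2 * Real.pi * Complex.I * n) (2 * Real.pi) fun n => ?_
  have h1 : ‖(2 * Real.pi * Complex.I * n : ℂ)‖ = 2 * Real.pi * |(n : ℝ)| := by
    simp [abs_of_pos Real.pi_pos]
  have h2 : |(n : ℝ)| ≤ Real.sqrt (1 + (n : ℝ) ^ 2) := Real.abs_le_sqrt (by linarith)
  rw [h1, wt_eq s]
  have h3 := wt_pos (s - 1) n
  have := mul_le_mul_of_nonneg_left h2 h3.le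
  nlinarith [Real.pi_pos]

/-- The multiplier with symbol `(2πin)⁻¹` gains one derivative; the junk value `0⁻¹ = 0` makes it
annihilate the constants. -/
theorem exists_primitive : ∃ P : HC (s - 1) →L[ℂ] HC s, ∀ f n,
    fourierCoeff (⇑(P f)) n = (2 * Real.pi * Complex.I * n)⁻¹ * fourierCoeff (⇑f) n := by
  refine HC.exists_multiplier (fun n : ℤ => (2 * Real.pi * Complex.I * n)⁻¹) 1 fun n => ?_
  rcases eq_or_ne n 0 with rfl | hn
  · simpa using (wt_pos (s - 1) 0).le
  have h1 : ‖((2 * Real.pi * Complex.I * n)⁻¹ : ℂ)‖ = (2 * Real.pi * |(n : ℝ)|)⁻¹ := by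
    simp [abs_of_pos Real.pi_pos]
  have hn1 : (1 : ℝ) ≤ |(n : ℝ)| := by exact_mod_cast Int.one_le_abs hn
  have h2 : Real.sqrt (1 + (n : ℝ) ^ 2) ≤ 2 * Real.pi * |(n : ℝ)| := by
    rw [Real.sqrt_le_left (by positivity), ← sq_abs (n : ℝ)]
    nlinarith [Real.pi_gt_three, sq_nonneg |(n : ℝ)|,
      mul_self_nonneg (Real.pi * |(n : ℝ)| - 3 * |(n : ℝ)|)]
  rw [h1, wt_eq s, one_mul, mul_assoc]
  refine mul_le_of_le_one_right (wt_pos _ n).le ?_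
  rw [← div_eq_mul_inv, div_le_one (by positivity)]
  exact h2

/-- The derivative `H^s → H^{s-1}` of complex functions. -/
def derivC : HC s →L[ℂ] HC (s - 1) := (exists_deriv s).choose

/-- The primitive `H^{s-1} → H^s` with mean zero of the mean-free part of a function. -/
def primC : HC (s - 1) →L[ℂ] HC s := (exists_primitive s).choose

variable {s}

theorem fourierCoeff_derivC (f : HC s) (n : ℤ) :
    fourierCoeff (⇑(derivC s f)) n = (2 * Real.pi * Complex.I * n) * fourierCoeff (⇑f) n :=
  (exists_deriv s).choose_spec f n

theorem fourierCoeff_primC (f : HC (s - 1)) (n : ℤ) :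
    fourierCoeff (⇑(primC s f)) n = (2 * Real.pi * Complex.I * n)⁻¹ * fourierCoeff (⇑f) n :=
  (exists_primitive s).choose_spec f n

theorem derivC_apply (f : HC s) (x : UnitAddCircle) : derivC s f x = HC.dseries f x := by
  rw [← (HC.hasSum_apply (derivC s f) x).tsum_eq]
  unfold HC.dseries
  refine tsum_congr fun n => ?_
  rw [fourierCoeff_derivC]; ring

theorem derivC_primC (f : HC (s - 1)) :
    derivC s (primC s f) = f - fourierCoeff (⇑f) 0 • (1 : HC (s - 1)) := by
  apply HC.ext_coeff
  intro n
  have e : fourierCoeff (⇑(f - fourierCoeff (⇑f) 0 • (1 : HC (s - 1)))) n =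
      fourierCoeff (⇑f) n - fourierCoeff (⇑f) 0 * if n = 0 then 1 else 0 := by
    rw [← HC.expMode_zero, ← HC.fourierCoeff_expMode (r := s - 1) 0 n]
    change coeffCL n (HC.toC (f - _)) = coeffCL n (HC.toC f) - _ * coeffCL n (HC.toC _)
    rw [map_sub, map_smul, map_sub, map_smul, smul_eq_mul]
  rw [e, fourierCoeff_derivC, fourierCoeff_primC]
  rcases eq_or_ne n 0 with rfl | hn
  · simp
  · have hn' : (n : ℂ) ≠ 0 := by exact_mod_cast hn
    have hpi : (Real.pi : ℂ) ≠ 0 := by exact_mod_cast Real.pi_ne_zero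
    rw [if_neg hn, mul_zero, sub_zero, mul_inv_cancel_left₀]
    simp [hn', hpi]

/-- The derivative `H^s(S¹; ℝ) → H^{s-1}(S¹; ℝ)`. -/
def derivR : HR s →L[ℝ] HR (s - 1) :=
  HC.reH.comp (((derivC s).restrictScalars ℝ).comp HR.toHCL)

theorem derivR_apply (h : HR s) (x : UnitAddCircle) : derivR h x = dx h x := by
  rw [HR.dx_eq]
  change (derivC s (HR.toHC h) x).re = _
  rw [derivC_apply]

/-- The primitive vanishing at `0` of the mean-free part of a function. -/
def primR : HR (s - 1) →L[ℝ] H0R s :=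
  ((ContinuousLinearMap.id ℝ (HR s) - (HR.evalL (r := s) 0).smulRight (HR.const 1)).comp
    (HC.reH.comp (((primC s).restrictScalars ℝ).comp HR.toHCL))).codRestrict (H0R s) fun v => by
    set u := HC.reH (primC s (HR.toHCL v)) with hu
    change (u - u 0 • (HR.const 1 : HR s)) 0 = 0
    simp

theorem integral_ofReal_coe (v : UnitAddCircle → ℝ) :
    fourierCoeff (fun x => (v x : ℂ)) 0 = ((∫ x, v x : ℝ) : ℂ) := by
  unfold fourierCoeff
  rw [AddCircle.integral_haarAddCircle]
  simp only [neg_zero, fourier_zero, one_smul, inv_one]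
  exact integral_complex_ofReal

theorem dx_const (c : ℝ) (x : UnitAddCircle) : dx (⇑(HR.const c : HR s)) x = 0 := by
  unfold dx; simp

theorem dx_reH (g : HC s) (x : UnitAddCircle) : dx (⇑(HC.reH g)) x = (HC.dseries g x).re := by
  have h := HC.hasDerivAt_apply g x 0
  have h2 := (Complex.reCLM.hasFDerivAt.comp_hasDerivAt (0 : ℝ) h)
  have h3 : HasDerivAt (fun t : ℝ => HC.reH g (x + (t : UnitAddCircle))) (HC.dseries g x).re 0 := by
    simpa [Function.comp_def] using! h2
  exact h3.deriv

theorem dx_primR (v : HR (s - 1)) (x : UnitAddCircle) :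
    dx (⇑(primR v : HR s)) x = v x - ∫ y, v y := by
  have e : (primR v : HR s) = HC.reH (primC s (HR.toHCL v)) -
      HR.const ((HC.reH (primC s (HR.toHCL v))) 0) := by
    set u := HC.reH (primC s (HR.toHCL v)) with hu
    ext y
    change (u - u 0 • (HR.const 1 : HR s)) y = (u - HR.const (u 0) : HR s) y
    simp
  rw [e, HR.dx_sub, dx_const, sub_zero, dx_reH, ← derivC_apply, derivC_primC]
  have e2 : fourierCoeff (⇑(HR.toHCL v)) 0 = ((∫ x, v x : ℝ) : ℂ) := integral_ofReal_coe v
  rw [e2]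
  simp

theorem HR.hasDerivAt_coe (h : HR s) (t : ℝ) :
    HasDerivAt (fun u : ℝ => h (u : UnitAddCircle)) (dx h (t : UnitAddCircle)) t := by
  have h1 := HR.hasDerivAt_apply h (t : UnitAddCircle)
  rw [← HR.dx_eq] at h1
  have h3 : HasDerivAt (fun u : ℝ => h ((t : UnitAddCircle) + (u : UnitAddCircle)))
      (dx h (t : UnitAddCircle)) (t - t) := by rw [sub_self]; exact h1
  refine (h3.comp_sub_const t t).congr_of_eventuallyEq (Filter.Eventually.of_forall fun u => ?_)
  change h _ = h _
  rw [← AddCircle.coe_add]; congr 2; ring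

/-- A function vanishing at `0` is determined by its derivative. -/
theorem H0R.ext_dx {h k : H0R s} (e : ∀ x, dx (h : HR s) x = dx (k : HR s) x) : h = k := by
  apply Subtype.ext
  ext x
  obtain ⟨t, rfl⟩ := QuotientAddGroup.mk_surjective x
  have hd : ∀ t : ℝ, HasDerivAt
      (fun u : ℝ => ((h : HR s) - (k : HR s)) (u : UnitAddCircle)) 0 t := fun t => by
    have := HR.hasDerivAt_coe ((h : HR s) - (k : HR s)) t
    rwa [HR.dx_sub, e, sub_self] at this
  have hc := is_const_of_deriv_eq_zero (fun t => (hd t).differentiableAt)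
    (fun t => (hd t).deriv) t 0
  have h0 : ((h : HR s) - (k : HR s)) ((0 : ℝ) : UnitAddCircle) = 0 := by
    change ((h : HR s) - (k : HR s)) 0 = 0
    rw [HR.sub_apply]
    have h1 : (h : HR s) 0 = 0 := h.2
    have h2 : (k : HR s) 0 = 0 := k.2
    rw [h1, h2, sub_self]
  rw [h0, HR.sub_apply] at hc
  exact sub_eq_zero.1 hc

/-- The derivative `φ_x` as a function of class `H^{s-1}`. -/
def phiXH (φ : Diff0 s) : HR (s - 1) := HR.const 1 + derivR (φ.1 : HR s)

@[simp] theorem phiXH_apply (φ : Diff0 s) (x : UnitAddCircle) : phiXH φ x = phiX φ x := by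
  unfold phiXH
  rw [HR.add_apply, HR.const_apply, derivR_apply]; rfl

theorem phiX_pos (φ : Diff0 s) (x : UnitAddCircle) : 0 < phiX φ x := by
  have := φ.2 x
  unfold phiX
  linarith

theorem Diff0.ext_phiX {φ ψ : Diff0 s} (h : ∀ x, phiX φ x = phiX ψ x) : φ = ψ :=
  Subtype.ext (H0R.ext_dx fun x => add_left_cancel (h x))

/-- A diffeomorphism with given positive derivative of mean `1`. -/
theorem mem_Diff0_primR (v : HR (s - 1)) (hv : ∀ x, 0 < v x) (hi : ∫ x, v x = 1) :
    primR v ∈ Diff0 s := by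
  intro x
  rw [dx_primR, hi]
  linarith [hv x]

end derivative

/-! ### Logarithms of positive functions and phases of circle-valued maps -/

section phase
variable {r : ℝ} [hr : Fact (1 / 2 < r)]

theorem exists_logR (v : HR r) (hv : ∀ x, 0 < v x) :
    ∃ g : HC r, ∀ x, g x = (Real.log (v x) : ℂ) :=
  HC.exists_of_exp (HR.toHC v)
    ⟨fun x => (Real.log (v x) : ℂ), Complex.continuous_ofReal.comp
      (v.continuous_coe.log fun x => (hv x).ne')⟩ fun x => by
    change Complex.exp (Real.log (v x) : ℂ) = _
    rw [← Complex.ofReal_exp, Real.exp_log (hv x), HR.toHC_apply]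

open Classical in
/-- The logarithm of a positive function, and `0` if the function is not positive. -/
def logR (v : HR r) : HC r := if hv : ∀ x, 0 < v x then (exists_logR v hv).choose else 0

theorem logR_apply {v : HR r} (hv : ∀ x, 0 < v x) (x : UnitAddCircle) :
    logR v x = (Real.log (v x) : ℂ) := by
  unfold logR
  rw [dif_pos hv]
  exact (exists_logR v hv).choose_spec x

/-- The logarithm is smooth on the positive functions: near `v₀` it is
`v ↦ log v₀ + L (v / v₀)`, with `L` the smooth logarithm near the constant function `1`. -/
theorem contDiffAt_logR {v₀ : HR r} (hv₀ : ∀ x, 0 < v₀ x) : ContDiffAt ℝ ∞ logR v₀ := by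
  obtain ⟨L, hL, hLa⟩ := HC.exists_smooth_log (r := r)
  obtain ⟨w, hw⟩ := HC.exists_inv (HR.toHCL v₀) fun x => by
    rw [HR.toHCL_apply]; exact_mod_cast (hv₀ x).ne'
  have hw1 : ∀ x, w x = ((v₀ x : ℝ) : ℂ)⁻¹ := fun x => by
    have := congrArg (fun k : HC r => k x) hw
    exact eq_inv_of_mul_eq_one_right this
  have hlin : ContDiff ℝ ∞ fun v : HR r => w * HR.toHCL v := by
    exact ((HC.mulL w).restrictScalars ℝ).contDiff.comp HR.toHCL.contDiff
  have h1 : w * HR.toHCL v₀ = 1 := by rw [mul_comm]; exact hw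
  have hcomp : ContDiffAt ℝ ∞ (fun v : HR r => logR v₀ + L (w * HR.toHCL v)) v₀ := by
    refine contDiffAt_const.add ?_
    refine ContDiffAt.comp v₀ ?_ hlin.contDiffAt
    rw [h1]; exact hL
  refine hcomp.congr_of_eventuallyEq ?_
  have h2 : ∀ᶠ v in 𝓝 v₀, ∀ x, L (w * HR.toHCL v) x = Complex.log ((w * HR.toHCL v) x) := by
    have : Filter.Tendsto (fun v : HR r => w * HR.toHCL v) (𝓝 v₀) (𝓝 1) := by
      rw [← h1]; exact hlin.continuous.tendsto v₀
    exact this.eventually hLa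
  obtain ⟨x₀, -, hx₀⟩ := isCompact_univ.exists_isMinOn Set.univ_nonempty
    v₀.continuous_coe.continuousOn
  have h3 : ∀ᶠ v in 𝓝 v₀, ∀ x, ‖HR.toHCL v x - HR.toHCL v₀ x‖ < v₀ x₀ :=
    HR.toHCL.continuous.continuousAt.eventually (HC.eventually_norm_sub_lt _ (hv₀ x₀))
  filter_upwards [h2, h3] with v hv2 hv3
  have hv : ∀ x, 0 < v x := fun x => by
    have h4 := hv3 x
    rw [HR.toHCL_apply, HR.toHCL_apply, ← Complex.ofReal_sub, Complex.norm_real,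
      Real.norm_eq_abs] at h4
    have h5 : v₀ x₀ ≤ v₀ x := hx₀ (Set.mem_univ x)
    linarith [(abs_lt.1 h4).1]
  ext x
  rw [logR_apply hv, HC.add_apply, logR_apply hv₀, hv2, HC.mul_apply, hw1, HR.toHCL_apply,
    ← Complex.ofReal_inv, ← Complex.ofReal_mul, ← Complex.ofReal_log
      (mul_pos (inv_pos.2 (hv₀ x)) (hv x)).le, ← Complex.ofReal_add,
    Real.log_mul (inv_pos.2 (hv₀ x)).ne' (hv x).ne', Real.log_inv, add_neg_cancel_left]

theorem phase_add (θ η : Circ) : phase (θ + η) = phase θ * phase η := by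
  unfold phase
  rw [AddCircle.toCircle_add, Circle.coe_mul]

theorem norm_phase (θ : Circ) : ‖phase θ‖ = 1 := Circle.norm_coe _

theorem phase_injective : Function.Injective phase := by
  intro θ η h
  exact AddCircle.injective_toCircle (by have := Real.pi_pos; positivity) (Subtype.ext h)

/-- The circle `S¹_{4π}` is homeomorphic to the unit circle through the phase. -/
def phaseHomeo : Circ ≃ₜ Circle :=
  AddCircle.homeomorphCircle (T := 4 * Real.pi) (by have := Real.pi_pos; positivity)

theorem coe_phaseHomeo (θ : Circ) : (phaseHomeo θ : ℂ) = phase θ := by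
  unfold phaseHomeo
  rw [AddCircle.homeomorphCircle_apply]; rfl

theorem exists_phase_eq {z : ℂ} (hz : ‖z‖ = 1) : ∃ θ : Circ, phase θ = z := by
  obtain ⟨θ, hθ⟩ := phaseHomeo.surjective ⟨z, mem_sphere_zero_iff_norm.2 hz⟩
  exact ⟨θ, by rw [← coe_phaseHomeo, hθ]⟩

theorem exists_phaseH (α : HCirc r) : ∃ g : HC r, ∀ x, g x = phase (α x) := by
  obtain ⟨n, h, hα⟩ := α.2
  refine ⟨HC.expMode n * HC.expH ((Complex.I / 2) • HR.toHCL h), fun x => ?_⟩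
  obtain ⟨t, rfl⟩ := QuotientAddGroup.mk_surjective x
  have e : α (t : UnitAddCircle) = ((4 * Real.pi * n * t + h (t : UnitAddCircle) : ℝ) : Circ) :=
    hα t
  change (HC.expMode n * HC.expH ((Complex.I / 2) • HR.toHCL h) : HC r) (t : UnitAddCircle)
    = phase (α (t : UnitAddCircle))
  rw [e, phase_coe, HC.mul_apply, HC.expH_apply, HC.expMode_apply, HC.smul_apply, HR.toHCL_apply,
    fourier_coe_apply, ← Complex.exp_add]
  congr 1
  push_cast
  ring

/-- The phase `e^{iα/2}` of a map `α : S¹ → S¹_{4π}` of class `H^r`. -/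
def phaseH (α : HCirc r) : HC r := (exists_phaseH α).choose

@[simp] theorem phaseH_apply (α : HCirc r) (x : UnitAddCircle) : phaseH α x = phase (α x) :=
  (exists_phaseH α).choose_spec x

theorem phaseH_add (α β : HCirc r) : phaseH (α + β) = phaseH α * phaseH β := by
  ext x; simp [phase_add]

theorem phaseH_proj (h : HR r) :
    phaseH (HCirc.proj h) = HC.expH ((Complex.I / 2) • HR.toHCL h) := by
  ext x
  rw [phaseH_apply, HCirc.proj_apply, phase_coe, HC.expH_apply, HC.smul_apply, HR.toHCL_apply]
  congr 1; ring

/-- A nowhere vanishing function `f` of class `H^r` has a phase of class `H^r`. The continuous phase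
lifts to the line as `4πnt + k(t)` with `k` periodic, and then `log |f| + ik/2` is a continuous
logarithm of `f e^{-2πint}`, hence of class `H^r`. -/
theorem exists_phase_lift (f : HC r) (hf : ∀ x, f x ≠ 0) :
    ∃ α : HCirc r, ∀ x, f x = (‖f x‖ : ℂ) * phase (α x) := by
  have hπ := Real.pi_pos
  have hnc : Continuous fun x => f x / (‖f x‖ : ℂ) :=
    f.continuous_coe.div (Complex.continuous_ofReal.comp f.continuous_coe.norm)
      fun x => by exact_mod_cast norm_ne_zero_iff.2 (hf x)
  have hn1 : ∀ x, f x / (‖f x‖ : ℂ) ∈ Submonoid.unitSphere ℂ := fun x => by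
    refine mem_sphere_zero_iff_norm.2 ?_
    rw [norm_div, Complex.norm_real, norm_norm, div_self (norm_ne_zero_iff.2 (hf x))]
  let γ : C(UnitAddCircle, Circle) := ⟨fun x => ⟨_, hn1 x⟩, hnc.subtype_mk _⟩
  let a : C(UnitAddCircle, Circ) := ⟨fun x => phaseHomeo.symm (γ x),
    phaseHomeo.symm.continuous.comp γ.continuous⟩
  have ha : ∀ x, f x = (‖f x‖ : ℂ) * phase (a x) := fun x => by
    have e : phase (a x) = f x / (‖f x‖ : ℂ) := by
      rw [← coe_phaseHomeo]
      change ((phaseHomeo (phaseHomeo.symm (γ x)) : Circle) : ℂ) = _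
      rw [Homeomorph.apply_symm_apply]
      rfl
    rw [e, mul_div_cancel₀]
    exact_mod_cast norm_ne_zero_iff.2 (hf x)
  -- lift `a` to a function on the line, periodic up to a multiple of `4π`
  obtain ⟨g₀, hg₀⟩ := QuotientAddGroup.mk_surjective (a ((0 : ℝ) : UnitAddCircle))
  obtain ⟨g, ⟨-, hg⟩, -⟩ := (AddCircle.isCoveringMap_coe
    (4 * Real.pi)).existsUnique_continuousMap_lifts
    (a.comp ⟨fun t : ℝ => (t : UnitAddCircle), AddCircle.continuous_mk' _⟩) 0 g₀ hg₀
  have hg' : ∀ t : ℝ, ((g t : ℝ) : Circ) = a (t : UnitAddCircle) := fun t => congrFun hg t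
  have hint : ∀ t : ℝ, ∃ n : ℤ, (g (t + 1) - g t) / (4 * Real.pi) = n := by
    intro t
    have e1 : ((g (t + 1) : ℝ) : Circ) = ((g t : ℝ) : Circ) := by
      rw [hg', hg', AddCircle.coe_add_period]
    rw [← sub_eq_zero, ← AddCircle.coe_sub, AddCircle.coe_eq_zero_iff] at e1
    obtain ⟨n, hn⟩ := e1
    refine ⟨n, ?_⟩
    rw [← hn]
    simp only [zsmul_eq_mul]
    field_simp
  choose N hN using hint
  have hNc : Continuous N := by
    have h1 : (fun t : ℝ => (N t : ℝ)) = fun t : ℝ => (g (t + 1) - g t) / (4 * Real.pi) :=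
      funext fun t => (hN t).symm
    rw [Int.isClosedEmbedding_coe_real.isInducing.continuous_iff]
    change Continuous fun t : ℝ => (N t : ℝ)
    rw [h1]; fun_prop
  have hNconst : ∀ t, N t = N 0 := fun t => PreconnectedSpace.constant inferInstance hNc
  set n := N 0 with hn
  have hper : ∀ t, g (t + 1) = g t + 4 * Real.pi * n := by
    intro t
    have := hN t
    rw [hNconst, div_eq_iff (by positivity)] at this
    linarith
  have hP : Function.Periodic (fun t => g t - 4 * Real.pi * n * t) 1 := fun t => by
    simp only [hper]; ring
  let k : C(UnitAddCircle, ℝ) := ⟨hP.lift, continuous_coinduced_dom.2 (by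
    change Continuous fun t => g t - 4 * Real.pi * n * t
    fun_prop)⟩
  have hk : ∀ t : ℝ, k (t : UnitAddCircle) = g t - 4 * Real.pi * n * t := fun t => rfl
  obtain ⟨G, hG⟩ := HC.exists_of_exp (f * HC.expMode (-n))
    ⟨fun x => (Real.log ‖f x‖ : ℂ) + Complex.I / 2 * (k x : ℂ), by
      refine (Complex.continuous_ofReal.comp
        (f.continuous_coe.norm.log fun x => norm_ne_zero_iff.2 (hf x))).add ?_
      exact continuous_const.mul (Complex.continuous_ofReal.comp k.continuous)⟩ fun x => by
    obtain ⟨t, rfl⟩ := QuotientAddGroup.mk_surjective x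
    change Complex.exp ((Real.log ‖f (t : UnitAddCircle)‖ : ℂ)
      + Complex.I / 2 * (k (t : UnitAddCircle) : ℂ)) =
      f (t : UnitAddCircle) * (HC.expMode (-n) : HC r) (t : UnitAddCircle)
    conv_rhs => rw [ha]
    rw [← hg', phase_coe, HC.expMode_apply, fourier_coe_apply, mul_assoc, ← Complex.exp_add,
      Complex.exp_add, ← Complex.ofReal_exp, Real.exp_log (norm_pos_iff.2 (hf _)), hk]
    congr 2
    push_cast
    ring
  have hkG : ∀ x, k x = (2 : ℝ) * HC.imH G x := by
    intro x
    rw [HC.imH_apply, hG]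
    change k x = 2 * ((Real.log ‖f x‖ : ℂ) + Complex.I / 2 * (k x : ℂ)).im
    simp
  refine ⟨⟨a, n, (2 : ℝ) • HC.imH G, fun t => ?_⟩, ha⟩
  rw [← hg', HR.smul_apply, ← hkG, hk]
  congr 1; ring

end phase

/-! ### The sphere -/

section manifold
variable {E H M : Type} [NormedAddCommGroup E] [NormedSpace ℝ E] [TopologicalSpace H]
  {I : ModelWithCorners ℝ E H} [TopologicalSpace M] [ChartedSpace H M]
  {r : ℝ} [Fact (1 / 2 < r)]

namespace Sph

theorem chart_mem_maximalAtlas {ε : ℝ} (hε : ε ^ 2 = 1) :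
    (chart ε hε : OpenPartialHomeomorph (Sph r) (onePerp r)) ∈
      IsManifold.maximalAtlas 𝓘(ℝ, onePerp r) ∞ (Sph r) := by
  apply IsManifold.subset_maximalAtlas
  rcases sq_eq_sq_iff_eq_or_eq_neg.1 (hε.trans (one_pow 2).symm) with rfl | rfl
  · left; rfl
  · right; rfl

theorem exists_mem_chart_source (f : Sph r) :
    ∃ (ε : ℝ) (hε : ε ^ 2 = 1), f ∈ (chart ε hε : OpenPartialHomeomorph (Sph r) _).source := by
  by_cases h : 1 + 1 * ht (incl f) = 0
  · refine ⟨-1, by norm_num, ?_⟩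
    change 1 + -1 * ht (incl f) ≠ 0
    intro h2; linarith
  · exact ⟨1, by norm_num, h⟩

theorem contMDiff_incl : ContMDiff 𝓘(ℝ, onePerp r) 𝓘(ℝ, HC r) ∞ (incl : Sph r → HC r) := by
  intro f
  obtain ⟨ε, hε, hf⟩ := exists_mem_chart_source f
  have h1 := contMDiffAt_of_mem_maximalAtlas (chart_mem_maximalAtlas hε) hf
  have h2 : ContMDiffAt 𝓘(ℝ, onePerp r) 𝓘(ℝ, HC r) ∞
      (fun g : Sph r => stereoInv ε (chart ε hε g)) f :=
    (contDiff_stereoInv ε).contMDiff.contMDiffAt.comp f h1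
  refine h2.congr_of_eventuallyEq ?_
  filter_upwards [(chart ε hε).open_source.mem_nhds hf] with g hg
  exact (stereoInv_stereo hε g hg).symm

/-- A map into the sphere is smooth if it is smooth as a map into `H^r`. -/
theorem contMDiffAt_of_incl {F : M → Sph r} {x : M}
    (h : ContMDiffAt I 𝓘(ℝ, HC r) ∞ (fun y => incl (F y)) x) :
    ContMDiffAt I 𝓘(ℝ, onePerp r) ∞ F x := by
  obtain ⟨ε, hε, hf⟩ := exists_mem_chart_source (F x)
  rw [ContMDiffAt, contMDiffWithinAt_iff_target_of_mem_maximalAtlas (chart_mem_maximalAtlas hε) hf]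
  refine ⟨?_, ?_⟩
  · exact (Topology.IsInducing.subtypeVal.continuousAt_iff.2 h.continuousAt).continuousWithinAt
  · have h2 : ContMDiffAt 𝓘(ℝ, HC r) 𝓘(ℝ, onePerp r) ∞ (stereo ε) (incl (F x)) :=
      (contDiffAt_stereo ε _ hf).contMDiffAt
    exact ContMDiffAt.comp (f := fun y => incl (F y)) x h2 h

theorem norm_normalize (g : HC r) (hg : g ≠ 0) :
    ∫ x : UnitAddCircle, ‖((Real.sqrt (l2 g g))⁻¹ • g) x‖ ^ 2 = 1 := by
  have hN : 0 < l2 g g :=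
    lt_of_le_of_ne (HC.l2_self_nonneg _) fun h => hg (HC.eq_zero_of_l2_self h.symm)
  rw [← HC.l2_self, HC.l2_smul_left, HC.l2_smul_right, ← mul_assoc, ← mul_inv,
    Real.mul_self_sqrt hN.le, inv_mul_cancel₀ hN.ne']

/-- The point of the sphere given by a function of norm `1`. -/
def ofUnit (f : HC r) (hf : ∫ x : UnitAddCircle, ‖f x‖ ^ 2 = 1) : Sph r := ⟨f, hf⟩

@[simp] theorem incl_ofUnit (f : HC r) (hf : ∫ x : UnitAddCircle, ‖f x‖ ^ 2 = 1) :
    incl (ofUnit f hf) = f := rfl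

open Classical in
/-- The radial retraction `g ↦ g / ‖g‖_{L²}` onto the sphere; its value at `0` is irrelevant. -/
def normalize (g : HC r) : Sph r :=
  if hg : g ≠ 0 then ofUnit _ (norm_normalize g hg) else pole 1 (by norm_num)

theorem incl_normalize {g : HC r} (hg : g ≠ 0) :
    incl (normalize g) = (Real.sqrt (l2 g g))⁻¹ • g := by
  unfold normalize
  rw [dif_pos hg, incl_ofUnit]

theorem normalize_incl (f : Sph r) : normalize (incl f) = f := by
  apply incl_injective
  rw [incl_normalize f.ne_zero, l2_incl, Real.sqrt_one, inv_one, one_smul]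

theorem contDiffAt_scale {g : HC r} (hg : g ≠ 0) :
    ContDiffAt ℝ ∞ (fun g : HC r => (Real.sqrt (l2 g g))⁻¹ • g) g := by
  have hN : 0 < l2 g g :=
    lt_of_le_of_ne (HC.l2_self_nonneg _) fun h => hg (HC.eq_zero_of_l2_self h.symm)
  have h1 : ContDiffAt ℝ ∞ (fun g : HC r => (Real.sqrt (l2 g g))⁻¹) g :=
    (ContDiffAt.sqrt contDiff_l2_self.contDiffAt hN.ne').inv (Real.sqrt_pos.2 hN).ne'
  exact h1.smul contDiffAt_id

theorem contMDiffAt_normalize {g : HC r} (hg : g ≠ 0) :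
    ContMDiffAt 𝓘(ℝ, HC r) 𝓘(ℝ, onePerp r) ∞ normalize g := by
  refine contMDiffAt_of_incl ((contDiffAt_scale hg).contMDiffAt.congr_of_eventuallyEq ?_)
  filter_upwards [isOpen_ne.mem_nhds hg] with k hk
  exact incl_normalize hk

theorem hasFDerivAt_l2_self (f : HC r) :
    HasFDerivAt (fun g : HC r => l2 g g) ((2 : ℝ) • HC.l2L.flip f) f := by
  have h := (HC.l2L (r := r)).hasFDerivAt_of_bilinear (hasFDerivAt_id f) (hasFDerivAt_id f)
  refine h.congr_fderiv ?_
  ext X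
  change l2 f X + l2 X f = 2 * l2 X f
  rw [HC.l2_comm f X]; ring

theorem hasFDerivAt_scale (f : HC r) (hf : l2 f f = 1) :
    HasFDerivAt (fun g : HC r => (Real.sqrt (l2 g g))⁻¹ • g)
      (ContinuousLinearMap.id ℝ (HC r) - (HC.l2L.flip f).smulRight f) f := by
  have h1 := (hasFDerivAt_l2_self f).sqrt (by rw [hf]; exact one_ne_zero)
  have h2 : HasFDerivAt (fun g : HC r => (Real.sqrt (l2 g g))⁻¹) (-(HC.l2L.flip f)) f := by
    have := (hasDerivAt_inv (x := Real.sqrt (l2 f f))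
      (by rw [hf, Real.sqrt_one]; exact one_ne_zero)).comp_hasFDerivAt f h1
    refine this.congr_fderiv ?_
    ext X
    rw [hf]
    simp
  refine (h2.smul (hasFDerivAt_id f)).congr_fderiv ?_
  ext1 X
  simp only [hf, Real.sqrt_one, inv_one, one_smul, id, add_apply, sub_apply,
    ContinuousLinearMap.smulRight_apply,
    ContinuousLinearMap.id_apply, neg_apply, neg_smul]
  abel

/-- The differential of the inclusion of the sphere. -/
def inclD (f : Sph r) : onePerp r →L[ℝ] HC r :=
  mfderiv 𝓘(ℝ, onePerp r) 𝓘(ℝ, HC r) (incl : Sph r → HC r) f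

theorem hasMFDerivAt_incl (f : Sph r) :
    HasMFDerivAt 𝓘(ℝ, onePerp r) 𝓘(ℝ, HC r) (incl : Sph r → HC r) f (inclD f) :=
  ((contMDiff_incl f).mdifferentiableAt (by simp)).hasMFDerivAt

theorem vec_eq (f : Sph r) (X : onePerp r) : vec f X = inclD f X := rfl

/-- The differential of the radial retraction at a point `f` of the sphere is a left inverse of the
differential of the inclusion, and composed with the latter it is the orthogonal projection along
`f`. -/
theorem exists_normalizeD (f : Sph r) : ∃ D : HC r →L[ℝ] onePerp r,
    HasMFDerivAt 𝓘(ℝ, HC r) 𝓘(ℝ, onePerp r) (normalize : HC r → Sph r) (incl f) D ∧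
    (∀ X, D (inclD f X) = X) ∧ ∀ X, inclD f (D X) = X - l2 X (incl f) • incl f := by
  have h1 : HasMFDerivAt 𝓘(ℝ, HC r) 𝓘(ℝ, onePerp r) (normalize : HC r → Sph r) (incl f) _ :=
    ((contMDiffAt_normalize f.ne_zero).mdifferentiableAt (by simp)).hasMFDerivAt
  refine ⟨_, h1, fun X => ?_, fun X => ?_⟩
  · have h2 := h1.comp f (hasMFDerivAt_incl f)
    have h3 : (normalize : HC r → Sph r) ∘ incl = id := funext normalize_incl
    rw [h3] at h2
    have h4 := hasMFDerivAt_unique h2 (hasMFDerivAt_id f)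
    exact congrArg (fun T : onePerp r →L[ℝ] onePerp r => T X) h4
  · have h2 : HasMFDerivAt 𝓘(ℝ, onePerp r) 𝓘(ℝ, HC r) (incl : Sph r → HC r)
        (normalize (incl f)) (inclD f) := by
      rw [normalize_incl]; exact hasMFDerivAt_incl f
    have h3 := h2.comp (incl f) h1
    have h4 : HasMFDerivAt 𝓘(ℝ, HC r) 𝓘(ℝ, HC r) (fun g : HC r => (Real.sqrt (l2 g g))⁻¹ • g)
        (incl f) _ := (hasFDerivAt_scale (incl f) f.l2_incl).hasMFDerivAt
    have h5 : (fun g : HC r => (Real.sqrt (l2 g g))⁻¹ • g) =ᶠ[𝓝 (incl f)]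
        (incl : Sph r → HC r) ∘ normalize := by
      filter_upwards [isOpen_ne.mem_nhds f.ne_zero] with k hk
      exact (incl_normalize hk).symm
    have h6 := hasMFDerivAt_unique (h3.congr_of_eventuallyEq h5) h4
    exact congrArg (fun T : HC r →L[ℝ] HC r => T X) h6

theorem inclD_injective (f : Sph r) : Function.Injective (inclD f) := by
  obtain ⟨D, -, hD, -⟩ := exists_normalizeD f
  exact Function.LeftInverse.injective hD

theorem l2_inclD (f : Sph r) (X : onePerp r) : l2 (inclD f X) (incl f) = 0 := by
  obtain ⟨D, -, hD, hD2⟩ := exists_normalizeD f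
  have h := hD2 (inclD f X)
  rw [hD] at h
  have h2 : l2 (inclD f X) (incl f) • incl f = 0 := by
    rw [eq_comm, sub_eq_self] at h; exact h
  exact (smul_eq_zero.1 h2).resolve_right f.ne_zero

/-- The tangent space of the sphere at `f` is the orthogonal complement of `f`. -/
theorem exists_inclD_eq (f : Sph r) {X : HC r} (hX : l2 X (incl f) = 0) :
    ∃ v : onePerp r, inclD f v = X := by
  obtain ⟨D, -, -, hD2⟩ := exists_normalizeD f
  exact ⟨D X, by rw [hD2, hX, zero_smul, sub_zero]⟩

end Sph
end manifold

/-! ### Projective space and the Fubini-Study metric -/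

namespace CP
variable {r : ℝ} [Fact (1 / 2 < r)]

/-- The chart `[f] ↦ f(· + a)/f(a) - 1` as an open partial homeomorphism. -/
def chartH (a : UnitAddCircle) : OpenPartialHomeomorph (CP r) (H0C r) :=
  (core r).openPartialHomeomorph (chart a) ⟨a, rfl⟩

theorem chartH_apply (a : UnitAddCircle) (P : CP r) : chartH a P = chart a P := rfl
theorem chartH_source (a : UnitAddCircle) :
    (chartH a : OpenPartialHomeomorph (CP r) (H0C r)).source = (chart a).source := rfl
theorem chartH_target (a : UnitAddCircle) :
    (chartH a : OpenPartialHomeomorph (CP r) (H0C r)).target = Set.univ := rfl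

theorem chartH_mem_maximalAtlas (a : UnitAddCircle) :
    (chartH a : OpenPartialHomeomorph (CP r) (H0C r)) ∈
      IsManifold.maximalAtlas 𝓘(ℝ, H0C r) ∞ (CP r) := by
  apply IsManifold.subset_maximalAtlas
  change _ ∈ ⋃ (e : PartialEquiv (CP r) (H0C r)) (he : _), {_}
  simp only [Set.mem_iUnion, Set.mem_singleton_iff]
  exact ⟨chart a, ⟨a, rfl⟩, rfl⟩

theorem hom_dehom (a : UnitAddCircle) (f : HC r) (ha : f a ≠ 0) :
    hom a (dehom a f) = (f a)⁻¹ • f := by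
  ext x
  rw [hom_apply, dehom_apply a f ha, HC.smul_apply, sub_add_cancel]
  ring

open Classical in
/-- The projection `g ↦ [g]` defined on the nonzero functions; its value at `0` is irrelevant. -/
def proj (g : HC r) : CP r :=
  if hg : g ≠ 0 then mk g hg else mk (Sph.incl (Sph.pole 1 (by norm_num))) (Sph.ne_zero _)

theorem proj_eq {g : HC r} (hg : g ≠ 0) : proj g = mk g hg := by
  unfold proj; rw [dif_pos hg]

theorem proj_incl (f : Sph r) : proj (Sph.incl f) = q r f := proj_eq f.ne_zero

theorem proj_smul {g : HC r} {c : ℂ} (hc : c ≠ 0) : proj (c • g) = proj g := by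
  by_cases hg : g = 0
  · rw [hg, smul_zero]
  · rw [proj_eq hg, proj_eq (smul_ne_zero hc hg), mk_eq_mk]
    exact ⟨c, rfl⟩

theorem ne_zero_of_apply {g : HC r} {a : UnitAddCircle} (h : g a ≠ 0) : g ≠ 0 := by
  rintro rfl; exact h rfl

theorem exists_apply_ne {g : HC r} (hg : g ≠ 0) : ∃ a, g a ≠ 0 := by
  by_contra h
  push Not at h
  exact hg (HC.ext h)

theorem chart_proj {g : HC r} (hg : g ≠ 0) (a : UnitAddCircle) : chart a (proj g) = dehom a g := by
  rw [proj_eq hg, chart_mk]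

theorem proj_mem_source {g : HC r} {a : UnitAddCircle} (h : g a ≠ 0) :
    proj g ∈ (chartH a : OpenPartialHomeomorph (CP r) (H0C r)).source := by
  rw [chartH_source, proj_eq (ne_zero_of_apply h), mk_mem_source]; exact h

theorem isOpen_apply_ne (a : UnitAddCircle) : IsOpen {g : HC r | g a ≠ 0} :=
  isOpen_ne_fun (HC.evalL (r := r) a).continuous continuous_const

theorem contMDiffAt_proj {g : HC r} (hg : g ≠ 0) :
    ContMDiffAt 𝓘(ℝ, HC r) 𝓘(ℝ, H0C r) ∞ proj g := by
  obtain ⟨a, ha⟩ := exists_apply_ne hg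
  have h1 : ContMDiffAt 𝓘(ℝ, H0C r) 𝓘(ℝ, H0C r) ∞ (chartH a : OpenPartialHomeomorph (CP r) _).symm
      (dehom a g) := contMDiffAt_symm_of_mem_maximalAtlas (chartH_mem_maximalAtlas a)
        (by rw [chartH_target]; trivial)
  have h2 := h1.comp g (contDiffAt_dehom a g ha).contMDiffAt
  refine h2.congr_of_eventuallyEq ?_
  filter_upwards [(isOpen_apply_ne a).mem_nhds ha] with k hk
  have h3 := (chartH a).left_inv (proj_mem_source hk)
  rw [chartH_apply, chart_proj (ne_zero_of_apply hk)] at h3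
  exact h3.symm

/-- A smooth local section of the projection through a given nonzero function. -/
theorem exists_section {g : HC r} {a : UnitAddCircle} (ha : g a ≠ 0) :
    ∃ S : CP r → HC r, ContMDiffAt 𝓘(ℝ, H0C r) 𝓘(ℝ, HC r) ∞ S (proj g) ∧ S (proj g) = g ∧
      (∀ᶠ P in 𝓝 (proj g), S P ≠ 0 ∧ proj (S P) = P) ∧
      ∀ k : HC r, k a ≠ 0 → S (proj k) = (g a / k a) • k := by
  have hS : ∀ k : HC r, k a ≠ 0 → g a • hom a (chartH a (proj k)) = (g a / k a) • k := by
    intro k hk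
    rw [chartH_apply, chart_proj (ne_zero_of_apply hk), hom_dehom a k hk, smul_smul]
    rfl
  refine ⟨fun P => g a • hom a (chartH a P), ?_, ?_, ?_, hS⟩
  · have h1 := contMDiffAt_of_mem_maximalAtlas (chartH_mem_maximalAtlas (r := r) a)
      (proj_mem_source ha)
    have h2 : ContDiff ℝ ∞ fun v : H0C r => g a • hom a v := (contDiff_hom a).const_smul (g a)
    exact h2.contMDiff.contMDiffAt.comp (proj g) h1
  · exact (hS g ha).trans (by rw [div_self ha, one_smul])
  · filter_upwards [(chartH a).open_source.mem_nhds (proj_mem_source ha)] with P hP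
    have hne := hom_ne a (chartH a P)
    refine ⟨smul_ne_zero ha hne, ?_⟩
    rw [proj_smul ha, proj_eq hne]
    exact (chartH a).left_inv hP

/-- The differential of the projection `g ↦ [g]`. -/
def projD (g : HC r) : HC r →L[ℝ] H0C r := mfderiv 𝓘(ℝ, HC r) 𝓘(ℝ, H0C r) proj g

theorem hasMFDerivAt_proj {g : HC r} (hg : g ≠ 0) :
    HasMFDerivAt 𝓘(ℝ, HC r) 𝓘(ℝ, H0C r) proj g (projD g) :=
  ((contMDiffAt_proj hg).mdifferentiableAt (by simp)).hasMFDerivAt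

/-- The derivative at `g` of the rescaling of functions to the value `g(a)` at `a`. -/
theorem hasFDerivAt_rescale {g : HC r} {a : UnitAddCircle} (ha : g a ≠ 0) :
    ∃ D : HC r →L[ℝ] HC r, HasFDerivAt (fun k : HC r => (g a / k a) • k) D g ∧
      ∀ X, D X = X - (X a / g a) • g := by
  have h1 : HasFDerivAt (fun k : HC r => k a) (HC.evalL (r := r) a) g :=
    (HC.evalL (r := r) a).hasFDerivAt
  have h2 := ((hasDerivAt_inv ha).comp_hasFDerivAt g h1).const_mul (g a)
  have h3 : HasFDerivAt (fun k : HC r => (g a / k a) • k) _ g :=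
    HasFDerivAt.smul h2 (hasFDerivAt_id (𝕜 := ℂ) g)
  refine ⟨_, h3.restrictScalars ℝ, fun X => ?_⟩
  ext x
  simp only [ContinuousLinearMap.coe_restrictScalars', add_apply, smul_apply,
    ContinuousLinearMap.smulRight_apply, ContinuousLinearMap.id_apply, HC.evalL_apply,
    smul_eq_mul, HC.add_apply, HC.smul_apply, HC.sub_apply, Function.comp_apply]
  field_simp
  ring

/-- The differential of a local section at `[g]`: a right inverse of the differential
of `g ↦ [g]`, which lifts tangent vectors to functions vanishing at a point `a` with `g(a) ≠ 0`. -/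
theorem exists_sectionD {g : HC r} (hg : g ≠ 0) : ∃ D : H0C r →L[ℝ] HC r,
    (∀ ξ, projD g (D ξ) = ξ) ∧ ∃ a, g a ≠ 0 ∧ ∀ X, D (projD g X) = X - (X a / g a) • g := by
  obtain ⟨a, ha⟩ := exists_apply_ne hg
  obtain ⟨S, hS, hSg, hSP, hSk⟩ := exists_section ha
  let D' : H0C r →L[ℝ] HC r := mfderiv 𝓘(ℝ, H0C r) 𝓘(ℝ, HC r) S (proj g)
  have h1 : HasMFDerivAt 𝓘(ℝ, H0C r) 𝓘(ℝ, HC r) S (proj g) D' :=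
    (hS.mdifferentiableAt (by simp)).hasMFDerivAt
  refine ⟨D', fun ξ => ?_, a, ha, fun X => ?_⟩
  · have h2 : HasMFDerivAt 𝓘(ℝ, HC r) 𝓘(ℝ, H0C r) proj (S (proj g)) (projD g) := by
      rw [hSg]; exact hasMFDerivAt_proj hg
    have h3 := h2.comp (proj g) h1
    have h4 : id =ᶠ[𝓝 (proj g)] (proj : HC r → CP r) ∘ S := by
      filter_upwards [hSP] with P hP
      exact hP.2.symm
    have h5 := hasMFDerivAt_unique (h3.congr_of_eventuallyEq h4) (hasMFDerivAt_id (proj g))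
    exact congrArg (fun T : H0C r →L[ℝ] H0C r => T ξ) h5
  · obtain ⟨D, hD, hDX⟩ := hasFDerivAt_rescale ha
    have h3 := h1.comp g (hasMFDerivAt_proj hg)
    have h4 : (fun k : HC r => (g a / k a) • k) =ᶠ[𝓝 g] S ∘ proj := by
      filter_upwards [(isOpen_apply_ne a).mem_nhds ha] with k hk
      exact (hSk k hk).symm
    have h5 := hasMFDerivAt_unique (h3.congr_of_eventuallyEq h4) hD.hasMFDerivAt
    rw [← hDX]
    exact congrArg (fun T : HC r →L[ℝ] HC r => T X) h5

theorem projD_surjective {g : HC r} (hg : g ≠ 0) : Function.Surjective (projD g) := by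
  obtain ⟨D, hD, -⟩ := exists_sectionD hg
  exact fun ξ => ⟨D ξ, hD ξ⟩

/-- The kernel of the differential of `g ↦ [g]` is the complex line through `g`. -/
theorem projD_eq_zero_iff {g : HC r} (hg : g ≠ 0) (X : HC r) :
    projD g X = 0 ↔ ∃ c : ℂ, X = c • g := by
  obtain ⟨D, hD, a, ha, hDX⟩ := exists_sectionD hg
  constructor
  · intro h
    have h1 := hDX X
    rw [h, map_zero] at h1
    exact ⟨X a / g a, (sub_eq_zero.1 h1.symm)⟩
  · rintro ⟨c, rfl⟩
    have h1 := hDX (c • g)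
    rw [HC.smul_apply, mul_div_cancel_right₀ _ ha, sub_self] at h1
    rw [← hD (projD g (c • g)), h1, map_zero]

/-- The differential of `g ↦ [g]` is invariant under the action of `ℂ*`. -/
theorem projD_smul {g : HC r} (hg : g ≠ 0) {c : ℂ} (hc : c ≠ 0) (X : HC r) :
    projD (c • g) (c • X) = projD g X := by
  have h1 : HasFDerivAt (fun k : HC r => c • k)
      ((c • ContinuousLinearMap.id ℂ (HC r)).restrictScalars ℝ) g :=
    ((c • ContinuousLinearMap.id ℂ (HC r)).restrictScalars ℝ).hasFDerivAt
  have h2 := (hasMFDerivAt_proj (smul_ne_zero hc hg)).comp g h1.hasMFDerivAt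
  have h3 : (proj : HC r → CP r) ∘ (fun k : HC r => c • k) = proj := funext fun k => proj_smul hc
  rw [h3] at h2
  have h5 := hasMFDerivAt_unique h2 (hasMFDerivAt_proj hg)
  exact congrArg (fun T : HC r →L[ℝ] H0C r => T X) h5

theorem contMDiff_q : ContMDiff 𝓘(ℝ, onePerp r) 𝓘(ℝ, H0C r) ∞ (q r) := by
  intro f
  have h := (contMDiffAt_proj f.ne_zero).comp f (Sph.contMDiff_incl f)
  exact h.congr_of_eventuallyEq (Filter.Eventually.of_forall fun g => (proj_incl g).symm)

theorem hasMFDerivAt_q (f : Sph r) : HasMFDerivAt 𝓘(ℝ, onePerp r) 𝓘(ℝ, H0C r) (q r) f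
    ((projD (Sph.incl f)).comp (Sph.inclD f)) := by
  have h := (hasMFDerivAt_proj f.ne_zero).comp f (Sph.hasMFDerivAt_incl f)
  exact h.congr_of_eventuallyEq (Filter.Eventually.of_forall fun g => (proj_incl g).symm)

theorem mfderiv_q (f : Sph r) (v : onePerp r) :
    (mfderiv 𝓘(ℝ, onePerp r) 𝓘(ℝ, H0C r) (q r) f : onePerp r →L[ℝ] H0C r) v =
      projD (Sph.incl f) (Sph.inclD f v) := by
  rw [(hasMFDerivAt_q f).mfderiv]; rfl

end CP

section hermitian
variable {r : ℝ}

/-- The hermitian `L²` inner product `∫ f ḡ`. -/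
def herm (f g : UnitAddCircle → ℂ) : ℂ := ∫ x, f x * starRingEnd ℂ (g x)

theorem herm_re (f g : UnitAddCircle → ℂ) : (herm f g).re = l2 f g := rfl

theorem herm_sub_left (f g h : HC r) : herm ⇑(f - g) h = herm f h - herm g h := by
  unfold herm
  rw [← MeasureTheory.integral_sub (HC.integrable_mul_conj f h) (HC.integrable_mul_conj g h)]
  simp only [HC.sub_apply, sub_mul]

theorem herm_smul_left (c : ℂ) (f h : HC r) : herm ⇑(c • f) h = c * herm f h := by
  unfold herm
  simp only [HC.smul_apply, mul_assoc, MeasureTheory.integral_const_mul]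

theorem herm_conj (f g : UnitAddCircle → ℂ) : starRingEnd ℂ (herm f g) = herm g f := by
  unfold herm
  rw [← integral_conj]
  congr 1; funext x
  simp [mul_comm]

theorem herm_smul_right (c : ℂ) (f h : HC r) : herm f ⇑(c • h) = starRingEnd ℂ c * herm f h := by
  rw [← herm_conj, herm_smul_left, map_mul, herm_conj]

theorem herm_self (f : UnitAddCircle → ℂ) : herm f f = (l2 f f : ℂ) := by
  apply Complex.ext
  · simp [herm_re]
  · have h := congrArg Complex.im (herm_conj f f)
    rw [Complex.conj_im] at h
    rw [Complex.ofReal_im]; linarith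

theorem l2_smul_smul (c : ℂ) (f g : HC r) : l2 ⇑(c • f) ⇑(c • g) = ‖c‖ ^ 2 * l2 f g := by
  rw [← herm_re, herm_smul_left, herm_smul_right, ← mul_assoc, Complex.mul_conj,
    Complex.normSq_eq_norm_sq, Complex.re_ofReal_mul, herm_re]

/-- The component of `X` orthogonal to the complex line through a unit vector `f`. -/
def horC (f X : HC r) : HC r := X - herm X f • f

theorem horC_smul (c : ℂ) (hc : ‖c‖ = 1) (f X : HC r) : horC (c • f) (c • X) = c • horC f X := by
  unfold horC
  rw [herm_smul_left, herm_smul_right, ← mul_assoc, Complex.mul_conj, Complex.normSq_eq_norm_sq,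
    hc, smul_sub, smul_smul, smul_smul]
  simp [mul_comm]

theorem horC_sub_smul {f : HC r} (hf : l2 f f = 1) (X : HC r) (c : ℂ) :
    horC f (X - c • f) = horC f X := by
  unfold horC
  rw [herm_sub_left, herm_smul_left, herm_self, hf, Complex.ofReal_one, mul_one, sub_smul]
  abel

theorem herm_eq_of_l2_eq_zero {f g : UnitAddCircle → ℂ} (h : l2 f g = 0) :
    herm f g = Complex.I * ((herm f g).im : ℂ) := by
  apply Complex.ext
  · simp [herm_re, h]
  · simp

/-- On tangent vectors of the sphere the horizontal component is the component orthogonal to the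
complex line. -/
theorem horPart_eq (f : Sph r) {X : HC r} (hX : l2 X (Sph.incl f) = 0) :
    horPart f X = horC (Sph.incl f) X := by
  unfold horPart horC
  have h2 : ∫ x, Sph.incl f x * starRingEnd ℂ (X x) = starRingEnd ℂ (herm X (Sph.incl f)) :=
    (herm_conj X (Sph.incl f)).symm
  have h1 := herm_eq_of_l2_eq_zero hX
  rw [h2, Complex.conj_im]
  conv_rhs => rw [h1]
  push_cast
  rw [mul_neg, neg_smul, sub_eq_add_neg]

end hermitian

section fubini
variable {r : ℝ} [Fact (1 / 2 < r)]

/-- The Fubini-Study metric, computed from an arbitrary representative `g` of norm `1` and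
arbitrary lifts of the tangent vectors to `H^r`. -/
theorem fubiniStudy_proj {g : HC r} (hg : l2 g g = 1) (Y Z : HC r) :
    fubiniStudy (CP.proj g) (CP.projD g Y) (CP.projD g Z) = l2 (horC g Y) (horC g Z) := by
  have hg0 : g ≠ 0 := by
    rintro rfl
    simp [l2] at hg
  set f : Sph r := Function.surjInv (CP.q_surjective r) (CP.proj g) with hf
  have hqf : CP.q r f = CP.proj g := Function.surjInv_eq _ _
  obtain ⟨c, hc⟩ : ∃ c : ℂ, c • g = Sph.incl f := by
    rw [CP.proj_eq hg0] at hqf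
    exact (CP.mk_eq_mk _ _).1 hqf
  have hc1 : ‖c‖ = 1 := by
    have h1 := f.l2_incl
    rw [← hc, l2_smul_smul, hg, mul_one] at h1
    exact (pow_eq_one_iff_of_nonneg (norm_nonneg c) two_ne_zero).1 h1
  have hc0 : c ≠ 0 := by rw [← norm_ne_zero_iff, hc1]; exact one_ne_zero
  set T : onePerp r → H0C r :=
    ⇑(mfderiv 𝓘(ℝ, onePerp r) 𝓘(ℝ, H0C r) (CP.q r) f : onePerp r →L[ℝ] H0C r) with hT
  have hTv : ∀ v, T v = CP.projD (Sph.incl f) (Sph.inclD f v) := fun v => CP.mfderiv_q f v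
  have key : ∀ X : HC r, horPart f (Sph.vec f (Function.invFun T (CP.projD g X))) =
      c • horC g X := by
    intro X
    have hex : ∃ v, T v = CP.projD g X := by
      obtain ⟨v, hv⟩ := Sph.exists_inclD_eq f
        (X := c • X - l2 ⇑(c • X) (Sph.incl f) • Sph.incl f) (by
          have h1 : ∀ (A B : HC r), l2 ⇑(A - B) (Sph.incl f) =
              l2 A (Sph.incl f) - l2 B (Sph.incl f) :=
            fun A B => by rw [← herm_re, herm_sub_left, Complex.sub_re, herm_re, herm_re]
          rw [h1, HC.l2_smul_left, f.l2_incl, mul_one, sub_self])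
      refine ⟨v, ?_⟩
      rw [hTv, hv, map_sub, ← CP.projD_smul hg0 hc0 X, hc, sub_eq_self]
      exact (CP.projD_eq_zero_iff f.ne_zero _).2 ⟨(l2 ⇑(c • X) (Sph.incl f) : ℂ), rfl⟩
    set v := Function.invFun T (CP.projD g X) with hv
    have h1 : T v = CP.projD g X := Function.invFun_eq hex
    rw [hTv, ← CP.projD_smul hg0 hc0 X, hc, ← sub_eq_zero, ← map_sub,
      CP.projD_eq_zero_iff f.ne_zero] at h1
    obtain ⟨d, hd⟩ := h1
    have h2 : Sph.inclD f v = c • X - (-d) • Sph.incl f := by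
      rw [neg_smul, sub_neg_eq_add, ← hd]; abel
    have h3 : horPart f (Sph.inclD f v) = c • horC g X := by
      rw [horPart_eq f (Sph.l2_inclD f v), h2, horC_sub_smul f.l2_incl, ← hc, horC_smul c hc1]
    exact (congrArg (horPart f) (Sph.vec_eq f v)).trans h3
  change l2 (horPart f (Sph.vec f (Function.invFun T (CP.projD g Y))))
    (horPart f (Sph.vec f (Function.invFun T (CP.projD g Z)))) = _
  rw [key, key, l2_smul_smul, hc1, one_pow, one_mul]

end fubini

/-! ### The charts of the manifolds `G^s` and `K^s` and the projection `p` -/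

section coordinates

/-- The tangent space at `x` is the model space through the preferred chart at `x`, so this chart
has the identity as differential. -/
theorem hasMFDerivAt_extChartAt_self {E H M : Type} [NormedAddCommGroup E] [NormedSpace ℝ E]
    [TopologicalSpace H] (I : ModelWithCorners ℝ E H) [TopologicalSpace M] [ChartedSpace H M]
    (x : M) : HasMFDerivAt I 𝓘(ℝ, E) (extChartAt I x) x (ContinuousLinearMap.id ℝ E) := by
  refine ⟨continuousAt_extChartAt x, ?_⟩
  have h : HasFDerivWithinAt (fun y : E => y) (ContinuousLinearMap.id ℝ E)
      (Set.range I) (extChartAt I x x) := hasFDerivWithinAt_id _ _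
  refine h.congr_of_eventuallyEq ?_ ?_
  · filter_upwards [extChartAt_target_mem_nhdsWithin (I := I) x] with y hy
    exact (extChartAt I x).right_inv hy
  · exact (extChartAt I x).right_inv (mem_extChartAt_target x)

namespace HCirc
variable {r : ℝ} [Fact (1 / 2 < r)]

/-- The coordinate `h` of a map `α₀ + h` near `α₀`. -/
def coord (α₀ : HCirc r) : HCirc r → HR r := extChartAt 𝓘(ℝ, HR r) α₀

theorem zero_mem_chartDomain : (0 : HR r) ∈ chartDomain r :=
  ⟨0, by have := Real.pi_pos; positivity, fun x => by simp⟩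

theorem coord_add_proj (α₀ : HCirc r) {k : HR r} (hk : k ∈ chartDomain r) :
    coord α₀ (α₀ + proj k) = k :=
  (extChartAt 𝓘(ℝ, HR r) α₀).right_inv ⟨trivial, hk⟩

theorem coord_self (α₀ : HCirc r) : coord α₀ α₀ = 0 := by
  have h := coord_add_proj α₀ (zero_mem_chartDomain (r := r))
  rwa [map_zero, add_zero] at h

theorem eventually_add_coord (α₀ : HCirc r) : ∀ᶠ α in 𝓝 α₀, α₀ + proj (coord α₀ α) = α := by
  filter_upwards [extChartAt_source_mem_nhds (I := 𝓘(ℝ, HR r)) α₀] with α hα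
  exact (extChartAt 𝓘(ℝ, HR r) α₀).left_inv hα

theorem contMDiffAt_coord (α₀ : HCirc r) :
    ContMDiffAt 𝓘(ℝ, HR r) 𝓘(ℝ, HR r) ∞ (coord α₀) α₀ := contMDiffAt_extChartAt

theorem hasMFDerivAt_coord (α₀ : HCirc r) :
    HasMFDerivAt 𝓘(ℝ, HR r) 𝓘(ℝ, HR r) (coord α₀) α₀ (ContinuousLinearMap.id ℝ (HR r)) :=
  hasMFDerivAt_extChartAt_self _ α₀

theorem contMDiffAt_add_proj (α₀ : HCirc r) :
    ContMDiffAt 𝓘(ℝ, HR r) 𝓘(ℝ, HR r) ∞ (fun k : HR r => α₀ + proj k) 0 := by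
  have h := contMDiffOn_extChartAt_symm (I := 𝓘(ℝ, HR r)) (n := ∞) α₀
  have ht : (extChartAt 𝓘(ℝ, HR r) α₀).target ∈ 𝓝 (0 : HR r) := by
    have := extChartAt_target_mem_nhds (I := 𝓘(ℝ, HR r)) α₀
    rwa [show extChartAt 𝓘(ℝ, HR r) α₀ α₀ = 0 from coord_self α₀] at this
  exact h.contMDiffAt ht

end HCirc

namespace HCircMod
variable {r : ℝ} [Fact (1 / 2 < r)]

/-- The coordinate `[h]` of a class `[α₀] + [h]` near `[α₀]`. -/
def coord (a : HCircMod r) : HCircMod r → HRmod r := extChartAt 𝓘(ℝ, HRmod r) a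

theorem coord_add_proj (a : HCircMod r) (k : HRmod r) : coord a (a + proj k) = k :=
  (extChartAt 𝓘(ℝ, HRmod r) a).right_inv ⟨trivial, Set.mem_univ k⟩

theorem coord_self (a : HCircMod r) : coord a a = 0 := by
  have h := coord_add_proj a 0
  rwa [map_zero, add_zero] at h

theorem eventually_add_coord (a : HCircMod r) : ∀ᶠ b in 𝓝 a, a + proj (coord a b) = b := by
  filter_upwards [extChartAt_source_mem_nhds (I := 𝓘(ℝ, HRmod r)) a] with b hb
  exact (extChartAt 𝓘(ℝ, HRmod r) a).left_inv hb

theorem contMDiffAt_coord (a : HCircMod r) :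
    ContMDiffAt 𝓘(ℝ, HRmod r) 𝓘(ℝ, HRmod r) ∞ (coord a) a := contMDiffAt_extChartAt

theorem contMDiffAt_add_proj (a : HCircMod r) :
    ContMDiffAt 𝓘(ℝ, HRmod r) 𝓘(ℝ, HRmod r) ∞ (fun k : HRmod r => a + proj k) 0 := by
  have h := contMDiffOn_extChartAt_symm (I := 𝓘(ℝ, HRmod r)) (n := ∞) a
  have ht : (extChartAt 𝓘(ℝ, HRmod r) a).target ∈ 𝓝 (0 : HRmod r) := by
    have := extChartAt_target_mem_nhds (I := 𝓘(ℝ, HRmod r)) a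
    rwa [show extChartAt 𝓘(ℝ, HRmod r) a a = 0 from coord_self a] at this
  exact h.contMDiffAt ht

/-- The projection `H^r(S¹; ℝ) → H^r(S¹; ℝ)/ℝ`. -/
def mkL (r : ℝ) : HR r →L[ℝ] HRmod r := (constR r).mkQL

theorem mk_eq_near (α₀ : HCirc r) :
    (mk : HCirc r → HCircMod r) =ᶠ[𝓝 α₀]
      (fun k => mk α₀ + proj k) ∘ (mkL r) ∘ HCirc.coord α₀ := by
  filter_upwards [HCirc.eventually_add_coord α₀] with α hα
  conv_lhs => rw [← hα, map_add]
  rfl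

theorem contMDiff_mk : ContMDiff 𝓘(ℝ, HR r) 𝓘(ℝ, HRmod r) ∞ (mk : HCirc r → HCircMod r) := by
  intro α₀
  refine ContMDiffAt.congr_of_eventuallyEq ?_ (mk_eq_near α₀)
  have h1 := ((mkL r).contDiff (n := ∞)).contMDiff.contMDiffAt.comp α₀ (HCirc.contMDiffAt_coord α₀)
  refine ContMDiffAt.comp α₀ ?_ h1
  rw [Function.comp_apply, HCirc.coord_self, map_zero]
  exact contMDiffAt_add_proj _

theorem hasMFDerivAt_mk (α₀ : HCirc r) :
    HasMFDerivAt 𝓘(ℝ, HR r) 𝓘(ℝ, HRmod r) (mk : HCirc r → HCircMod r) α₀ (mkL r) := by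
  have h0 : HasMFDerivAt 𝓘(ℝ, HR r) 𝓘(ℝ, HRmod r) (mk : HCirc r → HCircMod r) α₀ _ :=
    (contMDiff_mk.contMDiffAt.mdifferentiableAt (by simp)).hasMFDerivAt
  have h1 := (hasMFDerivAt_extChartAt_self 𝓘(ℝ, HRmod r) (mk α₀)).comp α₀ h0
  have h2 : (extChartAt 𝓘(ℝ, HRmod r) (mk α₀)) ∘ (mk : HCirc r → HCircMod r) =ᶠ[𝓝 α₀]
      (mkL r) ∘ HCirc.coord α₀ := by
    filter_upwards [mk_eq_near α₀] with α hα
    rw [Function.comp_apply, hα]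
    exact coord_add_proj _ _
  have h3 := (mkL r).hasFDerivAt.hasMFDerivAt.comp α₀ (HCirc.hasMFDerivAt_coord α₀)
  have h4 := hasMFDerivAt_unique h1 (h3.congr_of_eventuallyEq h2)
  have h5 : (mfderiv 𝓘(ℝ, HR r) 𝓘(ℝ, HRmod r) (mk : HCirc r → HCircMod r) α₀ :
      HR r →L[ℝ] HRmod r) = mkL r := h4
  rw [h5] at h0
  exact h0

end HCircMod

namespace HRmod
variable {r : ℝ} [Fact (1 / 2 < r)]

/-- The linear section `[h] ↦ h - h(0)` of the projection `H^r(S¹; ℝ) → H^r(S¹; ℝ)/ℝ`. -/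
def lift : HRmod r →L[ℝ] HR r :=
  (constR r).liftQL (ContinuousLinearMap.id ℝ (HR r) - (HR.evalL (r := r) 0).smulRight (HR.const 1))
    (by
      intro h hh
      obtain ⟨c, hc⟩ := mem_constR.1 hh
      rw [LinearMap.mem_ker]
      ext x
      simp [hc])

theorem lift_mk_apply (h : HR r) (x : UnitAddCircle) :
    lift (Submodule.Quotient.mk h : HRmod r) x = h x - h 0 := by
  change (h - h 0 • HR.const 1 : HR r) x = _
  simp

theorem mk_lift (k : HRmod r) : (Submodule.Quotient.mk (lift k) : HRmod r) = k := by
  obtain ⟨h, rfl⟩ := Submodule.Quotient.mk_surjective _ k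
  rw [Submodule.Quotient.eq, mem_constR]
  exact ⟨-h 0, fun x => by rw [HR.sub_apply, lift_mk_apply]; ring⟩

end HRmod

end coordinates

section projection
variable {s : ℝ} [hs : Fact (5 / 2 < s)]

theorem contMDiff_p : ContMDiff (IG s) (IK s) ∞ (p s) :=
  contMDiff_id.prodMap HCircMod.contMDiff_mk

/-- The differential of `p` is `(U₁, U₂) ↦ (U₁, [U₂])`. -/
theorem mfderiv_p (g : G s) (U : H0R s × HR (s - 1)) :
    (mfderiv (IG s) (IK s) (p s) g : H0R s × HR (s - 1) →L[ℝ] H0R s × HRmod (s - 1)) U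
      = (U.1, Submodule.Quotient.mk U.2) := by
  have h : HasMFDerivAt (IG s) (IK s) (p s) g _ :=
    (hasMFDerivAt_id g.1).prodMap (HCircMod.hasMFDerivAt_mk g.2)
  rw [h.mfderiv]
  have h1 : (mfderiv 𝓘(ℝ, H0R s) 𝓘(ℝ, H0R s) (id : Diff0 s → Diff0 s) g.1 :
      H0R s →L[ℝ] H0R s) = ContinuousLinearMap.id ℝ (H0R s) := mfderiv_id
  have h2 : (mfderiv 𝓘(ℝ, HR (s - 1)) 𝓘(ℝ, HRmod (s - 1)) HCircMod.mk g.2 :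
      HR (s - 1) →L[ℝ] HRmod (s - 1)) = HCircMod.mkL (s - 1) :=
    (HCircMod.hasMFDerivAt_mk g.2).mfderiv
  exact Prod.ext (congrArg (fun T : H0R s →L[ℝ] H0R s => T U.1) h1)
    (congrArg (fun T : HR (s - 1) →L[ℝ] HRmod (s - 1) => T U.2) h2)

theorem p_surjective : Function.Surjective (p s) := by
  rintro ⟨φ, a⟩
  obtain ⟨α, rfl⟩ := QuotientAddGroup.mk_surjective a
  exact ⟨(φ, α), rfl⟩

theorem p_eq_iff (g g' : G s) :
    p s g = p s g' ↔ ∃ θ : Circ, g' = (g.1, g.2 + HCirc.const θ) := by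
  obtain ⟨φ, α⟩ := g
  obtain ⟨ψ, β⟩ := g'
  constructor
  · intro h
    obtain ⟨θ, hθ⟩ := HCircMod.mk_eq_mk.1 (congrArg Prod.snd h)
    exact ⟨θ, Prod.ext (congrArg Prod.fst h).symm hθ⟩
  · rintro ⟨θ, h⟩
    rw [Prod.mk.injEq] at h
    exact Prod.ext h.1.symm (HCircMod.mk_eq_mk.2 ⟨θ, h.2⟩)

/-- A smooth local section of `p` through a given point. -/
theorem exists_section_p (g : G s) : ∃ σ : K s → G s,
    ContMDiffAt (IK s) (IG s) ∞ σ (p s g) ∧ σ (p s g) = g ∧ ∀ᶠ k in 𝓝 (p s g), p s (σ k) = k := by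
  obtain ⟨φ, α⟩ := g
  set l : HCircMod (s - 1) → HR (s - 1) := HRmod.lift ∘ HCircMod.coord (HCircMod.mk α) with hl
  have hl0 : l (HCircMod.mk α) = 0 := by
    rw [hl, Function.comp_apply, HCircMod.coord_self, map_zero]
  have hl1 : ContMDiffAt 𝓘(ℝ, HRmod (s - 1)) 𝓘(ℝ, HR (s - 1)) ∞ l (HCircMod.mk α) :=
    (HRmod.lift.contDiff (n := ∞)).contMDiff.contMDiffAt.comp _ (HCircMod.contMDiffAt_coord _)
  have h2 : ContMDiffAt 𝓘(ℝ, HRmod (s - 1)) 𝓘(ℝ, HR (s - 1)) ∞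
      (fun a => α + HCirc.proj (l a)) (HCircMod.mk α) := by
    refine ContMDiffAt.comp (g := fun k : HR (s - 1) => α + HCirc.proj k) _ ?_ hl1
    rw [hl0]
    exact HCirc.contMDiffAt_add_proj α
  refine ⟨fun k => (k.1, α + HCirc.proj (l k.2)), ?_, ?_, ?_⟩
  · have h3 : ContMDiffAt (IK s) 𝓘(ℝ, HRmod (s - 1)) ∞ (Prod.snd : K s → _) (p s (φ, α)) :=
      contMDiffAt_snd
    exact contMDiffAt_fst.prodMk (ContMDiffAt.comp
      (g := fun a => α + HCirc.proj (l a)) (p s (φ, α)) h2 h3)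
  · change (φ, α + HCirc.proj (l (HCircMod.mk α))) = _
    rw [hl0, map_zero, add_zero]
  · have h3 : ∀ᶠ k : K s in 𝓝 (p s (φ, α)),
        HCircMod.mk α + HCircMod.proj (HCircMod.coord (HCircMod.mk α) k.2) = k.2 :=
      (continuous_snd (X := Diff0 s)).continuousAt (x := p s (φ, α)) |>.eventually
        (HCircMod.eventually_add_coord (HCircMod.mk α))
    filter_upwards [h3] with k hk
    refine Prod.ext rfl ?_
    change HCircMod.mk (α + HCirc.proj (l k.2)) = k.2
    rw [map_add, ← HCircMod.proj_mk, hl, Function.comp_apply, HRmod.mk_lift, hk]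

end projection

section submersion_p
variable {s : ℝ} [hs : Fact (5 / 2 < s)]

/-- The splitting `h ↦ ([h], h(0))` of the functions into a class modulo constants and a
constant. -/
def HR.splitConst (r : ℝ) [Fact (1 / 2 < r)] : HR r ≃L[ℝ] HRmod r × ℝ :=
  ContinuousLinearEquiv.equivOfInverse
    ((HCircMod.mkL r).prod (HR.evalL 0))
    ((HRmod.lift.comp (ContinuousLinearMap.fst ℝ (HRmod r) ℝ)) +
      (ContinuousLinearMap.snd ℝ (HRmod r) ℝ).smulRight (HR.const 1))
    (fun h => by
      ext x
      change (HRmod.lift (Submodule.Quotient.mk h : HRmod r) + h 0 • HR.const 1 : HR r) x = h x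
      rw [HR.add_apply, HRmod.lift_mk_apply]; simp)
    (fun k => by
      obtain ⟨k, c⟩ := k
      obtain ⟨h, rfl⟩ := Submodule.Quotient.mk_surjective _ k
      have e : ∀ x, (HRmod.lift (Submodule.Quotient.mk h : HRmod r) + c • HR.const 1 : HR r) x =
          h x - h 0 + c := fun x => by
        rw [HR.add_apply, HRmod.lift_mk_apply]; simp
      refine Prod.ext ?_ ?_
      · refine (Submodule.Quotient.eq _).2 (mem_constR.2 ⟨c - h 0, fun x => ?_⟩)
        rw [HR.sub_apply]
        refine (congrArg (· - h x) (e x)).trans ?_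
        ring
      · refine (e 0).trans ?_
        ring)

/-- In the preferred charts `p` is `(h, k) ↦ (h, [k])`, which `HR.splitConst` turns into a linear
projection with kernel `ℝ`. -/
theorem isSubmersion_p : Manifold.IsSubmersion (IG s) (IK s) ∞ (p s) := by
  refine ⟨ℝ, inferInstance, inferInstance, fun g => ?_⟩
  refine Manifold.IsSubmersionAtOfComplement.mk_of_continuousAt contMDiff_p.continuous.continuousAt
    (((ContinuousLinearEquiv.refl ℝ (H0R s)).prodCongr (HR.splitConst (s - 1))).trans
      (ContinuousLinearEquiv.prodAssoc ℝ (H0R s) (HRmod (s - 1)) ℝ).symm)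
    (chartAt _ g) (chartAt _ (p s g)) (mem_chart_source _ g) (mem_chart_source _ _)
    (IsManifold.chart_mem_maximalAtlas g) (IsManifold.chart_mem_maximalAtlas (p s g)) ?_
  rintro ⟨h, k⟩ ⟨-, hh, hk⟩
  refine Prod.ext ?_ ?_
  · exact (extChartAt 𝓘(ℝ, H0R s) g.1).right_inv ⟨trivial, hh⟩
  · exact HCircMod.coord_add_proj (HCircMod.mk g.2) (Submodule.Quotient.mk k)

end submersion_p

/-! ### The map `Φ` -/

section madelung
variable {s : ℝ} [hs : Fact (5 / 2 < s)]

/-- The function `√φ_x` as an element of `H^{s-1}`. -/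
def sqrtPhiX (φ : Diff0 s) : HC (s - 1) := HC.expH ((1 / 2 : ℝ) • logR (phiXH φ))

theorem exp_half_log {t : ℝ} (ht : 0 < t) : Complex.exp ((1 / 2 : ℝ) * (Real.log t : ℂ)) = √t := by
  rw [← Complex.ofReal_mul, ← Complex.ofReal_exp, Real.sqrt_eq_rpow, Real.rpow_def_of_pos ht,
    mul_comm]

theorem sqrtPhiX_apply (φ : Diff0 s) (x : UnitAddCircle) : sqrtPhiX φ x = (√(phiX φ x) : ℂ) := by
  unfold sqrtPhiX
  have hp : ∀ x, 0 < phiXH φ x := fun x => by rw [phiXH_apply]; exact phiX_pos φ x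
  rw [HC.expH_apply, HC.real_smul_apply, logR_apply hp, phiXH_apply, exp_half_log (phiX_pos φ x)]

/-- The function `√φ_x e^{iα/2}`. -/
def madelungH (g : G s) : HC (s - 1) := sqrtPhiX g.1 * phaseH g.2

theorem madelungH_apply (g : G s) (x : UnitAddCircle) :
    madelungH g x = (√(phiX g.1 x) : ℂ) * phase (g.2 x) := by
  unfold madelungH
  rw [HC.mul_apply, sqrtPhiX_apply, phaseH_apply]

theorem norm_madelungH (g : G s) (x : UnitAddCircle) : ‖madelungH g x‖ = √(phiX g.1 x) := by
  rw [madelungH_apply, norm_mul, norm_phase, mul_one, Complex.norm_real,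
    Real.norm_of_nonneg (Real.sqrt_nonneg _)]

theorem norm_sq_madelungH (g : G s) (x : UnitAddCircle) : ‖madelungH g x‖ ^ 2 = phiX g.1 x := by
  rw [norm_madelungH, Real.sq_sqrt (phiX_pos g.1 x).le]

/-- The map `Φ(φ, α) = √φ_x e^{iα/2}`; its values have norm `1` since `∫ φ_x = 1`. -/
def madelung (g : G s) : Sph (s - 1) := Sph.ofUnit (madelungH g) (by
  simp only [norm_sq_madelungH, integral_phiX])

@[simp] theorem incl_madelung (g : G s) : Sph.incl (madelung g) = madelungH g := rfl

theorem madelung_mem_setU (g : G s) : madelung g ∈ setU (s - 1) := fun x => by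
  rw [incl_madelung, ← norm_ne_zero_iff, norm_madelungH]
  exact (Real.sqrt_pos.2 (phiX_pos g.1 x)).ne'

theorem madelungH_add_const (φ : Diff0 s) (α : HCirc (s - 1)) (θ : Circ) :
    madelungH (φ, α + HCirc.const θ) = phase θ • madelungH (φ, α) := by
  ext x
  rw [HC.smul_apply, madelungH_apply, madelungH_apply]
  change _ * phase (α x + θ) = _
  rw [phase_add]
  ring

theorem madelung_injective : Function.Injective (madelung : G s → Sph (s - 1)) := by
  rintro ⟨φ, α⟩ ⟨ψ, β⟩ h
  have h1 : ∀ x, madelungH (φ, α) x = madelungH (ψ, β) x := fun x =>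
    congrArg (fun f : Sph (s - 1) => Sph.incl f x) h
  have h2 : φ = ψ := Diff0.ext_phiX fun x => by
    have := norm_sq_madelungH (φ, α) x
    rw [h1, norm_sq_madelungH] at this
    exact this.symm
  subst h2
  refine Prod.ext rfl (HCirc.ext fun x => phase_injective ?_)
  have h3 := h1 x
  rw [madelungH_apply, madelungH_apply] at h3
  refine mul_left_cancel₀ ?_ h3
  exact_mod_cast (Real.sqrt_pos.2 (phiX_pos φ x)).ne'

/-- The expression of `Φ` in the coordinates `(h, k) ↦ (id + h, α₀ + k)`. -/
def madelungLoc (α₀ : HCirc (s - 1)) (z : H0R s × HR (s - 1)) : HC (s - 1) :=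
  phaseH α₀ * HC.expH ((1 / 2 : ℝ) • logR (HR.const 1 + derivR (z.1 : HR s)) +
    (Complex.I / 2) • HR.toHCL z.2)

theorem contDiffAt_madelungLoc (α₀ : HCirc (s - 1)) (φ : Diff0 s) (k : HR (s - 1)) :
    ContDiffAt ℝ ∞ (madelungLoc α₀) (φ.1, k) := by
  have h1 : ContDiff ℝ ∞ fun z : H0R s × HR (s - 1) => HR.const 1 + derivR (z.1 : HR s) :=
    contDiff_const.add ((derivR.comp ((H0R s).subtypeL.comp
      (ContinuousLinearMap.fst ℝ (H0R s) (HR (s - 1))))).contDiff)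
  have hp : ∀ x, 0 < (HR.const 1 + derivR (φ.1 : HR s) : HR (s - 1)) x := fun x => by
    have := phiX_pos φ x
    rwa [← phiXH_apply] at this
  have h2 : ContDiffAt ℝ ∞ (fun z : H0R s × HR (s - 1) =>
      logR (HR.const 1 + derivR (z.1 : HR s) : HR (s - 1))) (φ.1, k) :=
    ContDiffAt.comp (g := logR) (φ.1, k) (contDiffAt_logR hp) h1.contDiffAt
  have h3 : ContDiff ℝ ∞ fun z : H0R s × HR (s - 1) => (Complex.I / 2) • HR.toHCL z.2 :=
    ((((Complex.I / 2) • ContinuousLinearMap.id ℂ (HC (s - 1))).restrictScalars ℝ).comp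
      (HR.toHCL.comp (ContinuousLinearMap.snd ℝ (H0R s) (HR (s - 1))))).contDiff
  have h4 : ContDiffAt ℝ ∞ (fun z : H0R s × HR (s - 1) =>
      (1 / 2 : ℝ) • logR (HR.const 1 + derivR (z.1 : HR s) : HR (s - 1)) +
        (Complex.I / 2) • HR.toHCL z.2) (φ.1, k) :=
    (h2.const_smul (1 / 2 : ℝ)).add h3.contDiffAt
  have h5 := HC.contDiff_expH.contDiffAt.comp (φ.1, k) h4
  exact (((HC.mulL (phaseH α₀)).restrictScalars ℝ).contDiff.contDiffAt).comp (φ.1, k) h5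

theorem madelungLoc_apply (α₀ : HCirc (s - 1)) (φ : Diff0 s) (k : HR (s - 1)) :
    madelungLoc α₀ (φ.1, k) = madelungH (φ, α₀ + HCirc.proj k) := by
  unfold madelungH sqrtPhiX
  rw [phaseH_add, phaseH_proj]
  ext x
  change (phaseH α₀ * HC.expH ((1 / 2 : ℝ) • logR (phiXH φ) +
    (Complex.I / 2) • HR.toHCL k)) x = _
  simp only [HC.mul_apply, HC.expH_apply, HC.add_apply, Complex.exp_add]
  ring

/-- The coordinates of a point of `G^s` near `(φ, α₀)`. -/
def gcoord (α₀ : HCirc (s - 1)) (g : G s) : H0R s × HR (s - 1) := (g.1.1, HCirc.coord α₀ g.2)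

theorem contMDiffAt_gcoord (g₀ : G s) :
    ContMDiffAt (IG s) 𝓘(ℝ, H0R s × HR (s - 1)) ∞ (gcoord g₀.2) g₀ := by
  have h1 : ContMDiffAt (IG s) 𝓘(ℝ, H0R s) ∞ (fun g : G s => g.1.1) g₀ :=
    ContMDiffAt.comp (g := Subtype.val) g₀ (contMDiff_subtype_val.contMDiffAt (x := g₀.1))
      contMDiffAt_fst
  have h2 : ContMDiffAt (IG s) 𝓘(ℝ, HR (s - 1)) ∞ (fun g : G s => HCirc.coord g₀.2 g.2) g₀ :=
    ContMDiffAt.comp (g := HCirc.coord g₀.2) g₀ (HCirc.contMDiffAt_coord g₀.2) contMDiffAt_snd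
  exact h1.prodMk_space h2

theorem hasMFDerivAt_gcoord (g₀ : G s) :
    HasMFDerivAt (IG s) 𝓘(ℝ, H0R s × HR (s - 1)) (gcoord g₀.2) g₀
      (ContinuousLinearMap.id ℝ (H0R s × HR (s - 1))) := by
  exact hasMFDerivAt_extChartAt_self (IG s) g₀

theorem gcoord_self (g₀ : G s) : gcoord g₀.2 g₀ = (g₀.1.1, 0) := by
  unfold gcoord
  rw [HCirc.coord_self]

theorem madelungH_eq_near (g₀ : G s) : madelungH =ᶠ[𝓝 g₀] madelungLoc g₀.2 ∘ gcoord g₀.2 := by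
  have h3 : ∀ᶠ g : G s in 𝓝 g₀, g₀.2 + HCirc.proj (HCirc.coord g₀.2 g.2) = g.2 :=
    (continuous_snd (X := Diff0 s)).continuousAt (x := g₀) |>.eventually
      (HCirc.eventually_add_coord g₀.2)
  filter_upwards [h3] with g hg
  refine Eq.trans ?_ (madelungLoc_apply g₀.2 g.1 (HCirc.coord g₀.2 g.2)).symm
  rw [hg]

theorem contMDiff_madelungH : ContMDiff (IG s) 𝓘(ℝ, HC (s - 1)) ∞ (madelungH : G s → _) := by
  intro g₀
  refine ContMDiffAt.congr_of_eventuallyEq ?_ (madelungH_eq_near g₀)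
  refine ContMDiffAt.comp g₀ ?_ (contMDiffAt_gcoord g₀)
  rw [gcoord_self]
  exact (contDiffAt_madelungLoc g₀.2 g₀.1 0).contMDiffAt

theorem contMDiff_madelung : ContMDiff (IG s) 𝓘(ℝ, onePerp (s - 1)) ∞ (madelung : G s → _) :=
  fun _ => Sph.contMDiffAt_of_incl contMDiff_madelungH.contMDiffAt

/-- The differential of `(φ, α) ↦ √φ_x e^{iα/2}`. -/
def madelungD (g : G s) : H0R s × HR (s - 1) →L[ℝ] HC (s - 1) :=
  fderiv ℝ (madelungLoc g.2) (g.1.1, 0)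

theorem hasMFDerivAt_madelungH (g : G s) :
    HasMFDerivAt (IG s) 𝓘(ℝ, HC (s - 1)) madelungH g (madelungD g) := by
  have h1 : HasFDerivAt (madelungLoc g.2) (madelungD g) (gcoord g.2 g) := by
    rw [gcoord_self]
    exact ((contDiffAt_madelungLoc g.2 g.1 0).differentiableAt (by simp)).hasFDerivAt
  have h2 := h1.hasMFDerivAt.comp g (hasMFDerivAt_gcoord g)
  exact h2.congr_of_eventuallyEq (madelungH_eq_near g)

/-- The differential of `Φ` is `TΦ(U₁, U₂) = ½ Φ (U₁ₓ / φ_x + i U₂)`. -/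
theorem madelungD_apply (g : G s) (U : H0R s × HR (s - 1)) (x : UnitAddCircle) :
    madelungD g U x = madelungH g x *
      ((1 / 2 : ℝ) * ((dx (U.1 : HR s) x / phiX g.1 x : ℝ) + Complex.I * (U.2 x : ℝ))) := by
  have h1 : HasFDerivAt (madelungLoc g.2) (madelungD g) ((g.1.1, 0) + (0 : ℝ) • U) := by
    rw [zero_smul, add_zero]
    exact ((contDiffAt_madelungLoc g.2 g.1 0).differentiableAt (by simp)).hasFDerivAt
  have h2 : HasDerivAt (fun t : ℝ => ((g.1.1, 0) : H0R s × HR (s - 1)) + t • U) U 0 := by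
    simpa using ((hasDerivAt_id (0 : ℝ)).smul_const U).const_add
      ((g.1.1, 0) : H0R s × HR (s - 1))
  have h3 := ((HC.evalL (r := s - 1) x).restrictScalars ℝ).hasFDerivAt.comp_hasDerivAt (0 : ℝ)
    (h1.comp_hasDerivAt (0 : ℝ) h2)
  have hp := phiX_pos g.1 x
  -- near `t = 0` the curve `t ↦ Φ(φ + t U₁, α + t U₂)(x)` is given by an elementary formula
  have h4 : ∀ᶠ t : ℝ in 𝓝 0, madelungLoc g.2 (((g.1.1, 0) : H0R s × HR (s - 1)) + t • U) x =
      phase (g.2 x) * Complex.exp ((1 / 2 : ℝ) * (Real.log (phiX g.1 x +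
        t * dx (U.1 : HR s) x) : ℝ) + (Complex.I / 2) * ((t * U.2 x : ℝ) : ℂ)) := by
    have hc : ContinuousAt (fun t : ℝ => (g.1.1 + t • U.1 : H0R s)) 0 := by fun_prop
    have hm : ∀ᶠ t : ℝ in 𝓝 0, (g.1.1 + t • U.1 : H0R s) ∈ Diff0 s :=
      hc.eventually ((Diff0 s).isOpen.mem_nhds (by
        change g.1.1 + (0 : ℝ) • U.1 ∈ Diff0 s
        rw [zero_smul, add_zero]; exact g.1.2))
    filter_upwards [hm] with t ht
    have hpos : ∀ y, 0 < (phiXH ⟨_, ht⟩ : HR (s - 1)) y := fun y => by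
      rw [phiXH_apply]; exact phiX_pos ⟨_, ht⟩ y
    have e1 : (phiXH ⟨_, ht⟩ : HR (s - 1)) x = phiX g.1 x + t * dx (U.1 : HR s) x := by
      change ((HR.const 1 + derivR ((g.1.1 + t • U.1 : H0R s) : HR s) :
        HR (s - 1)) : UnitAddCircle → ℝ) x = _
      rw [Submodule.coe_add, Submodule.coe_smul, map_add, map_smul]
      simp only [HR.add_apply, HR.smul_apply, derivR_apply, HR.const_apply]
      unfold phiX
      ring
    change (phaseH g.2 * HC.expH ((1 / 2 : ℝ) • logR (phiXH ⟨_, ht⟩) +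
      (Complex.I / 2) • HR.toHCL (0 + t • U.2)) : HC (s - 1)) x = _
    rw [HC.mul_apply, phaseH_apply, HC.expH_apply, HC.add_apply, HC.real_smul_apply,
      logR_apply hpos, e1, HC.smul_apply, HR.toHCL_apply, zero_add, HR.smul_apply]
  have h5 : HasDerivAt (fun t : ℝ => Real.log (phiX g.1 x + t * dx (U.1 : HR s) x))
      (dx (U.1 : HR s) x / phiX g.1 x) 0 := by
    have h6 : HasDerivAt (fun t : ℝ => phiX g.1 x + t * dx (U.1 : HR s) x)
        (dx (U.1 : HR s) x) 0 := by
      simpa using ((hasDerivAt_id (0 : ℝ)).mul_const (dx (U.1 : HR s) x)).const_add (phiX g.1 x)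
    have h7 := h6.log (by simpa using hp.ne')
    simpa using h7
  have h8 : HasDerivAt (fun t : ℝ => t * U.2 x) (U.2 x) 0 := by
    simpa using (hasDerivAt_id (0 : ℝ)).mul_const (U.2 x)
  have h9 := ((h5.ofReal_comp.const_mul ((1 / 2 : ℝ) : ℂ)).add
    (h8.ofReal_comp.const_mul (Complex.I / 2))).cexp.const_mul (phase (g.2 x))
  have h10 := h3.unique (h9.congr_of_eventuallyEq h4)
  refine Eq.trans h10 ?_
  rw [madelungH_apply]
  simp only [Pi.add_apply, zero_mul, add_zero, Complex.ofReal_zero, mul_zero,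
    exp_half_log hp]
  push_cast
  ring

theorem re_mul_conj_mul (z : ℂ) (a b c d : ℝ) :
    Complex.reCLM ((z * ((1 / 2 : ℝ) * ((a : ℂ) + Complex.I * b))) *
      starRingEnd ℂ (z * ((1 / 2 : ℝ) * ((c : ℂ) + Complex.I * d)))) =
      1 / 4 * (‖z‖ ^ 2 * (a * c + b * d)) := by
  have e : (z * ((1 / 2 : ℝ) * ((a : ℂ) + Complex.I * b))) *
      starRingEnd ℂ (z * ((1 / 2 : ℝ) * ((c : ℂ) + Complex.I * d))) =
      ((1 / 4 * ‖z‖ ^ 2 : ℝ) : ℂ) *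
        (((a * c + b * d : ℝ) : ℂ) + ((b * c - a * d : ℝ) : ℂ) * Complex.I) := by
    have h := Complex.mul_conj z
    rw [Complex.normSq_eq_norm_sq] at h
    simp only [map_mul, map_add, Complex.conj_ofReal, Complex.conj_I]
    push_cast at h ⊢
    linear_combination (1 / 4 : ℂ) * (a + Complex.I * b) * (c - Complex.I * d) * h -
      (1 / 4 : ℂ) * ‖z‖ ^ 2 * b * d * Complex.I_sq
  rw [e, Complex.reCLM_apply, Complex.re_ofReal_mul]
  simp
  ring

theorem l2_madelungD (g : G s) (U V : H0R s × HR (s - 1)) :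
    l2 (madelungD g U) (madelungD g V) = metricG g U V := by
  unfold metricG l2
  rw [← MeasureTheory.integral_const_mul]
  have hre := (Complex.reCLM.integral_comp_comm
    (HC.integrable_mul_conj (madelungD g U) (madelungD g V))).symm
  refine Eq.trans hre ?_
  congr 1
  funext x
  rw [madelungD_apply, madelungD_apply, re_mul_conj_mul, norm_sq_madelungH]
  have hp := (phiX_pos g.1 x).ne'
  field_simp

theorem vec_mfderiv_madelung (g : G s) (U : H0R s × HR (s - 1)) :
    Sph.vec (madelung g) (mfderiv (IG s) 𝓘(ℝ, onePerp (s - 1)) (madelung : G s → _) g U) =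
      madelungD g U := by
  have h0 : HasMFDerivAt (IG s) 𝓘(ℝ, onePerp (s - 1)) (madelung : G s → _) g _ :=
    (contMDiff_madelung.contMDiffAt.mdifferentiableAt (by simp)).hasMFDerivAt
  have h1 := hasMFDerivAt_unique ((Sph.hasMFDerivAt_incl (madelung g)).comp g h0)
    (hasMFDerivAt_madelungH g)
  exact congrArg (fun T : H0R s × HR (s - 1) →L[ℝ] HC (s - 1) => T U) h1

/-- `Φ` is an isometry. -/
theorem preservesMetric_madelung :
    PreservesMetric (IG s) 𝓘(ℝ, onePerp (s - 1)) metricG metricSph (madelung : G s → _) :=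
  fun g U V => (congrArg₂ (fun A B : HC (s - 1) => l2 A B) (vec_mfderiv_madelung g U)
    (vec_mfderiv_madelung g V)).trans (l2_madelungD g U V)

end madelung

/-! ### The inverse of `Φ` -/

section inverse
variable {s : ℝ} [hs : Fact (5 / 2 < s)]

/-- An injective smooth map with smooth local right inverses at the points of `V` is a
diffeomorphism onto `V`. -/
theorem isDiffeoOnto_of_local_inverse {E E' H H' M N : Type} [NormedAddCommGroup E]
    [NormedSpace ℝ E] [NormedAddCommGroup E'] [NormedSpace ℝ E'] [TopologicalSpace H]
    [TopologicalSpace H'] {I : ModelWithCorners ℝ E H} {J : ModelWithCorners ℝ E' H'}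
    [TopologicalSpace M] [ChartedSpace H M] [TopologicalSpace N] [ChartedSpace H' N] [Nonempty M]
    {f : M → N} {V : Set N} (hf : ContMDiff I J ∞ f) (hinj : Function.Injective f)
    (hV : ∀ x, f x ∈ V)
    (h : ∀ y ∈ V, ∃ g : N → M, ContMDiffAt J I ∞ g y ∧ ∀ᶠ z in 𝓝 y, f (g z) = z) :
    IsDiffeoOnto I J f V := by
  have hl := Function.leftInverse_invFun hinj
  refine ⟨?_, ⟨fun x _ => hV x, hinj.injOn, fun y hy => ?_⟩, hf, Function.invFun f, hl,
    fun y hy => ?_⟩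
  · rw [isOpen_iff_mem_nhds]
    intro y hy
    obtain ⟨g, -, hg⟩ := h y hy
    filter_upwards [hg] with z hz
    rw [← hz]
    exact hV _
  · obtain ⟨g, -, hg⟩ := h y hy
    exact ⟨g y, Set.mem_univ _, hg.self_of_nhds⟩
  · obtain ⟨g, hgs, hg⟩ := h y hy
    refine (hgs.congr_of_eventuallyEq ?_).contMDiffWithinAt
    filter_upwards [hg] with z hz
    conv_lhs => rw [← hz]
    exact hl _

open Classical in
/-- The element `id + h` of `Diff₀^s`, for `h` in the open set of the global chart. -/
def Diff0.ofH (h : H0R s) : Diff0 s :=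
  if hh : h ∈ Diff0 s then ⟨h, hh⟩ else ⟨0, fun x => by
    change -1 < dx (⇑(0 : HR s)) x
    rw [← derivR_apply, map_zero, HR.zero_apply]
    norm_num⟩

theorem Diff0.val_ofH {h : H0R s} (hh : h ∈ Diff0 s) : (Diff0.ofH h).1 = h := by
  unfold Diff0.ofH
  rw [dif_pos hh]

theorem Diff0.contMDiffAt_ofH {h : H0R s} (hh : h ∈ Diff0 s) :
    ContMDiffAt 𝓘(ℝ, H0R s) 𝓘(ℝ, H0R s) ∞ Diff0.ofH h := by
  rw [← ContMDiffAt.subtypeVal_comp_iff]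
  refine contMDiffAt_id.congr_of_eventuallyEq ?_
  filter_upwards [(Diff0 s).isOpen.mem_nhds hh] with k hk
  exact Diff0.val_ofH hk

/-- The function `|f|²` as an element of `H^r(S¹; ℝ)`. -/
def absSq {r : ℝ} [Fact (1 / 2 < r)] (f : HC r) : HR r := HC.reH (f * HC.conjH f)

theorem absSq_apply {r : ℝ} [Fact (1 / 2 < r)] (f : HC r) (x : UnitAddCircle) :
    absSq f x = ‖f x‖ ^ 2 := by
  unfold absSq
  rw [HC.reH_apply, HC.mul_apply, HC.conjH_apply, Complex.mul_conj, Complex.normSq_eq_norm_sq,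
    Complex.ofReal_re]

theorem contDiff_absSq {r : ℝ} [Fact (1 / 2 < r)] : ContDiff ℝ ∞ (absSq : HC r → HR r) := by
  have h1 : ContDiff ℂ ∞ fun z : HC r × HC r => HC.mulL z.1 z.2 :=
    ((HC.mulL (r := r)).contDiff.comp contDiff_fst).clm_apply contDiff_snd
  have h2 : ContDiff ℝ ∞ fun f : HC r => (f, HC.conjH f) :=
    contDiff_id.prodMk HC.conjH.contDiff
  exact HC.reH.contDiff.comp ((h1.restrict_scalars ℝ).comp h2)

theorem primR_absSq_mem (f : Sph (s - 1)) (hf : f ∈ setU (s - 1)) :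
    primR (absSq (Sph.incl f)) ∈ Diff0 s := by
  refine mem_Diff0_primR _ (fun x => ?_) ?_
  · rw [absSq_apply]
    have := norm_pos_iff.2 (hf x)
    positivity
  · simp only [absSq_apply]
    exact f.2

/-- The diffeomorphism with derivative `|f|²`. -/
theorem phiX_ofH_primR (f : Sph (s - 1)) (hf : f ∈ setU (s - 1)) (x : UnitAddCircle) :
    phiX (Diff0.ofH (primR (absSq (Sph.incl f)))) x = ‖Sph.incl f x‖ ^ 2 := by
  unfold phiX
  rw [Diff0.val_ofH (primR_absSq_mem f hf), dx_primR]
  simp only [absSq_apply]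
  rw [show ∫ x : UnitAddCircle, ‖Sph.incl f x‖ ^ 2 = 1 from f.2]
  ring

/-- The nowhere vanishing functions form an open set. -/
theorem eventually_mem_setU {r : ℝ} [Fact (1 / 2 < r)] {f₀ : HC r} (h : ∀ x, f₀ x ≠ 0) :
    ∀ᶠ f in 𝓝 f₀, ∀ x, f x ≠ 0 := by
  obtain ⟨x₀, -, hx₀⟩ := isCompact_univ.exists_isMinOn Set.univ_nonempty
    f₀.continuous_coe.norm.continuousOn
  filter_upwards [HC.eventually_norm_sub_lt f₀ (norm_pos_iff.2 (h x₀))] with f hf x hx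
  have h1 := hf x
  rw [hx, zero_sub, norm_neg] at h1
  exact absurd (hx₀ (Set.mem_univ x)) (not_le.2 h1)

/-- Near a nowhere vanishing function `f₀` with phase `α₀`, the inverse of `Φ` is
`f ↦ (∫₀ |f|², α₀ + 2 arg (f / f₀))`. -/
theorem exists_local_inverse_madelung {f₀ : Sph (s - 1)} (hf₀ : f₀ ∈ setU (s - 1)) :
    ∃ g : Sph (s - 1) → G s, ContMDiffAt 𝓘(ℝ, onePerp (s - 1)) (IG s) ∞ g f₀ ∧
      ∀ᶠ f in 𝓝 f₀, madelung (g f) = f := by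
  obtain ⟨α₀, hα₀⟩ := exists_phase_lift (Sph.incl f₀) hf₀
  obtain ⟨w, hw⟩ := HC.exists_inv (Sph.incl f₀) hf₀
  obtain ⟨L, hL, hLa⟩ := HC.exists_smooth_log (r := s - 1)
  set m : HC (s - 1) → HC (s - 1) := fun f => f * w with hm
  have hm0 : m (Sph.incl f₀) = 1 := hw
  have hmc : ContDiff ℝ ∞ m := ((HC.mulL.flip w).restrictScalars ℝ).contDiff
  set k : HC (s - 1) → HR (s - 1) := fun f => (2 : ℝ) • HC.imH (L (m f)) with hk
  have hL1 : L 1 = 0 := by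
    ext x
    rw [hLa.self_of_nhds x, HC.one_apply, Complex.log_one, HC.zero_apply]
  have hk0 : k (Sph.incl f₀) = 0 := by
    simp only [hk]
    rw [hm0, hL1, map_zero, smul_zero]
  have hkc : ContDiffAt ℝ ∞ k (Sph.incl f₀) := by
    have h1 : ContDiffAt ℝ ∞ (fun f => L (m f)) (Sph.incl f₀) :=
      ContDiffAt.comp (g := L) _ (by rw [hm0]; exact hL) hmc.contDiffAt
    exact (HC.imH.contDiff.contDiffAt.comp _ h1).const_smul (2 : ℝ)
  have hincl := (Sph.contMDiff_incl f₀)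
  refine ⟨fun f => (Diff0.ofH (primR (absSq (Sph.incl f))), α₀ + HCirc.proj (k (Sph.incl f))),
    ?_, ?_⟩
  · have h1 : ContMDiffAt 𝓘(ℝ, onePerp (s - 1)) 𝓘(ℝ, H0R s) ∞
        (fun f : Sph (s - 1) => Diff0.ofH (primR (absSq (Sph.incl f)))) f₀ :=
      ContMDiffAt.comp (g := Diff0.ofH) f₀ (Diff0.contMDiffAt_ofH (primR_absSq_mem f₀ hf₀))
        (((primR.contDiff.comp contDiff_absSq).contMDiff.contMDiffAt).comp f₀ hincl)
    have h2 : ContMDiffAt 𝓘(ℝ, onePerp (s - 1)) 𝓘(ℝ, HR (s - 1)) ∞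
        (fun f : Sph (s - 1) => α₀ + HCirc.proj (k (Sph.incl f))) f₀ := by
      refine ContMDiffAt.comp (g := fun k : HR (s - 1) => α₀ + HCirc.proj k)
        (f := fun f : Sph (s - 1) => k (Sph.incl f)) f₀ ?_ (hkc.contMDiffAt.comp f₀ hincl)
      rw [hk0]
      exact HCirc.contMDiffAt_add_proj α₀
    exact h1.prodMk h2
  · have hc : Filter.Tendsto (fun f : Sph (s - 1) => Sph.incl f) (𝓝 f₀) (𝓝 (Sph.incl f₀)) :=
      Sph.continuous_incl.continuousAt
    have h1 : ∀ᶠ f in 𝓝 f₀, ∀ x, Sph.incl f x ≠ 0 := hc.eventually (eventually_mem_setU hf₀)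
    have h2 : ∀ᶠ f in 𝓝 f₀, ∀ x, L (m (Sph.incl f)) x = Complex.log (m (Sph.incl f) x) := by
      refine hc.eventually (p := fun f => ∀ x, L (m f) x = Complex.log (m f x)) ?_
      refine hmc.continuous.continuousAt.eventually
        (p := fun u => ∀ x, L u x = Complex.log (u x)) ?_
      rw [hm0]
      exact hLa
    filter_upwards [h1, h2] with f hf hlog
    apply Sph.incl_injective
    ext x
    rw [incl_madelung, madelungH_apply, phiX_ofH_primR f hf, Real.sqrt_sq (norm_nonneg _)]
    have hwx : Sph.incl f₀ x * w x = 1 := congrArg (fun u : HC (s - 1) => u x) hw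
    have hw0 : w x ≠ 0 := right_ne_zero_of_mul_eq_one hwx
    have hmx : m (Sph.incl f) x = Sph.incl f x * w x := rfl
    have hne : m (Sph.incl f) x ≠ 0 := by rw [hmx]; exact mul_ne_zero (hf x) hw0
    have e1 : phase ((α₀ + HCirc.proj (k (Sph.incl f))) x) =
        phase (α₀ x) * Complex.exp (Complex.I * (m (Sph.incl f) x).arg) := by
      rw [HCirc.add_apply, phase_add, HCirc.proj_apply, phase_coe]
      congr 2
      simp only [hk]
      rw [HR.smul_apply, HC.imH_apply, hlog, Complex.log_im]
      push_cast
      ring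
    -- `f₀ = |f₀| e^{iα₀/2}` and `f w = |f w| e^{i arg (f w)}`, where `f₀ w = 1`
    have e2 := hα₀ x
    have e3 := Complex.norm_mul_exp_arg_mul_I (m (Sph.incl f) x)
    have e4 : (‖m (Sph.incl f) x‖ : ℂ) * ‖Sph.incl f₀ x‖ = ‖Sph.incl f x‖ := by
      rw [← Complex.ofReal_mul, hmx, ← norm_mul, mul_assoc, mul_comm (w x), hwx, mul_one]
    change (‖Sph.incl f x‖ : ℂ) * phase ((α₀ + HCirc.proj (k (Sph.incl f))) x) = _
    rw [e1, ← e4, mul_comm Complex.I]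
    calc _ = (‖m (Sph.incl f) x‖ * Complex.exp ((m (Sph.incl f) x).arg * Complex.I)) *
          (‖Sph.incl f₀ x‖ * phase (α₀ x)) := by ring
      _ = Sph.incl f x := by
        rw [e3, ← e2, hmx, mul_assoc, mul_comm (w x), hwx, mul_one]

instance : Nonempty (G s) := ⟨(Diff0.ofH 0, 0)⟩

theorem isDiffeoOnto_madelung :
    IsDiffeoOnto (IG s) 𝓘(ℝ, onePerp (s - 1)) (madelung : G s → _) (setU (s - 1)) :=
  isDiffeoOnto_of_local_inverse contMDiff_madelung madelung_injective madelung_mem_setU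
    fun _ hf => exists_local_inverse_madelung hf

end inverse

/-! ### The map `Ψ` -/

theorem CP.q_eq_iff {r : ℝ} (f f' : Sph r) :
    CP.q r f = CP.q r f' ↔ ∃ θ : Circ, Sph.incl f' = phase θ • Sph.incl f := by
  rw [eq_comm]
  refine (CP.mk_eq_mk f'.ne_zero f.ne_zero).trans ⟨?_, ?_⟩
  · rintro ⟨c, hc⟩
    have hc1 : ‖c‖ = 1 := by
      have h1 := f'.l2_incl
      rw [← hc, l2_smul_smul, f.l2_incl, mul_one] at h1
      exact (pow_eq_one_iff_of_nonneg (norm_nonneg c) two_ne_zero).1 h1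
    obtain ⟨θ, rfl⟩ := exists_phase_eq hc1
    exact ⟨θ, hc.symm⟩
  · rintro ⟨θ, hθ⟩
    exact ⟨phase θ, hθ.symm⟩

theorem CP.q_normalize {r : ℝ} [Fact (1 / 2 < r)] {g : HC r} (hg : g ≠ 0) :
    CP.q r (Sph.normalize g) = CP.proj g := by
  have hN : 0 < l2 g g :=
    lt_of_le_of_ne (HC.l2_self_nonneg _) fun h => hg (HC.eq_zero_of_l2_self h.symm)
  have hc : (((Real.sqrt (l2 g g))⁻¹ : ℝ) : ℂ) ≠ 0 := by
    exact_mod_cast (inv_pos.2 (Real.sqrt_pos.2 hN)).ne'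
  rw [← CP.proj_incl, Sph.incl_normalize hg]
  exact CP.proj_smul hc

section projective
variable {s : ℝ} [hs : Fact (5 / 2 < s)]

/-- The map `Ψ(φ, [α]) = [√φ_x e^{iα/2}]`. -/
def madelungProj (k : K s) : CP (s - 1) :=
  CP.q (s - 1) (madelung (Function.surjInv p_surjective k))

theorem madelungProj_p (g : G s) : madelungProj (p s g) = CP.q (s - 1) (madelung g) := by
  have h := Function.surjInv_eq p_surjective (p s g)
  obtain ⟨θ, hθ⟩ := (p_eq_iff _ _).1 h
  refine (CP.q_eq_iff _ _).2 ⟨θ, ?_⟩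
  rw [incl_madelung, incl_madelung]
  exact (congrArg madelungH hθ).trans (madelungH_add_const _ _ _)

theorem madelungProj_eq_proj (g : G s) : madelungProj (p s g) = CP.proj (madelungH g) := by
  rw [madelungProj_p, ← CP.proj_incl, incl_madelung]

theorem contMDiff_madelungProj :
    ContMDiff (IK s) 𝓘(ℝ, H0C (s - 1)) ∞ (madelungProj : K s → _) := by
  intro k
  obtain ⟨g, rfl⟩ := p_surjective k
  obtain ⟨σ, hσ, hσg, hσp⟩ := exists_section_p g
  have h1 : ContMDiffAt (IK s) 𝓘(ℝ, H0C (s - 1)) ∞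
      (fun k => CP.q (s - 1) (madelung (σ k))) (p s g) :=
    ((CP.contMDiff_q.comp contMDiff_madelung).contMDiffAt).comp (p s g) hσ
  refine h1.congr_of_eventuallyEq ?_
  filter_upwards [hσp] with k hk
  conv_lhs => rw [← hk]
  exact madelungProj_p _

theorem madelungProj_injective : Function.Injective (madelungProj : K s → _) := by
  intro k k' h
  obtain ⟨g, rfl⟩ := p_surjective k
  obtain ⟨g', rfl⟩ := p_surjective k'
  rw [madelungProj_p, madelungProj_p, CP.q_eq_iff] at h
  obtain ⟨θ, hθ⟩ := h
  rw [incl_madelung (g := g), ← madelungH_add_const, ← incl_madelung] at hθ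
  exact (p_eq_iff g g').2 ⟨θ, madelung_injective (Sph.incl_injective hθ)⟩

/-- Near `[f₀]` the inverse of `Ψ` is the composition of a local section `[f] ↦ f`, the
normalization, the local inverse of `Φ` and `p`. -/
theorem exists_local_inverse_madelungProj {P₀ : CP (s - 1)} (hP₀ : P₀ ∈ setV (s - 1)) :
    ∃ k : CP (s - 1) → K s, ContMDiffAt 𝓘(ℝ, H0C (s - 1)) (IK s) ∞ k P₀ ∧
      ∀ᶠ P in 𝓝 P₀, madelungProj (k P) = P := by
  obtain ⟨f₀, hf₀, rfl⟩ := hP₀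
  obtain ⟨g, hg, hgf⟩ := exists_local_inverse_madelung hf₀
  obtain ⟨S, hS, hSf, hSP, -⟩ := CP.exists_section (hf₀ 0)
  rw [CP.proj_incl] at hS hSf hSP
  have h1 : ContMDiffAt 𝓘(ℝ, H0C (s - 1)) 𝓘(ℝ, onePerp (s - 1)) ∞
      (fun P => Sph.normalize (S P)) (CP.q (s - 1) f₀) := by
    refine ContMDiffAt.comp (g := Sph.normalize) _ ?_ hS
    rw [hSf]
    exact Sph.contMDiffAt_normalize f₀.ne_zero
  have h2 : Sph.normalize (S (CP.q (s - 1) f₀)) = f₀ := by rw [hSf, Sph.normalize_incl]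
  refine ⟨fun P => p s (g (Sph.normalize (S P))), ?_, ?_⟩
  · refine ContMDiffAt.comp (g := fun f => p s (g f)) (f := fun P => Sph.normalize (S P)) _ ?_ h1
    rw [h2]
    exact contMDiff_p.contMDiffAt.comp f₀ hg
  · have h3 : Filter.Tendsto (fun P => Sph.normalize (S P)) (𝓝 (CP.q (s - 1) f₀)) (𝓝 f₀) := by
      have := h1.continuousAt
      rwa [ContinuousAt, h2] at this
    filter_upwards [h3.eventually hgf, hSP] with P hP hP'
    rw [madelungProj_p, hP, CP.q_normalize hP'.1, hP'.2]

theorem madelungProj_mem_setV (k : K s) : madelungProj k ∈ setV (s - 1) :=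
  ⟨_, madelung_mem_setU _, rfl⟩

theorem isDiffeoOnto_madelungProj :
    IsDiffeoOnto (IK s) 𝓘(ℝ, H0C (s - 1)) (madelungProj : K s → _) (setV (s - 1)) :=
  haveI : Nonempty (K s) := ⟨p s (Classical.arbitrary (G s))⟩
  isDiffeoOnto_of_local_inverse contMDiff_madelungProj madelungProj_injective
    madelungProj_mem_setV fun _ hP => exists_local_inverse_madelungProj hP

theorem mfderiv_madelungProj (g : G s) (U : H0R s × HR (s - 1)) :
    (mfderiv (IK s) 𝓘(ℝ, H0C (s - 1)) (madelungProj : K s → _) (p s g) :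
      H0R s × HRmod (s - 1) →L[ℝ] H0C (s - 1)) (U.1, Submodule.Quotient.mk U.2) =
      CP.projD (madelungH g) (madelungD g U) := by
  have h1 : HasMFDerivAt (IK s) 𝓘(ℝ, H0C (s - 1)) (madelungProj : K s → _) (p s g) _ :=
    (contMDiff_madelungProj.contMDiffAt.mdifferentiableAt (by simp)).hasMFDerivAt
  have h2 : HasMFDerivAt (IG s) (IK s) (p s) g _ :=
    (contMDiff_p.contMDiffAt.mdifferentiableAt (by simp)).hasMFDerivAt
  have h3 := h1.comp g h2
  have h4 := (CP.hasMFDerivAt_proj (madelung g).ne_zero).comp g (hasMFDerivAt_madelungH g)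
  have h5 : (madelungProj : K s → _) ∘ p s = CP.proj ∘ madelungH := funext madelungProj_eq_proj
  rw [h5] at h3
  have h6 := congrArg (fun T : H0R s × HR (s - 1) →L[ℝ] H0C (s - 1) => T U)
    (hasMFDerivAt_unique h3 h4)
  rw [← mfderiv_p g U]
  exact h6

/-- The real part of the pairing of `TΦ(U)` with `Φ` is `½ ∫ U₁ₓ = 0`. -/
theorem herm_madelungD (g : G s) (U : H0R s × HR (s - 1)) :
    herm (madelungD g U) (madelungH g) =
      (1 / 2 : ℝ) * (Complex.I * (∫ x, U.2 x * phiX g.1 x : ℝ)) := by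
  have h1 : ∀ x, madelungD g U x * starRingEnd ℂ (madelungH g x) =
      ((1 / 2 * dx (U.1 : HR s) x : ℝ) : ℂ) +
        Complex.I * ((1 / 2 * (U.2 x * phiX g.1 x) : ℝ) : ℂ) := by
    intro x
    have h2 := Complex.mul_conj (madelungH g x)
    rw [Complex.normSq_eq_norm_sq, norm_sq_madelungH] at h2
    have hp : (phiX g.1 x : ℂ) ≠ 0 := by exact_mod_cast (phiX_pos g.1 x).ne'
    rw [madelungD_apply]
    push_cast
    calc _ = (madelungH g x * starRingEnd ℂ (madelungH g x)) * (1 / 2 *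
          ((dx (U.1 : HR s) x : ℂ) / phiX g.1 x + Complex.I * U.2 x)) := by ring
      _ = _ := by rw [h2]; field_simp
  have hi1 : Continuous fun x => 1 / 2 * dx (U.1 : HR s) x :=
    continuous_const.mul (HR.continuous_dx _)
  have hi2 : Continuous fun x => 1 / 2 * (U.2 x * phiX g.1 x) :=
    continuous_const.mul (U.2.continuous_coe.mul (continuous_phiX g.1))
  have i1 : MeasureTheory.Integrable fun x => ((1 / 2 * dx (U.1 : HR s) x : ℝ) : ℂ) :=
    (integrable_of_continuous hi1).ofReal
  have i2 : MeasureTheory.Integrable fun x =>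
      Complex.I * ((1 / 2 * (U.2 x * phiX g.1 x) : ℝ) : ℂ) :=
    (integrable_of_continuous hi2).ofReal.const_mul Complex.I
  unfold herm
  simp only [h1]
  rw [MeasureTheory.integral_add i1 i2,
    MeasureTheory.integral_const_mul, integral_complex_ofReal, integral_complex_ofReal,
    MeasureTheory.integral_const_mul, MeasureTheory.integral_const_mul, integral_dx]
  push_cast
  ring

/-- The horizontal component of `T Φ (U₁, U₂)` is `T Φ (U₁, π(U₂))`. -/
theorem horC_madelungD (g : G s) (U : H0R s × HR (s - 1)) :
    horC (madelungH g) (madelungD g U) =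
      madelungD g (U.1, U.2 - HR.const (∫ x, U.2 x * phiX g.1 x)) := by
  ext x
  unfold horC
  rw [HC.sub_apply, HC.smul_apply, herm_madelungD, madelungD_apply, madelungD_apply,
    HR.sub_apply, HR.const_apply]
  push_cast
  ring

/-- The metric of `K^s` is that of `G^s` on the representatives with `∫ U₂ φ_x = 0`. -/
theorem metricK_mk (g : G s) (U V : H0R s × HR (s - 1)) :
    metricK (p s g) ((U.1, Submodule.Quotient.mk U.2) : H0R s × HRmod (s - 1))
        ((V.1, Submodule.Quotient.mk V.2) : H0R s × HRmod (s - 1)) =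
      metricG g ((U.1, U.2 - HR.const (∫ x, U.2 x * phiX g.1 x)) : H0R s × HR (s - 1))
        ((V.1, V.2 - HR.const (∫ x, V.2 x * phiX g.1 x)) : H0R s × HR (s - 1)) := by
  unfold metricK metricG
  congr 2

theorem preservesMetric_madelungProj :
    PreservesMetric (IK s) 𝓘(ℝ, H0C (s - 1)) metricK fubiniStudy (madelungProj : K s → _) := by
  intro k
  obtain ⟨g, rfl⟩ := p_surjective k
  have hg : l2 (madelungH g) (madelungH g) = 1 := (madelung g).l2_incl
  have key : ∀ (P : CP (s - 1)) (_ : P = CP.proj (madelungH g)) (Y Z : HC (s - 1)),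
      fubiniStudy P (CP.projD (madelungH g) Y) (CP.projD (madelungH g) Z) =
        l2 (horC (madelungH g) Y) (horC (madelungH g) Z) := by
    rintro P rfl Y Z
    exact fubiniStudy_proj hg Y Z
  have main : ∀ U V : H0R s × HR (s - 1),
      fubiniStudy (madelungProj (p s g))
        ((mfderiv (IK s) 𝓘(ℝ, H0C (s - 1)) (madelungProj : K s → _) (p s g) :
          H0R s × HRmod (s - 1) →L[ℝ] H0C (s - 1)) (U.1, Submodule.Quotient.mk U.2))
        ((mfderiv (IK s) 𝓘(ℝ, H0C (s - 1)) (madelungProj : K s → _) (p s g) :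
          H0R s × HRmod (s - 1) →L[ℝ] H0C (s - 1)) (V.1, Submodule.Quotient.mk V.2)) =
      metricK (p s g) ((U.1, Submodule.Quotient.mk U.2) : H0R s × HRmod (s - 1))
        ((V.1, Submodule.Quotient.mk V.2) : H0R s × HRmod (s - 1)) := by
    intro U V
    rw [mfderiv_madelungProj, mfderiv_madelungProj, key _ (madelungProj_eq_proj g),
      horC_madelungD, horC_madelungD, metricK_mk, l2_madelungD]
  rintro ⟨U₁, u⟩ ⟨V₁, v⟩
  obtain ⟨U₂, rfl⟩ := Submodule.Quotient.mk_surjective _ u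
  obtain ⟨V₂, rfl⟩ := Submodule.Quotient.mk_surjective _ v
  exact main (U₁, U₂) (V₁, V₂)

/-- The vectors orthogonal to the fibre of `p` are those with `∫ U₂ φ_x = 0`. -/
theorem mem_horizontal_p (g : G s) (U : H0R s × HR (s - 1)) :
    U ∈ horizontal (IG s) (IK s) metricG (p s) g ↔ ∫ x, U.2 x * phiX g.1 x = 0 := by
  have hm : ∀ c : ℝ, metricG g U ((0, HR.const c) : H0R s × HR (s - 1)) =
      1 / 4 * (c * ∫ x, U.2 x * phiX g.1 x) := by
    intro c
    unfold metricG
    rw [← MeasureTheory.integral_const_mul c]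
    refine congrArg (fun F : UnitAddCircle → ℝ => 1 / 4 * ∫ x, F x) (funext fun x => ?_)
    have h0 : dx (⇑((0 : H0R s) : HR s)) x = 0 := by
      rw [← derivR_apply, Submodule.coe_zero, map_zero, HR.zero_apply]
    simp only [h0, HR.const_apply]
    ring
  constructor
  · intro h
    have h1 := h ((0, HR.const 1) : H0R s × HR (s - 1)) (by
      refine (mfderiv_p g (0, HR.const 1)).trans (Prod.ext rfl ?_)
      exact (Submodule.Quotient.mk_eq_zero _).2 (mem_constR.2 ⟨1, fun x => rfl⟩))
    have h2 := (hm 1).symm.trans h1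
    linarith
  · rintro h ⟨w₁, w₂⟩ hw
    have h1 := (mfderiv_p g (w₁, w₂)).symm.trans hw
    have h2 : w₁ = 0 := congrArg Prod.fst h1
    obtain ⟨c, hc⟩ := mem_constR.1 ((Submodule.Quotient.mk_eq_zero _).1 (congrArg Prod.snd h1))
    have h3 : w₂ = HR.const c := HR.ext fun x => hc x
    subst h2 h3
    exact (hm c).trans (by rw [h]; ring)

theorem integral_sub_const (φ : Diff0 s) (U : HR (s - 1)) (c : ℝ) :
    ∫ x, (U - HR.const c : HR (s - 1)) x * phiX φ x = (∫ x, U x * phiX φ x) - c := by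
  have hi1 : MeasureTheory.Integrable fun x => U x * phiX φ x :=
    integrable_of_continuous (U.continuous_coe.mul (continuous_phiX φ))
  have hi2 : MeasureTheory.Integrable fun x => c * phiX φ x :=
    integrable_of_continuous (continuous_const.mul (continuous_phiX φ))
  simp only [HR.sub_apply, HR.const_apply, sub_mul]
  rw [MeasureTheory.integral_sub hi1 hi2, MeasureTheory.integral_const_mul, integral_phiX, mul_one]

theorem isRiemannianSubmersion_p :
    IsRiemannianSubmersion (IG s) (IK s) metricG metricK (p s) where
  submersion := isSubmersion_p
  bijOn g := by
    refine ⟨fun _ _ => Set.mem_univ _, ?_, ?_⟩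
    · rintro ⟨U₁, U₂⟩ hU ⟨V₁, V₂⟩ hV e
      have e1 := (mfderiv_p g (U₁, U₂)).symm.trans (e.trans (mfderiv_p g (V₁, V₂)))
      obtain ⟨c, hc⟩ := mem_constR.1 ((Submodule.Quotient.eq _).1 (congrArg Prod.snd e1))
      have h3 : V₂ = U₂ - HR.const c := HR.ext fun x => by
        have := hc x
        rw [HR.sub_apply] at this
        rw [HR.sub_apply, HR.const_apply]; linarith
      have h4 := (mem_horizontal_p g (U₁, U₂)).1 hU
      have h5 := (mem_horizontal_p g (V₁, V₂)).1 hV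
      have h6 := integral_sub_const g.1 U₂ c
      rw [← h3] at h6
      have h7 : c = 0 := by
        have h8 : (0 : ℝ) = 0 - c := h5.symm.trans (h6.trans (congrArg (· - c) h4))
        linarith
      refine Prod.ext (show U₁ = V₁ from congrArg Prod.fst e1) ?_
      change U₂ = V₂
      rw [h3, h7]
      ext x
      simp
    · rintro ⟨U₁, u⟩ -
      obtain ⟨U₂, rfl⟩ := Submodule.Quotient.mk_surjective _ u
      refine ⟨((U₁, U₂ - HR.const (∫ x, U₂ x * phiX g.1 x)) : H0R s × HR (s - 1)), ?_, ?_⟩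
      · refine (mem_horizontal_p g _).2 ?_
        exact (integral_sub_const g.1 U₂ _).trans (sub_self _)
      · refine (mfderiv_p g _).trans (Prod.ext rfl ?_)
        refine (Submodule.Quotient.eq _).2 (mem_constR.2
          ⟨-∫ x, U₂ x * phiX g.1 x, fun x => ?_⟩)
        simp
  isometry g := by
    have main : ∀ U V : H0R s × HR (s - 1), ∫ x, U.2 x * phiX g.1 x = 0 →
        ∫ x, V.2 x * phiX g.1 x = 0 →
        metricK (p s g) ((U.1, Submodule.Quotient.mk U.2) : H0R s × HRmod (s - 1))
        ((V.1, Submodule.Quotient.mk V.2) : H0R s × HRmod (s - 1)) = metricG g U V := by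
      intro U V hU hV
      have h0 : ∀ W : HR (s - 1), W - HR.const 0 = W := fun W => by ext x; simp
      rw [metricK_mk, hU, hV, h0, h0]
    intro U hU V hV
    have h := main U V ((mem_horizontal_p g U).1 hU) ((mem_horizontal_p g V).1 hV)
    rw [← mfderiv_p g U, ← mfderiv_p g V] at h
    exact h

end projective

/-! ### The submersion `q` -/

section submersion_q
variable {r : ℝ} [Fact (1 / 2 < r)]

namespace CP

/-- The splitting `f ↦ (f - f(0), Im f(0))` of the tangent space `1^⊥` of the sphere. -/
def splitPerp (r : ℝ) [Fact (1 / 2 < r)] : onePerp r ≃L[ℝ] H0C r × ℝ :=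
  let constL : ℂ →L[ℝ] HC r :=
    ((ContinuousLinearMap.id ℂ ℂ).smulRight (HC.const 1 : HC r)).restrictScalars ℝ
  let A : H0C r × ℝ →L[ℝ] HC r :=
    (H0C r).subtypeL.comp (ContinuousLinearMap.fst ℝ (H0C r) ℝ) +
      constL.comp ((Complex.I • Complex.ofRealCLM).comp (ContinuousLinearMap.snd ℝ (H0C r) ℝ))
  have hA : ∀ z x, A z x = (z.1 : HC r) x + Complex.I * z.2 := fun z x => by
    simp [A, constL]
  have hperp : ∀ z, (Sph.perp (A z) : HC r) = A z - Sph.ht (A z) • HC.const 1 := fun _ => rfl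
  ContinuousLinearEquiv.equivOfInverse
    ((sub0.comp (onePerp r).subtypeL).prod
      (Complex.imCLM.comp (((HC.evalL (r := r) 0).restrictScalars ℝ).comp (onePerp r).subtypeL)))
    (Sph.perp.comp A)
    (fun f => by
      apply Subtype.ext
      set z : H0C r × ℝ := (sub0 (f : HC r), ((f : HC r) 0).im) with hz
      change (Sph.perp (A z) : HC r) = f
      have h1 : A z = (f : HC r) + (-((f : HC r) 0).re) • HC.const 1 := by
        ext x
        rw [hA, hz, sub0_coe]
        simp only [HC.sub_apply, HC.add_apply, HC.real_smul_apply, HC.const_apply]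
        push_cast
        linear_combination Complex.re_add_im ((f : HC r) 0)
      rw [hperp, h1, map_add, map_smul, Sph.ht_perp, Sph.ht_one]
      ext x
      simp)
    (fun z => by
      have h1 : ∀ x, (Sph.perp (A z) : HC r) x =
          (z.1 : HC r) x + Complex.I * z.2 - (Sph.ht (A z) : ℝ) := fun x => by
        rw [hperp, HC.sub_apply, hA, HC.real_smul_apply, HC.const_apply, mul_one]
      have h2 := h1 0
      rw [coe_zero, zero_add] at h2
      refine Prod.ext (Subtype.ext (HC.ext fun x => ?_)) ?_
      · change (sub0 (Sph.perp (A z) : HC r) : HC r) x = (z.1 : HC r) x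
        rw [sub0_coe, HC.sub_apply, HC.const_apply, h1, h2]
        ring
      · change ((Sph.perp (A z) : HC r) 0).im = z.2
        rw [h2]
        simp)

theorem hom_self (a : UnitAddCircle) (g : H0C r) : hom a g a = 1 := by
  rw [hom_apply, sub_self, coe_zero, add_zero]

theorem dehom_hom (a : UnitAddCircle) (g : H0C r) : dehom a (hom a g) = g := by
  apply Subtype.ext
  ext x
  rw [dehom_apply _ _ (by rw [hom_self]; exact one_ne_zero), hom_self, hom_apply]
  simp

/-- The ratio `Im / Re` of a complex number, a coordinate on the rays of the right half plane. -/
def slope (z : ℂ) : ℝ := z.im / z.re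

theorem slope_smul {c : ℝ} (hc : c ≠ 0) (z : ℂ) : slope (c * z) = slope z := by
  unfold slope
  rw [Complex.im_ofReal_mul, Complex.re_ofReal_mul, mul_div_mul_left _ _ hc]

theorem one_add_slope (z : ℂ) (hz : 0 < z.re) :
    (1 + Complex.I * slope z : ℂ) = ((z.re)⁻¹ : ℝ) * z := by
  unfold slope
  apply Complex.ext <;> simp <;> field_simp

theorem one_add_ne (t : ℝ) : (1 + Complex.I * t : ℂ) ≠ 0 := fun h => by
  have := congrArg Complex.re h
  simp at this

/-- The inverse of the adapted chart up to a positive factor: the function `(1 + it) c₀ f` with `f`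
the representative with `f(a) = 1` of the class with coordinate `z.1` in the chart at `a`, and
`t = z.2`. -/
def adaptedInv (a : UnitAddCircle) (c₀ : ℂ) (z : H0C r × ℝ) : HC r :=
  ((1 + Complex.I * z.2) * c₀) • hom a z.1

theorem adaptedInv_ne (a : UnitAddCircle) {c₀ : ℂ} (hc₀ : c₀ ≠ 0) (z : H0C r × ℝ) :
    adaptedInv a c₀ z ≠ 0 :=
  smul_ne_zero (mul_ne_zero (one_add_ne _) hc₀) (hom_ne a _)

theorem contDiff_adaptedInv (a : UnitAddCircle) (c₀ : ℂ) :
    ContDiff ℝ ∞ (adaptedInv a c₀ : H0C r × ℝ → HC r) := by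
  have h1 : ContDiff ℝ ∞ fun z : H0C r × ℝ => (1 + Complex.I * (z.2 : ℂ)) * c₀ :=
    (contDiff_const.add (contDiff_const.mul
      (Complex.ofRealCLM.contDiff.comp contDiff_snd))).mul contDiff_const
  exact h1.smul ((contDiff_hom a).comp contDiff_fst)

theorem exists_normalize_eq {g : HC r} (hg : g ≠ 0) :
    ∃ c : ℝ, 0 < c ∧ Sph.incl (Sph.normalize g) = (c : ℂ) • g := by
  have hN : 0 < l2 g g :=
    lt_of_le_of_ne (HC.l2_self_nonneg _) fun h => hg (HC.eq_zero_of_l2_self h.symm)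
  exact ⟨_, inv_pos.2 (Real.sqrt_pos.2 hN), Sph.incl_normalize hg⟩

theorem normalize_smul {c : ℝ} (hc : 0 < c) {g : HC r} (hg : g ≠ 0) :
    Sph.normalize ((c : ℂ) • g) = Sph.normalize g := by
  have hcg : (c : ℂ) • g ≠ 0 := smul_ne_zero (by exact_mod_cast hc.ne') hg
  apply Sph.incl_injective
  rw [Sph.incl_normalize hcg, Sph.incl_normalize hg, l2_smul_smul, Complex.norm_real,
    Real.norm_of_nonneg hc.le, Real.sqrt_mul (by positivity), Real.sqrt_sq hc.le]
  ext x
  simp only [HC.real_smul_apply, HC.smul_apply]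
  have : (c : ℂ) ≠ 0 := by exact_mod_cast hc.ne'
  push_cast
  field_simp

theorem contMDiffOn_adaptedFun (a : UnitAddCircle) (c₀ : ℂ) :
    ContMDiffOn 𝓘(ℝ, onePerp r) 𝓘(ℝ, onePerp r) ∞
      (fun f : Sph r => (splitPerp r).symm (dehom a (Sph.incl f), slope (Sph.incl f a / c₀)))
      {f | 0 < (Sph.incl f a / c₀).re} := by
  intro f hf
  have hf' : 0 < (Sph.incl f a / c₀).re := hf
  have ha : Sph.incl f a ≠ 0 := fun h => by rw [h] at hf'; simp at hf'
  have h1 : ContDiff ℝ ∞ fun k : HC r => k a / c₀ :=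
    (((HC.evalL (r := r) a).restrictScalars ℝ).contDiff).div_const c₀
  have h2 : ContDiffAt ℝ ∞ (fun k : HC r => slope (k a / c₀)) (Sph.incl f) :=
    ContDiffAt.div (Complex.imCLM.contDiff.comp h1).contDiffAt
      (Complex.reCLM.contDiff.comp h1).contDiffAt hf'.ne'
  have h3 : ContDiffAt ℝ ∞
      (fun k : HC r => (splitPerp r).symm (dehom a k, slope (k a / c₀))) (Sph.incl f) :=
    (splitPerp r).symm.contDiff.contDiffAt.comp (Sph.incl f) ((contDiffAt_dehom a _ ha).prodMk h2)
  exact (h3.contMDiffAt.comp f (Sph.contMDiff_incl f)).contMDiffWithinAt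

theorem contMDiff_adaptedInv (a : UnitAddCircle) {c₀ : ℂ} (hc₀ : c₀ ≠ 0) :
    ContMDiff 𝓘(ℝ, onePerp r) 𝓘(ℝ, onePerp r) ∞
      (fun h : onePerp r => Sph.normalize (adaptedInv a c₀ (splitPerp r h))) := fun h =>
  ContMDiffAt.comp (g := Sph.normalize) (f := fun h : onePerp r => adaptedInv a c₀ (splitPerp r h))
    h (Sph.contMDiffAt_normalize (adaptedInv_ne a hc₀ _))
    ((contDiff_adaptedInv a c₀).comp (splitPerp r).contDiff).contMDiff.contMDiffAt

/-- A chart of the sphere adapted to `q`: near a function with value `c₀ ≠ 0` at `a`, a function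
`f` is determined by its class and by the argument of `f(a) / c₀`.
The latter enters through its tangent `slope`, and the splitting `splitPerp` identifies the target
with the model space of the sphere. -/
def adaptedChart (a : UnitAddCircle) {c₀ : ℂ} (hc₀ : c₀ ≠ 0) :
    OpenPartialHomeomorph (Sph r) (onePerp r) where
  toFun f := (splitPerp r).symm (dehom a (Sph.incl f), slope (Sph.incl f a / c₀))
  invFun h := Sph.normalize (adaptedInv a c₀ (splitPerp r h))
  source := {f | 0 < (Sph.incl f a / c₀).re}
  target := Set.univ
  map_source' _ _ := Set.mem_univ _
  map_target' h _ := by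
    obtain ⟨c, hc, e⟩ := exists_normalize_eq (adaptedInv_ne a hc₀ (splitPerp r h))
    change 0 < (Sph.incl (Sph.normalize _) a / c₀).re
    rw [e, HC.smul_apply, adaptedInv, HC.smul_apply, hom_self, mul_one, ← mul_assoc,
      mul_div_cancel_right₀ _ hc₀, Complex.re_ofReal_mul]
    simpa using hc
  left_inv' f (hf : 0 < (Sph.incl f a / c₀).re) := by
    have ha : Sph.incl f a ≠ 0 := fun h => by rw [h] at hf; simp at hf
    have e : adaptedInv a c₀ (dehom a (Sph.incl f), slope (Sph.incl f a / c₀)) =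
        ((((Sph.incl f a / c₀).re)⁻¹ : ℝ) : ℂ) • Sph.incl f := by
      unfold adaptedInv
      rw [one_add_slope _ hf, hom_dehom a _ ha, smul_smul, mul_assoc _ _ c₀,
        div_mul_cancel₀ _ hc₀, mul_assoc, mul_inv_cancel₀ ha, mul_one]
    rw [ContinuousLinearEquiv.apply_symm_apply, e, normalize_smul (inv_pos.2 hf) f.ne_zero,
      Sph.normalize_incl]
  right_inv' h _ := by
    obtain ⟨c, hc, e⟩ := exists_normalize_eq (adaptedInv_ne a hc₀ (splitPerp r h))
    have hc' : (c : ℂ) ≠ 0 := by exact_mod_cast hc.ne'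
    have e1 : dehom a (Sph.incl (Sph.normalize (adaptedInv a c₀ (splitPerp r h)))) =
        (splitPerp r h).1 := by
      rw [e, dehom_smul _ _ _ hc']
      exact (dehom_smul _ _ _ (mul_ne_zero (one_add_ne _) hc₀)).trans (dehom_hom a _)
    have e2 : slope (Sph.incl (Sph.normalize (adaptedInv a c₀ (splitPerp r h))) a / c₀) =
        (splitPerp r h).2 := by
      rw [e, HC.smul_apply, adaptedInv, HC.smul_apply, hom_self, mul_one, ← mul_assoc,
        mul_div_cancel_right₀ _ hc₀, slope_smul hc.ne']
      simp [slope]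
    rw [e1, e2]
    exact (splitPerp r).symm_apply_apply h
  open_source := by
    have h1 : Continuous fun f : Sph r => (Sph.incl f a / c₀).re :=
      Complex.continuous_re.comp (((HC.evalL (r := r) a).continuous.comp
        Sph.continuous_incl).div_const c₀)
    exact isOpen_lt continuous_const h1
  open_target := isOpen_univ
  continuousOn_toFun := (contMDiffOn_adaptedFun a c₀).continuousOn
  continuousOn_invFun := (contMDiff_adaptedInv a hc₀).continuous.continuousOn

theorem adaptedChart_mem_maximalAtlas (a : UnitAddCircle) {c₀ : ℂ} (hc₀ : c₀ ≠ 0) :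
    (adaptedChart a hc₀ : OpenPartialHomeomorph (Sph r) (onePerp r)) ∈
      IsManifold.maximalAtlas 𝓘(ℝ, onePerp r) ∞ (Sph r) :=
  OpenPartialHomeomorph.mem_maximalAtlas_of_contMDiffOn _ (contMDiffOn_adaptedFun a c₀)
    (contMDiff_adaptedInv a hc₀).contMDiffOn

/-- In the adapted charts `q` is the projection `H0C r × ℝ → H0C r`. -/
theorem isSubmersion_q : Manifold.IsSubmersion 𝓘(ℝ, onePerp r) 𝓘(ℝ, H0C r) ∞ (q r) := by
  refine ⟨ℝ, inferInstance, inferInstance, fun f => ?_⟩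
  obtain ⟨a, ha⟩ := exists_apply_ne f.ne_zero
  refine Manifold.IsSubmersionAtOfComplement.mk_of_continuousAt contMDiff_q.continuous.continuousAt
    (splitPerp r) (adaptedChart a ha) (chartH a) ?_ ?_ (adaptedChart_mem_maximalAtlas a ha)
    (chartH_mem_maximalAtlas a) ?_
  · change 0 < (Sph.incl f a / Sph.incl f a).re
    rw [div_self ha]
    exact zero_lt_one
  · rw [← proj_incl]
    exact proj_mem_source ha
  · rintro h -
    obtain ⟨c, hc, e⟩ := exists_normalize_eq (adaptedInv_ne a ha (splitPerp r h))
    have hc' : (c : ℂ) ≠ 0 := by exact_mod_cast hc.ne'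
    change chart a (q r (Sph.normalize (adaptedInv a _ (splitPerp r h)))) = (splitPerp r h).1
    rw [← proj_incl, chart_proj (Sph.ne_zero _), e, dehom_smul _ _ _ hc']
    exact (dehom_smul _ _ _ (mul_ne_zero (one_add_ne _) ha)).trans (dehom_hom a _)

theorem projD_horC {g : HC r} (hg : g ≠ 0) (Y : HC r) : projD g (horC g Y) = projD g Y := by
  rw [horC, map_sub, sub_eq_self]
  exact (projD_eq_zero_iff hg _).2 ⟨_, rfl⟩

/-- The vertical vectors of `q` at `f` are the real multiples of `if`. -/
theorem projD_inclD_eq_zero_iff (f : Sph r) (X : onePerp r) :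
    projD (Sph.incl f) (Sph.inclD f X) = 0 ↔
      ∃ t : ℝ, Sph.inclD f X = (Complex.I * t) • Sph.incl f := by
  rw [projD_eq_zero_iff f.ne_zero]
  refine ⟨?_, fun ⟨t, ht⟩ => ⟨_, ht⟩⟩
  rintro ⟨c, hc⟩
  have h1 : c.re = 0 := by
    have h2 := Sph.l2_inclD f X
    rwa [hc, ← herm_re, herm_smul_left, herm_self, f.l2_incl, Complex.ofReal_one, mul_one] at h2
  refine ⟨c.im, ?_⟩
  rw [hc]
  congr 1
  apply Complex.ext <;> simp [h1]

/-- The vectors orthogonal to the fibre of `q` are those hermitian orthogonal to `f`. -/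
theorem mem_horizontal_q (f : Sph r) (X : onePerp r) :
    X ∈ horizontal 𝓘(ℝ, onePerp r) 𝓘(ℝ, H0C r) metricSph (q r) f ↔
      herm (Sph.inclD f X) (Sph.incl f) = 0 := by
  have hl : ∀ t : ℝ, l2 (Sph.inclD f X) ⇑((Complex.I * t) • Sph.incl f) =
      t * (herm (Sph.inclD f X) (Sph.incl f)).im := fun t => by
    rw [← herm_re, herm_smul_right]
    simp
  constructor
  · intro h
    obtain ⟨w, hw⟩ := Sph.exists_inclD_eq f (X := (Complex.I * (1 : ℝ)) • Sph.incl f) (by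
      rw [← herm_re, herm_smul_left, herm_self, f.l2_incl]
      simp)
    have h1 : l2 (Sph.inclD f X) (Sph.inclD f w) = 0 := h w ((mfderiv_q f w).trans
      ((projD_inclD_eq_zero_iff f w).2 ⟨1, hw⟩))
    rw [hw, hl, one_mul] at h1
    exact Complex.ext (Sph.l2_inclD f X) h1
  · intro h w hw
    obtain ⟨t, ht⟩ := (projD_inclD_eq_zero_iff f w).1 ((mfderiv_q f w).symm.trans hw)
    change l2 (Sph.inclD f X) (Sph.inclD f w) = 0
    rw [ht, hl, h, Complex.zero_im, mul_zero]

theorem isRiemannianSubmersion_q :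
    IsRiemannianSubmersion 𝓘(ℝ, onePerp r) 𝓘(ℝ, H0C r) metricSph fubiniStudy (q r) where
  submersion := isSubmersion_q
  bijOn f := by
    have hf : herm (Sph.incl f) (Sph.incl f) = 1 := by rw [herm_self, f.l2_incl]; simp
    refine ⟨fun _ _ => Set.mem_univ _, ?_, ?_⟩
    · intro X hX Y hY e
      have e1 : projD (Sph.incl f) (Sph.inclD f X) = projD (Sph.incl f) (Sph.inclD f Y) :=
        (mfderiv_q f X).symm.trans (e.trans (mfderiv_q f Y))
      rw [← sub_eq_zero, ← map_sub, projD_eq_zero_iff f.ne_zero] at e1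
      obtain ⟨c, hc⟩ := e1
      have h1 : herm ⇑(Sph.inclD f X - Sph.inclD f Y) (Sph.incl f) = 0 := by
        rw [herm_sub_left, (mem_horizontal_q f X).1 hX, (mem_horizontal_q f Y).1 hY, sub_zero]
      rw [hc, herm_smul_left, hf, mul_one] at h1
      rw [h1, zero_smul, sub_eq_zero] at hc
      exact Sph.inclD_injective f hc
    · intro ξ _
      obtain ⟨Y, hY⟩ := projD_surjective f.ne_zero ξ
      have h1 : herm (horC (Sph.incl f) Y) (Sph.incl f) = 0 := by
        unfold horC
        rw [herm_sub_left, herm_smul_left, hf, mul_one, sub_self]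
      obtain ⟨X, hX⟩ := Sph.exists_inclD_eq f (X := horC (Sph.incl f) Y) (by
        rw [← herm_re, h1, Complex.zero_re])
      refine ⟨X, (mem_horizontal_q f X).2 (by rw [hX, h1]), (mfderiv_q f X).trans ?_⟩
      rw [hX]
      exact (projD_horC f.ne_zero Y).trans hY
  isometry f X hX Y hY := by
    have h1 : ∀ Z : onePerp r, herm (Sph.inclD f Z) (Sph.incl f) = 0 →
        horC (Sph.incl f) (Sph.inclD f Z) = Sph.inclD f Z := fun Z hZ => by
      rw [horC, hZ, zero_smul, sub_zero]
    have h2 := fubiniStudy_proj f.l2_incl (Sph.inclD f X) (Sph.inclD f Y)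
    rw [h1 X ((mem_horizontal_q f X).1 hX), h1 Y ((mem_horizontal_q f Y).1 hY), proj_incl,
      ← mfderiv_q f X, ← mfderiv_q f Y] at h2
    exact h2

end CP
end submersion_q

end TwoHS

end

theorem theorem6p1 (s : ℝ) [Fact (5 / 2 < s)] :
    ∃ (Φ : G s → Sph (s - 1)) (Ψ : K s → CP (s - 1)),
      -- the defining formulas of `Φ` and `Ψ`
      (∀ (φ : Diff0 s) (α : HCirc (s - 1)) (x : UnitAddCircle),
        Sph.incl (Φ (φ, α)) x = (√(phiX φ x) : ℂ) * phase (α x)) ∧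
      (∀ (φ : Diff0 s) (α : HCirc (s - 1)), ∃ (f : HC (s - 1)) (hf : f ≠ 0),
        (∀ x, f x = (√(phiX φ x) : ℂ) * phase (α x)) ∧
        Ψ (φ, HCircMod.mk α) = CP.mk f hf) ∧
      -- `Ψ` is a diffeomorphism onto `𝒱^{s-1}` and an isometry
      IsDiffeoOnto (IK s) 𝓘(ℝ, H0C (s - 1)) Ψ (setV (s - 1)) ∧
      PreservesMetric (IK s) 𝓘(ℝ, H0C (s - 1)) metricK fubiniStudy Ψ ∧
      -- `Φ` is a diffeomorphism onto `𝒰^{s-1}` and an isometry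
      IsDiffeoOnto (IG s) 𝓘(ℝ, onePerp (s - 1)) Φ (setU (s - 1)) ∧
      PreservesMetric (IG s) 𝓘(ℝ, onePerp (s - 1)) metricG metricSph Φ ∧
      -- `p` and `q` are Riemannian submersions
      IsRiemannianSubmersion (IG s) (IK s) metricG metricK (p s) ∧
      IsRiemannianSubmersion 𝓘(ℝ, onePerp s) 𝓘(ℝ, H0C s) metricSph fubiniStudy (CP.q s) ∧
      IsRiemannianSubmersion 𝓘(ℝ, onePerp (s - 1)) 𝓘(ℝ, H0C (s - 1)) metricSph fubiniStudy
        (CP.q (s - 1)) ∧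
      -- the diagram commutes
      (∀ g : G s, CP.q (s - 1) (Φ g) = Ψ (p s g)) ∧
      -- the fibres of `p` and `q` are the orbits of the circle, and `Φ` is equivariant
      (∀ g g' : G s, p s g = p s g' ↔ ∃ θ : Circ, g' = (g.1, g.2 + HCirc.const θ)) ∧
      (∀ f f' : Sph (s - 1), CP.q (s - 1) f = CP.q (s - 1) f' ↔
        ∃ θ : Circ, Sph.incl f' = phase θ • Sph.incl f) ∧
      (∀ (φ : Diff0 s) (α : HCirc (s - 1)) (θ : Circ),
        Sph.incl (Φ (φ, α + HCirc.const θ)) = phase θ • Sph.incl (Φ (φ, α))) := by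
  refine ⟨madelung, madelungProj, ?_, ?_, isDiffeoOnto_madelungProj,
    preservesMetric_madelungProj, isDiffeoOnto_madelung, preservesMetric_madelung,
    isRiemannianSubmersion_p, CP.isRiemannianSubmersion_q, CP.isRiemannianSubmersion_q,
    fun g => (madelungProj_p g).symm, p_eq_iff, CP.q_eq_iff, madelungH_add_const⟩
  · exact fun φ α x => madelungH_apply (φ, α) x
  · intro φ α
    exact ⟨madelungH (φ, α), (madelung (φ, α)).ne_zero, madelungH_apply (φ, α),
      madelungProj_p (φ, α)⟩
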